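/- For a directed set $\Lambda$ and a family of C$^*$-algebras $(B_\lambda)_{\lambda\in\Lambda}$ let $\prod_\lambda B_\lambda$ be the C$^*$-algebra of norm-bounded nets $(x_\lambda)$ and $\bigoplus_\lambda B_\lambda$ its closed ideal of nets with $\lim_\lambda\|x_\lambda\|=0$. A linear map between C$^*$-algebras is c.p.c. if it is completely positive and contractive, and it has order $0$ if it maps orthogonal positive elements to orthogonal elements. A C$^*$-algebra $A$ has nuclear dimension at most $\omega$ if there are a nonempty directed set $\Lambda$ and, for $i=0,1,2,\dots$ and $\lambda\in\Lambda$, finite-dimensional C$^*$-algebras $F^i_\lambda$ and c.p.c. maps $\psi^i_\lambda\colon A\to F^i_\lambda$ and $\phi^i_\lambda\colon F^i_\lambda\to A$ such that (1) for every $i$ the induced maps $\psi^i\colon A\to \prod_\lambda F^i_\lambda/\bigoplus_\lambda F^i_\lambda$, $a\mapsto[(\psi^i_\lambda(a))_\lambda]$, and $\phi^i\colon \prod_\lambda F^i_\lambda/\bigoplus_\lambda F^i_\lambda\to \prod_\lambda A/\bigoplus_\lambda A$, $[(x_\lambda)_\lambda]\mapsto[(\phi^i_\lambda(x_\lambda))_\lambda]$,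 are c.p.c. of order $0$; (2) $\iota(a)=\sum_{i=0}^\infty \phi^i\psi^i(a)$ for all $a\in A$, the series being norm convergent, where $\iota\colon A\to\prod_\lambda A/\bigoplus_\lambda A$ is the diagonal embedding. Let $Cu(A)=W(A\otimes\mathcal K)$ be the stabilized Cuntz semigroup of $A$: the set of Cuntz equivalence classes of positive elements of $\bigcup_n M_n(A\otimes\mathcal K)$, where $\mathcal K$ is the algebra of compact operators on $\ell^2(\mathbb N)$, ordered by Cuntz subequivalence and with addition $[a]+[b]=[\mathrm{diag}(a,b)]$. For $x,y\in Cu(A)$ write $x\le_s y$ if $(k+1)x\le ky$ for some $k\in\mathbb N$, and let $\sum_{i=0}^\infty y_i$ denote the supremum in $Cu(A)$ of the partial sums of $(y_i)$. **Theorem.** Let $A$ be a C$^*$-algebra of nuclear dimension at most $\omega$. Then $Cu(A)$ has the $\omega$-comparison property: if $x,y_0,y_1,\dots\in Cu(A)$ satisfy $x\le_s y_i$ for all $i\ge 0$, then $\sum_{i=0}^\infty y_i$ exists and $x\le\sum_{i=0}^\infty y_i$. -/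

import Mathlib

universe u v w

noncomputable section

namespace CuntzComparison

open Filter Topology
open scoped ENNReal CStarAlgebra

set_option linter.unusedSectionVars false

section ProdModSum

variable {L : Type v} [Preorder L] (F : L → Type w) [∀ l, NonUnitalCStarAlgebra (F l)]

/-- The closed ideal `⨁ F l` of `∏ F l` (the algebra of bounded nets), consisting of the nets whose
norms tend to zero. -/
def nullNets : Submodule ℂ (lp F ∞) where
  carrier := {x | Tendsto (fun l => ‖x l‖) atTop (𝓝 0)}
  add_mem' {x y} hx hy := by
    refine squeeze_zero (fun _ => norm_nonneg _) (fun l => ?_) (by simpa using hx.add hy)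
    simpa using norm_add_le (x l) (y l)
  zero_mem' := by simpa using tendsto_const_nhds
  smul_mem' c x hx := by
    have : Tendsto (fun l => ‖c‖ * ‖x l‖) atTop (𝓝 0) := by simpa using hx.const_mul ‖c‖
    simpa [norm_smul] using this

variable {F} in
theorem mem_nullNets {x : lp F ∞} :
    x ∈ nullNets F ↔ Tendsto (fun l => ‖x l‖) atTop (𝓝 0) := Iff.rfl

variable {F} in
theorem mul_mem_nullNets_left (x : lp F ∞) {y : lp F ∞} (hy : y ∈ nullNets F) :
    x * y ∈ nullNets F := by
  rw [mem_nullNets] at *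
  refine squeeze_zero (fun _ => norm_nonneg _) (fun l => ?_) (by simpa using hy.const_mul ‖x‖)
  rw [lp.infty_coeFn_mul]
  exact (norm_mul_le _ _).trans
    (mul_le_mul_of_nonneg_right (lp.norm_apply_le_norm ENNReal.top_ne_zero x l) (norm_nonneg _))

variable {F} in
theorem star_mem_nullNets {x : lp F ∞} (hx : x ∈ nullNets F) : star x ∈ nullNets F := by
  rw [mem_nullNets] at *
  simpa [lp.star_apply] using hx

variable {F} in
theorem mul_mem_nullNets_right {x : lp F ∞} (y : lp F ∞) (hx : x ∈ nullNets F) :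
    x * y ∈ nullNets F := by
  have := star_mem_nullNets (mul_mem_nullNets_left (star y) (star_mem_nullNets hx))
  simpa using this

instance isClosed_nullNets : IsClosed (nullNets F : Set (lp F ∞)) := by
  refine isClosed_of_closure_subset fun x hx => ?_
  rw [SetLike.mem_coe, mem_nullNets, Metric.tendsto_nhds]
  intro e he
  obtain ⟨y, hy, hxy⟩ := Metric.mem_closure_iff.1 hx (e / 2) (by positivity)
  have hy' := (Metric.tendsto_nhds.1 (mem_nullNets.1 hy)) (e / 2) (by positivity)
  filter_upwards [hy'] with l hl
  simp only [dist_zero_right, norm_norm] at hl ⊢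
  have h1 := lp.norm_apply_le_norm ENNReal.top_ne_zero (x - y) l
  rw [dist_eq_norm] at hxy
  have h2 : x l = (x - y) l + y l := by simp
  rw [h2]
  exact (norm_add_le _ _).trans_lt (by linarith)

/-- The quotient C⋆-algebra `∏ F l / ⨁ F l` of bounded nets modulo null nets. -/
def ProdModSum : Type (max v w) := lp F ∞ ⧸ nullNets F

namespace ProdModSum

instance : NormedAddCommGroup (ProdModSum F) :=
  inferInstanceAs (NormedAddCommGroup (lp F ∞ ⧸ nullNets F))

instance : NormedSpace ℂ (ProdModSum F) :=
  inferInstanceAs (NormedSpace ℂ (lp F ∞ ⧸ nullNets F))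

instance : CompleteSpace (ProdModSum F) :=
  inferInstanceAs (CompleteSpace (lp F ∞ ⧸ nullNets F))

/-- The quotient map `∏ F l → ∏ F l / ⨁ F l`. -/
def mk : lp F ∞ →ₗ[ℂ] ProdModSum F := (nullNets F).mkQ

variable {F}

theorem mk_surjective : Function.Surjective (mk F) := (nullNets F).mkQ_surjective

theorem mk_eq_mk {x y : lp F ∞} : mk F x = mk F y ↔ x - y ∈ nullNets F :=
  Submodule.Quotient.eq _

theorem norm_mk_le (x : lp F ∞) : ‖mk F x‖ ≤ ‖x‖ := Submodule.Quotient.norm_mk_le _ x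

theorem exists_norm_lt (x : ProdModSum F) {e : ℝ} (he : 0 < e) :
    ∃ y : lp F ∞, mk F y = x ∧ ‖y‖ < ‖x‖ + e := Submodule.Quotient.norm_mk_lt x he

instance : Mul (ProdModSum F) where
  mul := Quotient.map₂ (· * ·) (by
    intro a b hab c d hcd
    rw [← Quotient.eq_iff_equiv] at hab hcd ⊢
    have h1 : a - b ∈ nullNets F := (Submodule.Quotient.eq _).1 hab
    have h2 : c - d ∈ nullNets F := (Submodule.Quotient.eq _).1 hcd
    refine (Submodule.Quotient.eq (nullNets F)).2 ?_
    have : a * c - b * d = (a - b) * c + b * (c - d) := by noncomm_ring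
    rw [this]
    exact add_mem (mul_mem_nullNets_right c h1) (mul_mem_nullNets_left b h2))

instance : Star (ProdModSum F) where
  star := Quotient.map star (by
    intro a b hab
    rw [← Quotient.eq_iff_equiv] at hab ⊢
    have h1 : a - b ∈ nullNets F := (Submodule.Quotient.eq _).1 hab
    refine (Submodule.Quotient.eq (nullNets F)).2 ?_
    rw [← star_sub]
    exact star_mem_nullNets h1)

theorem mk_mul (x y : lp F ∞) : mk F (x * y) = mk F x * mk F y := rfl

theorem mk_star (x : lp F ∞) : mk F (star x) = star (mk F x) := rfl

instance : NonUnitalNormedRing (ProdModSum F) where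
  __ := (inferInstance : NormedAddCommGroup (ProdModSum F))
  __ := (inferInstance : Mul (ProdModSum F))
  left_distrib a b c := by
    obtain ⟨a, rfl⟩ := mk_surjective a
    obtain ⟨b, rfl⟩ := mk_surjective b
    obtain ⟨c, rfl⟩ := mk_surjective c
    simp only [← map_add, ← mk_mul, mul_add]
  right_distrib a b c := by
    obtain ⟨a, rfl⟩ := mk_surjective a
    obtain ⟨b, rfl⟩ := mk_surjective b
    obtain ⟨c, rfl⟩ := mk_surjective c
    simp only [← map_add, ← mk_mul, add_mul]
  zero_mul a := by
    obtain ⟨a, rfl⟩ := mk_surjective a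
    rw [← map_zero (mk F), ← mk_mul, zero_mul]
  mul_zero a := by
    obtain ⟨a, rfl⟩ := mk_surjective a
    rw [← map_zero (mk F), ← mk_mul, mul_zero]
  mul_assoc a b c := by
    obtain ⟨a, rfl⟩ := mk_surjective a
    obtain ⟨b, rfl⟩ := mk_surjective b
    obtain ⟨c, rfl⟩ := mk_surjective c
    simp only [← mk_mul, mul_assoc]
  norm_mul_le a b := by
    have key : ∀ e : ℝ, 0 < e → ‖a * b‖ ≤ (‖a‖ + e) * (‖b‖ + e) := by
      intro e he
      obtain ⟨x, hx, hx'⟩ := exists_norm_lt a he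
      obtain ⟨y, hy, hy'⟩ := exists_norm_lt b he
      rw [← hx, ← hy, ← mk_mul, hx, hy]
      exact (norm_mk_le _).trans ((norm_mul_le _ _).trans
        (mul_le_mul hx'.le hy'.le (norm_nonneg _) (by positivity)))
    have hlim : Tendsto (fun e : ℝ => (‖a‖ + e) * (‖b‖ + e)) (𝓝[>] 0) (𝓝 (‖a‖ * ‖b‖)) := by
      have : Continuous fun e : ℝ => (‖a‖ + e) * (‖b‖ + e) := by fun_prop
      simpa using (this.tendsto 0).mono_left nhdsWithin_le_nhds
    exact ge_of_tendsto hlim (by filter_upwards [self_mem_nhdsWithin] with e he using key e he)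

instance : StarRing (ProdModSum F) where
  star_involutive a := by
    obtain ⟨a, rfl⟩ := mk_surjective a
    rw [← mk_star, ← mk_star, star_star]
  star_mul a b := by
    obtain ⟨a, rfl⟩ := mk_surjective a
    obtain ⟨b, rfl⟩ := mk_surjective b
    simp only [← mk_mul, ← mk_star, star_mul]
  star_add a b := by
    obtain ⟨a, rfl⟩ := mk_surjective a
    obtain ⟨b, rfl⟩ := mk_surjective b
    simp only [← map_add, ← mk_star, star_add]

/-- The norm of a class is bounded by any eventual bound of the norms of a representing net. -/
theorem norm_mk_le_of_eventually (x : lp F ∞) {r : ℝ} (hr : 0 ≤ r)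
    (h : ∀ᶠ l in atTop, ‖x l‖ ≤ r) : ‖mk F x‖ ≤ r := by
  classical
  let y : lp F ∞ := ⟨fun l => if ‖x l‖ ≤ r then x l else 0, by
    refine memℓp_infty ⟨r, ?_⟩
    rintro _ ⟨l, rfl⟩
    dsimp only
    split_ifs with hl
    · exact hl
    · simpa using hr⟩
  have hxy : mk F x = mk F y := by
    rw [mk_eq_mk, mem_nullNets]
    refine tendsto_const_nhds.congr' ?_
    filter_upwards [h] with l hl
    have : y l = x l := if_pos hl
    simp [this]
  rw [hxy]
  refine (norm_mk_le y).trans (lp.norm_le_of_forall_le hr fun l => ?_)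
  change ‖if ‖x l‖ ≤ r then x l else 0‖ ≤ r
  split_ifs with hl
  · exact hl
  · simpa using hr

/-- Every number above the norm of a class eventually bounds the norms of a representing net. -/
theorem eventually_norm_lt (x : lp F ∞) {r : ℝ} (hr : ‖mk F x‖ < r) :
    ∀ᶠ l in atTop, ‖x l‖ < r := by
  obtain ⟨y, hy, hyr⟩ := exists_norm_lt (mk F x) (half_pos (sub_pos.2 hr))
  have hd := (Metric.tendsto_nhds.1 (mem_nullNets.1 (mk_eq_mk.1 hy.symm))) _
    (half_pos (sub_pos.2 hr))
  filter_upwards [hd] with l hl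
  have h1 := lp.norm_apply_le_norm ENNReal.top_ne_zero y l
  have h2 : x l = (x - y) l + y l := by simp
  simp only [dist_zero_right, norm_norm] at hl
  rw [h2]
  exact (norm_add_le _ _).trans_lt (by linarith)

instance : CStarRing (ProdModSum F) where
  norm_mul_self_le a := by
    obtain ⟨x, rfl⟩ := mk_surjective a
    refine le_of_forall_pos_le_add fun e he => ?_
    have h := eventually_norm_lt (star x * x) (r := ‖star (mk F x) * mk F x‖ + e)
      (by rw [mk_mul, mk_star]; linarith)
    set r := ‖star (mk F x) * mk F x‖ + e with hr
    have hr0 : 0 ≤ r := by positivity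
    have h2 : ‖mk F x‖ ≤ √r := by
      refine norm_mk_le_of_eventually x (Real.sqrt_nonneg _) ?_
      filter_upwards [h] with l hl
      rw [lp.infty_coeFn_mul, Pi.mul_apply, lp.star_apply, CStarRing.norm_star_mul_self] at hl
      exact Real.le_sqrt_of_sq_le (by rw [sq]; exact hl.le)
    calc ‖mk F x‖ * ‖mk F x‖ ≤ √r * √r := by gcongr
      _ = r := Real.mul_self_sqrt hr0

instance : NonUnitalCStarAlgebra (ProdModSum F) where
  smul_assoc c a b := by
    obtain ⟨a, rfl⟩ := mk_surjective a
    obtain ⟨b, rfl⟩ := mk_surjective b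
    simp only [smul_eq_mul, ← mk_mul, ← map_smul, smul_mul_assoc]
  smul_comm c a b := by
    obtain ⟨a, rfl⟩ := mk_surjective a
    obtain ⟨b, rfl⟩ := mk_surjective b
    simp only [smul_eq_mul, ← mk_mul, ← map_smul, mul_smul_comm]
  star_smul c a := by
    obtain ⟨a, rfl⟩ := mk_surjective a
    simp only [← mk_star, ← map_smul, star_smul]

instance : PartialOrder (ProdModSum F) := CStarAlgebra.spectralOrder _

instance : StarOrderedRing (ProdModSum F) := CStarAlgebra.spectralOrderedRing _

section maps

variable {E : L → Type*} [∀ l, NonUnitalCStarAlgebra (E l)]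

/-- A family of linear contractions, acting on bounded nets. -/
def lpMap (T : ∀ l, E l →ₗ[ℂ] F l) (hT : ∀ l x, ‖T l x‖ ≤ ‖x‖) : lp E ∞ →ₗ[ℂ] lp F ∞ where
  toFun x := ⟨fun l => T l (x l), memℓp_infty ⟨‖x‖, by
    rintro _ ⟨l, rfl⟩
    exact (hT l _).trans (lp.norm_apply_le_norm ENNReal.top_ne_zero x l)⟩⟩
  map_add' x y := by ext l; exact map_add (T l) _ _
  map_smul' c x := by ext l; exact map_smul (T l) _ _

/-- The map `∏ E l / ⨁ E l → ∏ F l / ⨁ F l` induced by a family of linear contractions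
`E l → F l`. -/
def map (T : ∀ l, E l →ₗ[ℂ] F l) (hT : ∀ l x, ‖T l x‖ ≤ ‖x‖) : ProdModSum E →ₗ[ℂ] ProdModSum F :=
  (nullNets E).mapQ (nullNets F) (lpMap T hT) fun x hx =>
    squeeze_zero (fun _ => norm_nonneg _) (fun l => hT l (x l)) hx

end maps

variable (L) in
/-- The diagonal embedding `ι` of `A` into `∏ A / ⨁ A`, sending `a` to the class of the constant
net `a`. -/
def diag (A : Type u) [NonUnitalCStarAlgebra A] : A →ₗ[ℂ] ProdModSum (fun _ : L => A) :=
  mk (fun _ : L => A) ∘ₗ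
    { toFun a := ⟨fun _ => a, memℓp_infty ⟨‖a‖, by rintro _ ⟨l, rfl⟩; exact le_rfl⟩⟩
      map_add' _ _ := rfl
      map_smul' _ _ := rfl }

end ProdModSum

end ProdModSum

section Stabilization

variable (A : Type u) [NonUnitalCStarAlgebra A] [PartialOrder A] [StarOrderedRing A]

/-- `M_m(A)`. -/
abbrev Mat (m : ℕ) : Type u := CStarMatrix (Fin m) (Fin m) A

/-- The union `M_∞(A) = ⋃ M_n(A)` along the embeddings `a ↦ diag (a, 0)`, as a subalgebra of
`∏ M_m(A) / ⨁ M_m(A)`: a finitely supported matrix `a` over `ℕ` is represented by the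
sequence whose `m`-th term, for all large `m`, is the upper left `m × m` corner of `a`. -/
def finMatrices : NonUnitalStarSubalgebra ℂ (ProdModSum (Mat A)) where
  carrier := {x | ∃ y : lp (Mat A) ∞, ProdModSum.mk _ y = x ∧ ∃ (n : ℕ) (a : ℕ → ℕ → A),
    (∀ i j, n ≤ i ∨ n ≤ j → a i j = 0) ∧ ∀ m, n ≤ m → ∀ i j : Fin m, y m i j = a i j}
  add_mem' := by
    rintro _ _ ⟨y, rfl, n, a, ha, hy⟩ ⟨z, rfl, k, b, hb, hz⟩
    refine ⟨y + z, map_add _ _ _, max n k, fun i j => a i j + b i j, fun i j h => ?_,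
      fun m hm i j => ?_⟩
    · simp only [ha i j (by omega), hb i j (by omega), add_zero]
    · exact congrArg₂ (· + ·) (hy m (by omega) i j) (hz m (by omega) i j)
  zero_mem' := ⟨0, map_zero _, 0, fun _ _ => 0, fun _ _ _ => rfl, fun _ _ _ _ => rfl⟩
  mul_mem' := by
    rintro _ _ ⟨y, rfl, n, a, ha, hy⟩ ⟨z, rfl, k, b, hb, hz⟩
    refine ⟨y * z, ProdModSum.mk_mul _ _, max n k,
      fun i j => ∑ p ∈ Finset.range (max n k), a i p * b p j, fun i j h => ?_,
      fun m hm i j => ?_⟩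
    · refine Finset.sum_eq_zero fun p _ => ?_
      rcases h with h | h
      · rw [ha i p (by omega), zero_mul]
      · rw [hb p j (by omega), mul_zero]
    · rw [lp.infty_coeFn_mul, Pi.mul_apply, CStarMatrix.mul_apply]
      simp only [hy m (by omega), hz m (by omega)]
      rw [Fin.sum_univ_eq_sum_range (fun p => a i p * b p j)]
      refine (Finset.sum_subset (Finset.range_mono hm) fun p _ hp => ?_).symm
      rw [Finset.mem_range] at hp
      rw [ha i p (by omega), zero_mul]
  smul_mem' := by
    rintro c _ ⟨y, rfl, n, a, ha, hy⟩
    refine ⟨c • y, map_smul _ _ _, n, fun i j => c • a i j, fun i j h => ?_, fun m hm i j => ?_⟩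
    · simp only [ha i j h, smul_zero]
    · exact congrArg (c • ·) (hy m hm i j)
  star_mem' := by
    rintro _ ⟨y, rfl, n, a, ha, hy⟩
    refine ⟨star y, ProdModSum.mk_star _, n, fun i j => star (a j i), fun i j h => ?_,
      fun m hm i j => ?_⟩
    · simp only [ha j i h.symm, star_zero]
    · exact congrArg star (hy m hm j i)

/-- The stabilization `A ⊗ 𝒦`: the C⋆-algebraic inductive limit of the matrix algebras `M_n(A)`
along `a ↦ diag (a, 0)`, realized as the norm closure of `⋃ M_n(A)` in
`∏ M_m(A) / ⨁ M_m(A)`. -/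
def Stab : Type u := (finMatrices A).topologicalClosure

instance : NonUnitalCStarAlgebra (Stab A) :=
  NonUnitalStarSubalgebra.nonUnitalCStarAlgebra (finMatrices A).topologicalClosure
    (h_closed := (finMatrices A).isClosed_topologicalClosure)

instance : PartialOrder (Stab A) := CStarAlgebra.spectralOrder _

instance : StarOrderedRing (Stab A) := CStarAlgebra.spectralOrderedRing _

end Stabilization

section Cuntz

variable {B : Type u} [NonUnitalCStarAlgebra B] [PartialOrder B] [StarOrderedRing B]

/-- Cuntz subequivalence of a (positive) `m × m` matrix `a` and a (positive) `n × n` matrix `b`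
over `B`: there are `n × m` matrices `d` over `B` for which `d⋆ b d` is arbitrarily close to `a`. -/
def CuntzLE {m n : Type} [Fintype m] [Fintype n] (a : CStarMatrix m m B) (b : CStarMatrix n n B) :
    Prop :=
  a ∈ closure (Set.range fun d : CStarMatrix n m B => d.conjTranspose * b * d)

theorem mulAssoc {k l m n : Type} [Fintype l] [Fintype m] (x : CStarMatrix k l B)
    (y : CStarMatrix l m B) (z : CStarMatrix m n B) : x * y * z = x * (y * z) :=
  Matrix.mul_assoc (α := B) x y z

theorem conjTransposeMul {l m n : Type} [Fintype m] (x : CStarMatrix l m B)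
    (y : CStarMatrix m n B) : (x * y).conjTranspose = y.conjTranspose * x.conjTranspose :=
  Matrix.conjTranspose_mul (α := B) x y

theorem continuousMul {l m n : Type} [Fintype l] [Fintype m] [Fintype n] :
    Continuous fun p : CStarMatrix l m B × CStarMatrix m n B => p.1 * p.2 := by
  refine continuous_pi fun i => continuous_pi fun j => ?_
  refine continuous_finsetSum _ fun k _ => ?_
  have h1 : Continuous fun p : CStarMatrix l m B × CStarMatrix m n B => p.1 i k :=
    (continuous_apply k).comp ((continuous_apply i).comp continuous_fst)
  have h2 : Continuous fun p : CStarMatrix l m B × CStarMatrix m n B => p.2 k j :=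
    (continuous_apply j).comp ((continuous_apply k).comp continuous_snd)
  exact h1.mul h2

theorem CuntzLE.trans {k m n : Type} [Fintype k] [Fintype m] [Fintype n] {a : CStarMatrix k k B}
    {b : CStarMatrix m m B} {c : CStarMatrix n n B} (hab : CuntzLE a b) (hbc : CuntzLE b c) :
    CuntzLE a c := by
  refine closure_minimal ?_ isClosed_closure hab
  rintro _ ⟨d, rfl⟩
  have hcont : Continuous fun x : CStarMatrix m m B => d.conjTranspose * x * d :=
    continuousMul.comp
      ((continuousMul.comp (continuous_const.prodMk continuous_id)).prodMk continuous_const)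
  refine map_mem_closure (f := fun x : CStarMatrix m m B => d.conjTranspose * x * d) hcont hbc ?_
  rintro _ ⟨e, rfl⟩
  refine ⟨e * d, ?_⟩
  simp only [conjTransposeMul, mulAssoc]

/-- The matrix `(b (e i) (e j))` obtained from `b` by relabelling the indices. -/
def relabel {m n : Type} (b : CStarMatrix n n B) (e : m ≃ n) : CStarMatrix m m B :=
  CStarMatrix.ofMatrix fun i j => b (e i) (e j)

theorem relabel_apply {m n : Type} (b : CStarMatrix n n B) (e : m ≃ n) (i j : m) :
    relabel b e i j = b (e i) (e j) := rfl

theorem relabel_cuntzLE {m n : Type} [Fintype m] [Fintype n] (b : CStarMatrix n n B)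
    (e : m ≃ n) : CuntzLE (relabel b e) b := by
  have hu := CStarAlgebra.increasingApproximateUnit (CStarMatrix m m B)
  set a := relabel b e with ha
  have h1 : Tendsto (fun u : CStarMatrix m m B => star u * a * u)
      (CStarAlgebra.approximateUnit (CStarMatrix m m B)) (𝓝 a) := by
    have hl : Tendsto (fun u : CStarMatrix m m B => a * u)
      (CStarAlgebra.approximateUnit (CStarMatrix m m B)) (𝓝 a) := hu.tendsto_mul_left a
    have hr : Tendsto (fun u : CStarMatrix m m B => u * a)
      (CStarAlgebra.approximateUnit (CStarMatrix m m B)) (𝓝 a) := hu.tendsto_mul_right a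
    rw [tendsto_iff_norm_sub_tendsto_zero] at *
    refine squeeze_zero' (.of_forall fun _ => norm_nonneg _) ?_ (by simpa using hl.add hr)
    filter_upwards [hu.eventually_norm, hu.eventually_star_eq] with u hu1 hu2
    have : star u * a * u - a = u * (a * u - a) + (u * a - a) := by
      rw [hu2]; noncomm_ring
    rw [this]
    refine (norm_add_le _ _).trans (add_le_add_left ?_ _)
    calc ‖u * (a * u - a)‖ ≤ ‖u‖ * ‖a * u - a‖ := norm_mul_le _ _
      _ ≤ 1 * ‖a * u - a‖ := by gcongr
      _ = _ := one_mul _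
  refine mem_closure_of_tendsto h1 (.of_forall fun u => ?_)
  refine ⟨CStarMatrix.ofMatrix fun i j => u (e.symm i) j, ?_⟩
  have hd : ∀ i j, CStarMatrix.ofMatrix (fun i j => u (e.symm i) j) (e i) j = u i j := fun i j =>
    congrArg (u · j) (e.symm_apply_apply i)
  ext i j
  simp only [CStarMatrix.mul_apply, CStarMatrix.conjTranspose_apply, CStarMatrix.star_apply, ha,
    relabel_apply, ← e.sum_comp, hd]

theorem cuntzLE_relabel {m n : Type} [Fintype m] [Fintype n] (b : CStarMatrix n n B)
    (e : m ≃ n) : CuntzLE b (relabel b e) := by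
  have := relabel_cuntzLE (relabel b e) e.symm
  have h : relabel (relabel b e) e.symm = b := by
    ext i j
    simp only [relabel_apply, Equiv.apply_symm_apply]
  rwa [h] at this

theorem CuntzLE.refl {m : Type} [Fintype m] (a : CStarMatrix m m B) : CuntzLE a a :=
  relabel_cuntzLE a (Equiv.refl m)

/-- The block diagonal matrix `diag (a, b)`. -/
def blockDiag {k l m n : Type} (a : CStarMatrix k l B) (b : CStarMatrix m n B) :
    CStarMatrix (k ⊕ m) (l ⊕ n) B :=
  CStarMatrix.ofMatrix (Matrix.fromBlocks a 0 0 b)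

theorem blockDiag_mul {i j k l m n : Type} [Fintype k] [Fintype l] (a : CStarMatrix i k B)
    (b : CStarMatrix j l B) (c : CStarMatrix k m B) (d : CStarMatrix l n B) :
    blockDiag a b * blockDiag c d = blockDiag (a * c) (b * d) := by
  ext (x | x) (y | y) <;>
    simp [blockDiag, CStarMatrix.mul_apply, Matrix.fromBlocks]

theorem blockDiag_conjTranspose {k l m n : Type} (a : CStarMatrix k l B) (b : CStarMatrix m n B) :
    (blockDiag a b).conjTranspose = blockDiag a.conjTranspose b.conjTranspose := by
  refine (Matrix.fromBlocks_conjTranspose (α := B) a 0 0 b).trans ?_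
  simp only [Matrix.conjTranspose_zero]
  rfl

theorem CuntzLE.blockDiag {k l m n : Type} [Fintype k] [Fintype l] [Fintype m] [Fintype n]
    {a : CStarMatrix k k B} {b : CStarMatrix l l B} {c : CStarMatrix m m B}
    {d : CStarMatrix n n B} (h : CuntzLE a c) (h' : CuntzLE b d) :
    CuntzLE (blockDiag a b) (blockDiag c d) := by
  have hcont : Continuous fun p : CStarMatrix k k B × CStarMatrix l l B =>
      CuntzComparison.blockDiag p.1 p.2 :=
    Continuous.matrix_fromBlocks (R := B) continuous_fst continuous_const continuous_const
      continuous_snd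
  refine map_mem_closure₂ (f := fun (x : CStarMatrix k k B) (y : CStarMatrix l l B) =>
    CuntzComparison.blockDiag x y) hcont h h' ?_
  rintro _ ⟨x, rfl⟩ _ ⟨y, rfl⟩
  refine ⟨CuntzComparison.blockDiag x y, ?_⟩
  simp only [blockDiag_conjTranspose, blockDiag_mul]

theorem exists_eq_star_mul_self {C : Type*} [NonUnitalCStarAlgebra C] [PartialOrder C]
    [StarOrderedRing C] {a : C} (ha : 0 ≤ a) : ∃ c, a = star c * c :=
  CStarAlgebra.nonneg_iff_eq_star_mul_self.1 ha

theorem blockDiag_nonneg {m n : Type} [Fintype m] [Fintype n] {a : CStarMatrix m m B}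
    {b : CStarMatrix n n B} (ha : 0 ≤ a) (hb : 0 ≤ b) : 0 ≤ blockDiag a b := by
  obtain ⟨c, rfl⟩ := exists_eq_star_mul_self ha
  obtain ⟨d, rfl⟩ := exists_eq_star_mul_self hb
  have h : blockDiag (star c * c) (star d * d) = star (blockDiag c d) * blockDiag c d := by
    rw [CStarMatrix.star_eq_conjTranspose, CStarMatrix.star_eq_conjTranspose,
      CStarMatrix.star_eq_conjTranspose, blockDiag_conjTranspose]
    exact (blockDiag_mul _ _ _ _).symm
  rw [h]
  exact star_mul_self_nonneg _

theorem relabel_nonneg {m n : Type} [Fintype m] [Fintype n] {b : CStarMatrix n n B}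
    (hb : 0 ≤ b) (e : m ≃ n) : 0 ≤ relabel b e := by
  obtain ⟨c, rfl⟩ := exists_eq_star_mul_self hb
  have h : relabel (star c * c) e = star (relabel c e) * relabel c e := by
    ext i j
    simp only [relabel_apply, CStarMatrix.mul_apply, CStarMatrix.star_apply, ← e.sum_comp]
  rw [h]
  exact star_mul_self_nonneg _

end Cuntz

section CuntzSemigroup

variable (B : Type u) [NonUnitalCStarAlgebra B] [PartialOrder B] [StarOrderedRing B]

/-- `⋃ M_n(B)₊`: the positive square matrices over `B`, of all sizes. -/
def PosMat : Type u := Σ n : ℕ, {a : Mat B n // 0 ≤ a}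

variable {B}

/-- Positive matrices preordered by Cuntz subequivalence. -/
instance : Preorder (PosMat B) where
  le a b := CuntzLE a.2.1 b.2.1
  le_refl a := CuntzLE.refl _
  le_trans _ _ _ := CuntzLE.trans

/-- `a ⊕ b = diag (a, b)`. -/
instance : Add (PosMat B) where
  add a b := ⟨a.1 + b.1, relabel (blockDiag a.2.1 b.2.1) finSumFinEquiv.symm,
    relabel_nonneg (blockDiag_nonneg a.2.2 b.2.2) _⟩

instance : Zero (PosMat B) where
  zero := ⟨0, 0, le_rfl⟩

namespace PosMat

theorem add_le_add {a b c d : PosMat B} (h : a ≤ c) (h' : b ≤ d) : a + b ≤ c + d :=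
  (relabel_cuntzLE _ _).trans ((CuntzLE.blockDiag h h').trans (cuntzLE_relabel _ _))

theorem add_comm_le (a b : PosMat B) : a + b ≤ b + a := by
  have h : blockDiag a.2.1 b.2.1 = relabel (blockDiag b.2.1 a.2.1) (Equiv.sumComm _ _) := by
    ext (i | i) (j | j) <;> rfl
  refine (relabel_cuntzLE _ _).trans (CuntzLE.trans ?_ (cuntzLE_relabel _ _))
  rw [h]
  exact relabel_cuntzLE _ _

theorem add_assoc_aux (a b c : PosMat B) : a + b + c ≤ a + (b + c) ∧ a + (b + c) ≤ a + b + c := by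
  have h : blockDiag (blockDiag a.2.1 b.2.1) c.2.1 =
      relabel (blockDiag a.2.1 (blockDiag b.2.1 c.2.1)) (Equiv.sumAssoc _ _ _) := by
    ext ((i | i) | i) ((j | j) | j) <;> rfl
  have l1 : CuntzLE (a + b + c).2.1 (blockDiag (blockDiag a.2.1 b.2.1) c.2.1) :=
    (relabel_cuntzLE _ _).trans (CuntzLE.blockDiag (relabel_cuntzLE _ _) (CuntzLE.refl _))
  have l2 : CuntzLE (blockDiag (blockDiag a.2.1 b.2.1) c.2.1) (a + b + c).2.1 :=
    (CuntzLE.blockDiag (cuntzLE_relabel _ _) (CuntzLE.refl _)).trans (cuntzLE_relabel _ _)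
  have r1 : CuntzLE (a + (b + c)).2.1 (blockDiag a.2.1 (blockDiag b.2.1 c.2.1)) :=
    (relabel_cuntzLE _ _).trans (CuntzLE.blockDiag (CuntzLE.refl _) (relabel_cuntzLE _ _))
  have r2 : CuntzLE (blockDiag a.2.1 (blockDiag b.2.1 c.2.1)) (a + (b + c)).2.1 :=
    (CuntzLE.blockDiag (CuntzLE.refl _) (cuntzLE_relabel _ _)).trans (cuntzLE_relabel _ _)
  rw [h] at l1 l2
  exact ⟨l1.trans ((relabel_cuntzLE _ _).trans r2), r1.trans ((cuntzLE_relabel _ _).trans l2)⟩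

theorem zero_add_aux (a : PosMat B) : 0 + a ≤ a ∧ a ≤ 0 + a := by
  have h : blockDiag (0 : PosMat B).2.1 a.2.1 = relabel a.2.1 (Equiv.emptySum (Fin 0) _) := by
    ext (i | i) (j | j)
    · exact i.elim0
    · exact i.elim0
    · exact j.elim0
    · rfl
  have h1 : CuntzLE (0 + a).2.1 (blockDiag (0 : PosMat B).2.1 a.2.1) := relabel_cuntzLE _ _
  have h2 : CuntzLE (blockDiag (0 : PosMat B).2.1 a.2.1) (0 + a).2.1 := cuntzLE_relabel _ _
  rw [h] at h1 h2
  exact ⟨h1.trans (relabel_cuntzLE _ _), (cuntzLE_relabel _ _).trans h2⟩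

end PosMat

variable (B) in
/-- The ordered semigroup `W(B)` of Cuntz equivalence classes of positive matrices over `B`, with
order induced by Cuntz subequivalence. -/
def CuntzW : Type u := Antisymmetrization (PosMat B) (· ≤ ·)

instance : PartialOrder (CuntzW B) :=
  inferInstanceAs (PartialOrder (Antisymmetrization (PosMat B) (· ≤ ·)))

/-- The class `[a]` of a positive matrix. -/
def CuntzW.mk (a : PosMat B) : CuntzW B := toAntisymmetrization (· ≤ ·) a

theorem CuntzW.mk_le_mk {a b : PosMat B} : CuntzW.mk a ≤ CuntzW.mk b ↔ a ≤ b := Iff.rfl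

theorem CuntzW.ind {p : CuntzW B → Prop} (h : ∀ a, p (CuntzW.mk a)) (x : CuntzW B) : p x :=
  Antisymmetrization.ind _ h x

/-- Addition on `W(B)` is `[a] + [b] = [diag (a, b)]`. -/
instance : Add (CuntzW B) where
  add := Quotient.map₂ (· + ·) fun _ _ h _ _ h' =>
    ⟨PosMat.add_le_add h.1 h'.1, PosMat.add_le_add h.2 h'.2⟩

instance : Zero (CuntzW B) where
  zero := CuntzW.mk 0

instance : AddCommMonoid (CuntzW B) where
  add_assoc x y z := by
    induction x using CuntzW.ind
    induction y using CuntzW.ind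
    induction z using CuntzW.ind
    exact Quotient.sound (PosMat.add_assoc_aux _ _ _)
  zero_add x := by
    induction x using CuntzW.ind
    exact Quotient.sound (PosMat.zero_add_aux _)
  add_zero x := by
    induction x using CuntzW.ind with
    | h a =>
      exact Quotient.sound ⟨(PosMat.add_comm_le a 0).trans (PosMat.zero_add_aux a).1,
        (PosMat.zero_add_aux a).2.trans (PosMat.add_comm_le 0 a)⟩
  add_comm x y := by
    induction x using CuntzW.ind
    induction y using CuntzW.ind
    exact Quotient.sound ⟨PosMat.add_comm_le _ _, PosMat.add_comm_le _ _⟩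
  nsmul := nsmulRec

theorem CuntzW.mk_add (a b : PosMat B) : CuntzW.mk (a + b) = CuntzW.mk a + CuntzW.mk b := rfl

instance : IsOrderedAddMonoid (CuntzW B) where
  add_le_add_left x y h z := by
    induction x using CuntzW.ind
    induction y using CuntzW.ind
    induction z using CuntzW.ind
    exact PosMat.add_le_add h le_rfl

/-- The stabilized Cuntz semigroup `Cu(A) = W(A ⊗ 𝒦)`. -/
abbrev Cu (A : Type u) [NonUnitalCStarAlgebra A] [PartialOrder A] [StarOrderedRing A] : Type u :=
  CuntzW (Stab A)

end CuntzSemigroup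

section Comparison

variable {S : Type u} [AddCommMonoid S] [PartialOrder S]

/-- The relation `x ≤ₛ y`: `(k + 1) x ≤ k y` for some natural number `k`. -/
def LEs (x y : S) : Prop := ∃ k : ℕ, (k + 1) • x ≤ k • y

variable (S) in
/-- The `ω`-comparison property: if `x ≤ₛ y i` for all `i`, then the infinite sum of the `y i`, that
is the supremum of the partial sums, exists and is above `x`. -/
def OmegaComparison : Prop :=
  ∀ (x : S) (y : ℕ → S), (∀ i, LEs x (y i)) →
    ∃ s : S, IsLUB (Set.range fun n : ℕ => ∑ i ∈ Finset.range n, y i) s ∧ x ≤ s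

end Comparison

section NuclearDimension

section maps

variable {A : Type*} {B : Type*} [NonUnitalCStarAlgebra A] [PartialOrder A] [StarOrderedRing A]
  [NonUnitalCStarAlgebra B] [PartialOrder B] [StarOrderedRing B]

/-- `f` is a completely positive contraction. -/
structure IsCPC (f : A →ₗ[ℂ] B) : Prop where
  completelyPositive : ∃ g : A →CP B, g.toLinearMap = f
  contractive : ∀ a, ‖f a‖ ≤ ‖a‖

/-- `f` has order zero: it preserves orthogonality of positive elements. -/
def IsOrderZero (f : A →ₗ[ℂ] B) : Prop :=
  ∀ a b : A, 0 ≤ a → 0 ≤ b → a * b = 0 → f a * f b = 0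

end maps

section induced

variable {L : Type v} [Preorder L] {A : Type u} [NonUnitalCStarAlgebra A] [PartialOrder A]
  [StarOrderedRing A] {F : L → Type w} [∀ l, NonUnitalCStarAlgebra (F l)]
  [∀ l, PartialOrder (F l)] [∀ l, StarOrderedRing (F l)]

/-- The map `A → ∏ F l / ⨁ F l` induced by a net of c.p.c. maps `ψ l : A → F l`, sending `a` to
the class of the net `(ψ l a)`. -/
def inducedIn {ψ : ∀ l, A →ₗ[ℂ] F l} (hψ : ∀ l, IsCPC (ψ l)) : A →ₗ[ℂ] ProdModSum F :=
  ProdModSum.map ψ (fun l => (hψ l).contractive) ∘ₗ ProdModSum.diag L A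

/-- The map `∏ F l / ⨁ F l → ∏ A / ⨁ A` induced by a net of c.p.c. maps `φ l : F l → A`, sending
the class of `(x l)` to the class of `(φ l (x l))`. -/
def inducedOut {φ : ∀ l, F l →ₗ[ℂ] A} (hφ : ∀ l, IsCPC (φ l)) :
    ProdModSum F →ₗ[ℂ] ProdModSum (fun _ : L => A) :=
  ProdModSum.map φ fun l => (hφ l).contractive

end induced

/-- `A` has nuclear dimension at most `ω`: there are nets, over a directed set `L`, of completely
positive contractions `ψ i l : A → F i l` and `φ i l : F i l → A`, for `i = 0, 1, 2, …`, through
finite-dimensional C⋆-algebras `F i l`, such that the induced maps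
`A → ∏ F i l / ⨁ F i l` and `∏ F i l / ⨁ F i l → ∏ A / ⨁ A` are completely positive contractions
of order zero, and the series of their compositions converges in norm to the diagonal embedding,
pointwise on `A`. -/
def NuclearDimLEOmega (A : Type u) [NonUnitalCStarAlgebra A] [PartialOrder A]
    [StarOrderedRing A] : Prop :=
  ∃ (L : Type v) (_ : Preorder L) (_ : IsDirectedOrder L) (_ : Nonempty L)
    (F : ℕ → L → Type w) (_ : ∀ i l, NonUnitalCStarAlgebra (F i l))
    (_ : ∀ i l, PartialOrder (F i l)) (_ : ∀ i l, StarOrderedRing (F i l))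
    (_ : ∀ i l, FiniteDimensional ℂ (F i l))
    (ψ : ∀ i l, A →ₗ[ℂ] F i l) (φ : ∀ i l, F i l →ₗ[ℂ] A)
    (hψ : ∀ i l, IsCPC (ψ i l)) (hφ : ∀ i l, IsCPC (φ i l)),
    (∀ i, IsCPC (inducedIn (hψ i)) ∧ IsOrderZero (inducedIn (hψ i))) ∧
    (∀ i, IsCPC (inducedOut (hφ i)) ∧ IsOrderZero (inducedOut (hφ i))) ∧
    ∀ a : A, Tendsto
      (fun n : ℕ => ∑ i ∈ Finset.range n, inducedOut (hφ i) (inducedIn (hψ i) a))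
      atTop (𝓝 (ProdModSum.diag L A a))

end NuclearDimension

end CuntzComparison

end

/-! Write x = [a] and y_i = [b_i] with positive a, b_i in `Stab A`. Such representatives, and the
supremum of the partial sums, come from a sequence of isometries with orthogonal ranges
(`exists_isometries`, `exists_cls_eq`, `exists_isLUB_cls`). It then suffices to approximate a, for
every e > 0, by a finite sum ∑ x_i⋆ b_i x_i, since such a sum is Cuntz below the diagonal matrix of
the b_i.

As a is close to a finite sum of the φ_i ψ_i(a), it is enough that each φ_i ψ_i(a) be asymptotically
Cuntz below b_i. Fix i and write (k + 1)[a] ≤ k[b]. Since ψ is asymptotically of order zero, this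
passes to a comparison of k + 1 copies of ψ(a) with k copies of ψ(b) in a finite-dimensional
algebra. There a dimension count removes the multiplicities
(`exists_conj_near_of_finiteDimensional`): ψ(a) is close to r⋆ ψ(b) r, with a bound on r that does
not depend on the index of the net. Since φ is asymptotically of order zero, φ(r⋆ ψ(b) r) is Cuntz
below φψ(b), and φψ(b) is asymptotically dominated by b because it is one of the positive terms that
sum to b. This is `OrderZeroNet.exists_near`.

Both uses of order zero rest on the identity f(xy) f(z) = f(x) f(yz) of `IsCPC.map_mul_map`. It
gives f(xyz) f(u) f(w) = f(x) f(y) f(zuw), which is why cubes appear; `Sub.of_cube_eq` turns a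
factorization of a cube back into a Cuntz subequivalence.

The maps act on A while the elements lie in A ⊗ 𝒦. Compression by an approximate unit moves the
comparison into some M_n(A), and the entrywise amplifications of the maps keep all the properties
used (`OrderZeroNet.amp`). `exists_sum_near_of_ampSub` makes the choices in a consistent order. -/

noncomputable section

namespace CuntzComparison

open Filter Topology
open scoped ENNReal CStarAlgebra

set_option linter.unusedSectionVars false

/-! ### Cuntz subequivalence inside one C⋆-algebra. -/

section CuntzCalculus

variable {B : Type*} [NonUnitalCStarAlgebra B]

/-- Cuntz subequivalence of elements of a C⋆-algebra. -/
def Sub (a b : B) : Prop := a ∈ closure (Set.range fun d : B => star d * b * d)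

theorem sub_iff {a b : B} : Sub a b ↔ ∀ e > 0, ∃ d : B, ‖a - star d * b * d‖ < e := by
  simp [Sub, Metric.mem_closure_iff, dist_eq_norm]

theorem Sub.conj (b d : B) : Sub (star d * b * d) b := subset_closure ⟨d, rfl⟩

theorem Sub.trans {a b c : B} (hab : Sub a b) (hbc : Sub b c) : Sub a c := by
  refine closure_minimal ?_ isClosed_closure hab
  rintro _ ⟨d, rfl⟩
  have hcont : Continuous fun x : B => star d * x * d := by fun_prop
  refine map_mem_closure (f := fun x : B => star d * x * d) hcont hbc ?_
  rintro _ ⟨e, rfl⟩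
  exact ⟨e * d, by simp only [star_mul, mul_assoc]⟩

theorem Sub.of_forall {a b : B} (h : ∀ e > 0, ∃ c, Sub c b ∧ ‖a - c‖ < e) : Sub a b := by
  have : a ∈ closure {c | Sub c b} := by
    simpa [Metric.mem_closure_iff, dist_eq_norm] using h
  exact closure_minimal (fun c hc => hc) isClosed_closure this

variable [PartialOrder B] [StarOrderedRing B]

theorem quasispectrum_nonneg' {a : B} (ha : 0 ≤ a) {t : ℝ} (ht : t ∈ quasispectrum ℝ a) : 0 ≤ t :=
  quasispectrum_nonneg_of_nonneg a ha t ht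

theorem star_cfcₙ_real (f : ℝ → ℝ) (a : B) : star (cfcₙ f a) = cfcₙ f a :=
  (cfcₙ_predicate f a : IsSelfAdjoint _)

/-- Conjugating `a * a` by g(a) gives the function t³ / (t + e/4)², which is within e/2 of t
uniformly for t ≥ 0. -/
theorem Sub.mul_self {a : B} (ha : 0 ≤ a) : Sub a (a * a) := by
  rw [sub_iff]
  intro e he
  let g : ℝ → ℝ := fun t => √|t| / (|t| + e / 4)
  have hne : ∀ t : ℝ, |t| + e / 4 ≠ 0 := fun t => by positivity
  have hg : Continuous g := by
    have : Continuous fun t : ℝ => |t| + e / 4 := by fun_prop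
    exact (by fun_prop : Continuous fun t : ℝ => √|t|).div this hne
  have hg0 : g 0 = 0 := by simp [g]
  have hsa : IsSelfAdjoint a := .of_nonneg ha
  refine ⟨cfcₙ g a, ?_⟩
  have key : a - star (cfcₙ g a) * (a * a) * cfcₙ g a =
      cfcₙ (fun t => t - g t * (t * t) * g t) a := by
    have h1 : a * a = cfcₙ (fun t : ℝ => t * t) a := by
      rw [cfcₙ_mul (fun t : ℝ => t) (fun t => t) a, cfcₙ_id' ℝ a]
    rw [star_cfcₙ_real, h1, ← cfcₙ_mul g (fun t => t * t) a,
      ← cfcₙ_mul (fun t => g t * (t * t)) g a (by fun_prop) (by simp) (by fun_prop) hg0]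
    rw [cfcₙ_sub (fun t => t) (fun t => g t * (t * t) * g t) a (by fun_prop) rfl (by fun_prop)
      (by simp), cfcₙ_id' ℝ a]
  rw [key]
  refine lt_of_le_of_lt (norm_cfcₙ_le (c := e / 2) fun t ht => ?_) (by linarith)
  have ht0 := quasispectrum_nonneg' ha ht
  have h2 : g t * (t * t) * g t = t ^ 3 / (t + e / 4) ^ 2 := by
    simp only [g, abs_of_nonneg ht0]
    have := Real.mul_self_sqrt ht0
    field_simp
    rw [Real.sq_sqrt ht0]
    ring
  rw [h2]
  have hp : 0 < t + e / 4 := by positivity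
  have h3 : t - t ^ 3 / (t + e / 4) ^ 2 = t * (2 * t * (e / 4) + (e / 4) ^ 2) / (t + e / 4) ^ 2 := by
    field_simp
    ring
  rw [h3, Real.norm_of_nonneg (by positivity), div_le_iff₀ (by positivity)]
  nlinarith [mul_nonneg ht0 he.le, mul_nonneg (mul_nonneg ht0 he.le) he.le,
    mul_nonneg (mul_nonneg ht0 ht0) he.le, mul_pos he he, mul_pos (mul_pos he he) he]

theorem Sub.mul_star_self (y : B) : Sub (y * star y) (star y * y) := by
  refine (Sub.mul_self (mul_star_self_nonneg y)).trans ?_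
  have : y * star y * (y * star y) = star (star y) * (star y * y) * star y := by
    simp only [star_star, mul_assoc]
  rw [this]
  exact Sub.conj _ _

/-- Let s = c c⋆ and U = t (t + r)⁻¹ = R K with R = √t. Then U s U = (R K c)(R K c)⋆ is Cuntz below
(R K c)⋆(R K c) = (K c)⋆ t (K c), hence below t. As r → 0 it tends to s, because ‖c - U c‖² = ‖(1 -
U) s (1 - U)‖ ≤ ‖(1 - U) t (1 - U)‖ ≤ r. -/
theorem Sub.of_le {s t : B} (hs : 0 ≤ s) (hst : s ≤ t) : Sub s t := by
  have ht : 0 ≤ t := hs.trans hst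
  have htsa : IsSelfAdjoint t := .of_nonneg ht
  obtain ⟨c, hc⟩ := CStarAlgebra.nonneg_iff_eq_mul_star_self.1 hs
  obtain ⟨d, hd⟩ := CStarAlgebra.nonneg_iff_eq_star_mul_self.1 (sub_nonneg.2 hst)
  refine Sub.of_forall fun e he => ?_
  -- a cut-off parameter making `‖c - u c‖` small
  obtain ⟨r, hr, hrc⟩ : ∃ r > 0, √r * ‖c‖ * 2 < e := by
    refine ⟨(e / (4 * (‖c‖ + 1))) ^ 2, by positivity, ?_⟩
    rw [Real.sqrt_sq (by positivity)]
    have : e / (4 * (‖c‖ + 1)) * ‖c‖ * 2 = e * (‖c‖ / (2 * (‖c‖ + 1))) := by field_simp; ring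
    rw [this]
    refine mul_lt_of_lt_one_right he ?_
    rw [div_lt_one (by positivity)]
    linarith [norm_nonneg c]
  have hne : ∀ t : ℝ, |t| + r ≠ 0 := fun t => by positivity
  have hcd : Continuous fun t : ℝ => |t| + r := by fun_prop
  let k : ℝ → ℝ := fun t => √|t| / (|t| + r)
  have hk : Continuous k := (by fun_prop : Continuous fun t : ℝ => √|t|).div hcd hne
  have hk0 : k 0 = 0 := by simp [k]
  let q : ℝ → ℝ := fun t => √|t|
  have hq : Continuous q := by fun_prop
  have hq0 : q 0 = 0 := by simp [q]
  set K := cfcₙ k t with hK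
  set R := cfcₙ q t with hR
  set U := R * K with hU
  have hUc : U = cfcₙ (fun x => q x * k x) t := (cfcₙ_mul q k t).symm
  have hUK : U = K * R := (cfcₙ_commute_cfcₙ q k t).eq
  have hKs : star K = K := star_cfcₙ_real _ _
  have hRs : star R = R := star_cfcₙ_real _ _
  have hUs : star U = U := by rw [hUc]; exact star_cfcₙ_real _ _
  have hRR : R * R = t := by
    rw [hR, ← cfcₙ_mul q q t]
    conv_rhs => rw [← cfcₙ_id' ℝ t]
    refine cfcₙ_congr fun x hx => ?_
    have hx0 := quasispectrum_nonneg' ht hx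
    simp [q, abs_of_nonneg hx0, Real.mul_self_sqrt hx0]
  have hU1 : ‖U‖ ≤ 1 := by
    rw [hUc]
    refine norm_cfcₙ_le fun x hx => ?_
    have hx0 := quasispectrum_nonneg' ht hx
    simp only [q, k, abs_of_nonneg hx0]
    rw [← mul_div_assoc, Real.mul_self_sqrt hx0, Real.norm_of_nonneg (by positivity),
      div_le_one (by positivity)]
    linarith
  have hT : ‖t - U * t - t * U + U * t * U‖ ≤ r := by
    have h1 : t - U * t - t * U + U * t * U = cfcₙ (fun x =>
        x - (q x * k x) * x - x * (q x * k x) + (q x * k x) * x * (q x * k x)) t := by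
      have hm : Continuous fun x => q x * k x := by fun_prop
      rw [cfcₙ_add _ _ _ (by fun_prop) (by simp [hq0]) (by fun_prop) (by simp),
        cfcₙ_sub _ _ _ (by fun_prop) (by simp) (by fun_prop) (by simp),
        cfcₙ_sub _ _ _ (by fun_prop) (by simp) (by fun_prop) (by simp),
        cfcₙ_mul (fun x => q x * k x * x) (fun x => q x * k x) t (by fun_prop) (by simp)
          (by fun_prop) (by simp [hq0]),
        cfcₙ_mul (fun x => q x * k x) (fun x => x) t (by fun_prop) (by simp [hq0])
          (by fun_prop) (by simp),
        cfcₙ_mul (fun x => x) (fun x => q x * k x) t (by fun_prop) (by simp)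
          (by fun_prop) (by simp [hq0]), ← hUc, cfcₙ_id' ℝ t]
    rw [h1]
    refine norm_cfcₙ_le fun x hx => ?_
    have hx0 := quasispectrum_nonneg' ht hx
    have h2 : q x * k x = x / (x + r) := by
      simp only [q, k, abs_of_nonneg hx0]
      rw [← mul_div_assoc, Real.mul_self_sqrt hx0]
    have hp : 0 < x + r := by positivity
    have h3 : x - x / (x + r) * x - x * (x / (x + r)) + x / (x + r) * x * (x / (x + r)) =
        x * r ^ 2 / (x + r) ^ 2 := by field_simp; ring
    rw [h2, h3, Real.norm_of_nonneg (by positivity), div_le_iff₀ (by positivity)]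
    nlinarith [mul_nonneg hx0 hr.le, mul_nonneg (mul_nonneg hx0 hx0) hr.le,
      mul_nonneg (mul_nonneg hx0 hr.le) hr.le, mul_pos (mul_pos hr hr) hr]
  have hcU : ‖c - U * c‖ ≤ √r := by
    refine Real.le_sqrt_of_sq_le ?_
    rw [sq, ← CStarRing.norm_self_mul_star]
    have h1 : (c - U * c) * star (c - U * c) = s - U * s - s * U + U * s * U := by
      rw [star_sub, star_mul, hUs, hc]
      noncomm_ring
    rw [h1]
    refine le_trans (CStarAlgebra.norm_le_norm_of_nonneg_of_le (h1 ▸ mul_star_self_nonneg _) ?_) hT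
    rw [← sub_nonneg]
    have h2 : t - U * t - t * U + U * t * U - (s - U * s - s * U + U * s * U) =
        star (d - d * U) * (d - d * U) := by
      have h3 : t = s + star d * d := by rw [← hd]; abel
      rw [star_sub, star_mul, hUs, h3]
      noncomm_ring
    rw [h2]
    exact star_mul_self_nonneg _
  refine ⟨U * s * U, ?_, ?_⟩
  · have h1 : U * s * U = (R * (K * c)) * star (R * (K * c)) := by
      rw [star_mul, star_mul, hRs, hKs, hc]
      nth_rw 2 [hUK]
      simp only [hU, mul_assoc]
    have h2 : star (R * (K * c)) * (R * (K * c)) = star (K * c) * t * (K * c) := by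
      rw [star_mul, hRs, ← hRR]
      simp only [mul_assoc]
    rw [h1]
    refine (Sub.mul_star_self _).trans ?_
    rw [h2]
    exact Sub.conj _ _
  · have h1 : s - U * s * U = (c - U * c) * star c + U * c * star (c - U * c) := by
      rw [star_sub, star_mul, hUs, hc]
      noncomm_ring
    rw [h1]
    calc _ ≤ ‖c - U * c‖ * ‖star c‖ + ‖U * c‖ * ‖star (c - U * c)‖ :=
          (norm_add_le _ _).trans (add_le_add (norm_mul_le _ _) (norm_mul_le _ _))
      _ ≤ √r * ‖c‖ + (1 * ‖c‖) * √r := by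
          rw [norm_star, norm_star]
          have : ‖U * c‖ ≤ 1 * ‖c‖ :=
            (norm_mul_le _ _).trans (mul_le_mul_of_nonneg_right hU1 (norm_nonneg _))
          gcongr
      _ < e := by linarith

/-- If the cube of a positive element factors through `t ≥ 0`, then it is Cuntz below `t`. -/
theorem Sub.of_cube_eq {p t x y : B} (hp : 0 ≤ p) (ht : 0 ≤ t) (h : p * p * p = x * t * y) :
    Sub p t := by
  have hps : star p = p := IsSelfAdjoint.of_nonneg hp
  have hts : star t = t := IsSelfAdjoint.of_nonneg ht
  have hp2 : 0 ≤ p * p := by simpa [hps] using star_mul_self_nonneg p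
  have hp4 : 0 ≤ p * p * (p * p) := by simpa [hps, mul_assoc] using star_mul_self_nonneg (p * p)
  have h6 : 0 ≤ star (p * p * p) * (p * p * p) := star_mul_self_nonneg _
  -- p ≲ p² ≲ p⁴ ≲ p⁸ = p p⁶ p ≲ p⁶.
  have h8 : Sub p (star (p * p * p) * (p * p * p)) := by
    refine (Sub.mul_self hp).trans ((Sub.mul_self hp2).trans ((Sub.mul_self hp4).trans ?_))
    have : p * p * (p * p) * (p * p * (p * p)) = star p * (star (p * p * p) * (p * p * p)) * p := by
      simp only [star_mul, hps, mul_assoc]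
    rw [this]
    exact Sub.conj _ _
  refine h8.trans ?_
  obtain ⟨q, hq0, hq⟩ : ∃ q : B, 0 ≤ q ∧ q * q = t :=
    ⟨CFC.sqrt t, CFC.sqrt_nonneg t, CFC.sqrt_mul_sqrt_self t ht⟩
  have hqs : star q = q := IsSelfAdjoint.of_nonneg hq0
  -- p⁶ = (t y)⋆ (x⋆ x) (t y) is at most a multiple of y⋆ t² y = (√t y)⋆ t (√t y), which is a
  -- conjugate of t.
  have hle : star (p * p * p) * (p * p * p) ≤ (‖star x * x‖) • (star (t * y) * (t * y)) := by
    have h1 : star (p * p * p) * (p * p * p) = star (t * y) * (star x * x) * (t * y) := by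
      rw [h]
      simp only [star_mul, mul_assoc]
    rw [h1]
    exact CStarAlgebra.star_left_conjugate_le_norm_smul (.star_mul_self x)
  refine (Sub.of_le h6 hle).trans ?_
  have h2 : ‖star x * x‖ • (star (t * y) * (t * y)) =
      star ((√‖star x * x‖ : ℝ) • (q * y)) * t * ((√‖star x * x‖ : ℝ) • (q * y)) := by
    rw [star_smul, star_trivial (√‖star x * x‖), smul_mul_assoc, smul_mul_assoc, mul_smul_comm, smul_smul,
      Real.mul_self_sqrt (norm_nonneg _), star_mul, star_mul, hts, hqs, ← hq]
    simp only [mul_assoc]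
  rw [h2]
  exact Sub.conj _ _

end CuntzCalculus

/-! ### Completely positive order zero maps and the identity f(xy) f(z) = f(x) f(yz). -/

section OrderZero

variable {A B : Type*} [NonUnitalCStarAlgebra A] [PartialOrder A] [StarOrderedRing A]
  [NonUnitalCStarAlgebra B] [PartialOrder B] [StarOrderedRing B]

theorem map_star_of_nonneg {f : A →ₗ[ℂ] B} (hf : ∀ a, 0 ≤ a → 0 ≤ f a) (a : A) :
    f (star a) = star (f a) := by
  have ha : a ∈ Submodule.span ℂ {a : A | 0 ≤ a} := by
    rw [CStarAlgebra.span_nonneg]; trivial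
  induction ha using Submodule.span_induction with
  | mem a ha =>
    have ha : 0 ≤ a := ha
    rw [(IsSelfAdjoint.of_nonneg ha).star_eq, (IsSelfAdjoint.of_nonneg (hf a ha)).star_eq]
  | zero => simp
  | add a b _ _ ha hb => simp [ha, hb]
  | smul c a _ ha => simp [ha]

theorem IsCPC.map_nonneg {f : A →ₗ[ℂ] B} (hf : IsCPC f) {a : A} (ha : 0 ≤ a) : 0 ≤ f a := by
  obtain ⟨g, rfl⟩ := hf.completelyPositive
  exact _root_.map_nonneg g ha

theorem IsCPC.continuous {f : A →ₗ[ℂ] B} (hf : IsCPC f) : Continuous f :=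
  AddMonoidHomClass.continuous_of_bound f 1 fun a => by simpa using hf.contractive a

/-- A completely positive map `f` satisfies `f (x⋆ x) z = 0 → f x z = 0`. -/
theorem IsCPC.map_mul_eq_zero {f : A →ₗ[ℂ] B} (hf : IsCPC f) {x : A} {z : B}
    (h : f (star x * x) * z = 0) : f x * z = 0 := by
  have key : ∀ e : A, f (star e * x) * z = 0 := by
    intro e
    -- A Cauchy–Schwarz argument on 2 × 2 matrices: N⋆ N has entries e⋆ x and x⋆ x. Factor its image
    -- as c⋆ c. The hypothesis forces `c k 1 * z = 0`, and these products are factors of every term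
    -- of f(e⋆ x) z. Letting e run through an approximate unit gives the claim.
    let N : CStarMatrix (Fin 2) (Fin 2) A := CStarMatrix.ofMatrix !![e, x; 0, 0]
    obtain ⟨g, hg⟩ := hf.completelyPositive
    have hpos := g.map_cstarMatrix_nonneg (star N * N) (star_mul_self_nonneg N)
    obtain ⟨c, hc⟩ := exists_eq_star_mul_self hpos
    have entry : ∀ i j, f ((star N * N) i j) = ∑ k, star (c k i) * c k j := by
      intro i j
      have := congrFun (congrFun hc i) j
      rw [CStarMatrix.mul_apply] at this
      simp only [CStarMatrix.star_apply] at this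
      rw [← this, ← hg]
      rfl
    have e11 : (star N * N) 1 1 = star x * x := by
      simp [CStarMatrix.mul_apply, CStarMatrix.star_apply, N]
    have e01 : (star N * N) 0 1 = star e * x := by
      simp [CStarMatrix.mul_apply, CStarMatrix.star_apply, N]
    have hz : ∀ k, c k 1 * z = 0 := by
      have hsum : ∑ k, star (c k 1 * z) * (c k 1 * z) = 0 := by
        have : ∑ k, star (c k 1 * z) * (c k 1 * z) = star z * (f (star x * x) * z) := by
          rw [← e11, entry, Finset.sum_mul, Finset.mul_sum]
          simp only [star_mul, mul_assoc]
        rw [this, h, mul_zero]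
      rw [Finset.sum_eq_zero_iff_of_nonneg fun _ _ => star_mul_self_nonneg _] at hsum
      intro k
      exact (CStarRing.star_mul_self_eq_zero_iff _).1 (hsum k (Finset.mem_univ _))
    rw [← e01, entry, Finset.sum_mul]
    exact Finset.sum_eq_zero fun k _ => by rw [mul_assoc, hz, mul_zero]
  have hu := CStarAlgebra.increasingApproximateUnit A
  have := hu.neBot
  have hlim : Tendsto (fun u : A => f (u * x) * z) (CStarAlgebra.approximateUnit A)
      (𝓝 (f x * z)) :=
    ((hf.continuous.tendsto x).comp (hu.tendsto_mul_right x)).mul_const z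
  refine tendsto_nhds_unique hlim (tendsto_const_nhds.congr fun u => ?_)
  simpa using (key (star u)).symm

/-- The positive elements x⋆ x and y y⋆ are orthogonal; `IsCPC.map_mul_eq_zero` then removes x⋆ and,
after taking adjoints, y⋆. -/
theorem IsCPC.map_mul_map_eq_zero {f : A →ₗ[ℂ] B} (hf : IsCPC f) (h0 : IsOrderZero f) {x y : A}
    (h : x * y = 0) : f x * f y = 0 := by
  have hs : ∀ a, f (star a) = star (f a) := map_star_of_nonneg fun _ => hf.map_nonneg
  have h1 : f (star x * x) * f (y * star y) = 0 := by
    refine h0 _ _ (star_mul_self_nonneg x) (mul_star_self_nonneg y) ?_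
    rw [mul_assoc, ← mul_assoc x, h, zero_mul, mul_zero]
  have h2 := hf.map_mul_eq_zero h1
  have h3 : f (star (star y) * star y) * f (star x) = 0 := by
    have := congrArg star h2
    rw [star_mul, star_zero, ← hs, ← hs] at this
    simpa using this
  have h4 := hf.map_mul_eq_zero h3
  have := congrArg star h4
  rw [star_mul, star_zero, ← hs, ← hs] at this
  simpa using this

/-- The function `t ↦ t / δ - i`, clamped to `[0, 1]`. -/
def ramp (δ : ℝ) (i : ℕ) (t : ℝ) : ℝ := max 0 (min 1 (t / δ - i))

theorem continuous_ramp (δ : ℝ) (i : ℕ) : Continuous (ramp δ i) := by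
  unfold ramp; fun_prop

theorem ramp_zero (δ : ℝ) (i : ℕ) : ramp δ i 0 = 0 := by
  simp [ramp]

/-- A later ramp is zero until the earlier one has reached 1, so each ramp acts as a unit on all
later ones. -/
theorem ramp_mul_ramp (δ : ℝ) {i j : ℕ} (hij : i < j) (t : ℝ) :
    ramp δ i t * ramp δ j t = ramp δ j t := by
  have hij' : (i : ℝ) + 1 ≤ j := by exact_mod_cast hij
  unfold ramp
  rcases le_or_gt (t / δ) j with h | h
  · rw [max_eq_left (b := min 1 (t / δ - j)) ((min_le_right _ _).trans (by linarith)), mul_zero]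
  · rw [min_eq_left (b := t / δ - i) (by linarith)]
    simp

theorem ramp_succ_le (δ : ℝ) (i : ℕ) (t : ℝ) : ramp δ (i + 1) t ≤ ramp δ i t := by
  unfold ramp
  push_cast
  gcongr
  linarith

theorem sum_ramp (δ : ℝ) (n : ℕ) {t : ℝ} (h0 : 0 ≤ t / δ) :
    ∑ i ∈ Finset.range n, ramp δ i t = min (t / δ) n := by
  induction n with
  | zero => simp [h0]
  | succ n ih =>
    rw [Finset.sum_range_succ, ih, ramp]
    push_cast
    rcases le_total (t / δ) n with h | h
    · rw [min_eq_left h, min_eq_left (h.trans (by linarith)),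
        max_eq_left ((min_le_right _ _).trans (by linarith)), add_zero]
    · rw [min_eq_right h, max_eq_right (le_min (by norm_num) (by linarith))]
      rcases le_total (t / δ) (n + 1) with h' | h'
      · rw [min_eq_left h', min_eq_right (by linarith)]; ring
      · rw [min_eq_right h', min_eq_left (by linarith)]

/-- The differences of a decreasing sequence `P`, applied to `x` from one side by `m`. -/
def bands (m : A → A → A) (P : ℕ → A) (x : A) : ℕ → A
  | 0 => x - m x (P 0)
  | i + 1 => m x (P i - P (i + 1))

/-- What matters is uniformity in the set of bands. The differences of P are positive with sum at
most `P 0`, so they contribute at most ‖x‖; the zeroth band contributes at most 2‖x‖. -/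
theorem norm_sum_bands_le {m : A → A → A} (hm : ∀ x y, ‖m x y‖ ≤ ‖x‖ * ‖y‖)
    (hadd : ∀ x y z, m x (y + z) = m x y + m x z) {P : ℕ → A}
    (hP0 : ∀ i, 0 ≤ P i) (hP1 : ‖P 0‖ ≤ 1) (hanti : ∀ i, P (i + 1) ≤ P i) (x : A)
    (S : Finset ℕ) : ‖∑ i ∈ S, bands m P x i‖ ≤ 3 * ‖x‖ := by
  let D : ℕ → A := fun i => match i with
    | 0 => 0
    | i + 1 => P i - P (i + 1)
  have hm0 : ∀ x, m x 0 = 0 := fun x => by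
    have := hadd x 0 0
    simpa using this
  have hD : ∀ i, bands m P x i = (if i = 0 then x - m x (P 0) else 0) + m x (D i) := by
    rintro (_ | i)
    · simp [bands, D, hm0]
    · simp [bands, D]
  have hD0 : ∀ i, 0 ≤ D i := by
    rintro (_ | i)
    · exact le_rfl
    · exact sub_nonneg.2 (hanti i)
  have hDsum : ∀ n, ∑ i ∈ Finset.range (n + 1), D i = P 0 - P n := by
    intro n
    induction n with
    | zero => simp [D]
    | succ n ih => rw [Finset.sum_range_succ, ih]; simp [D]
  have hS : ‖∑ i ∈ S, D i‖ ≤ 1 := by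
    obtain ⟨n, hn⟩ : ∃ n, S ⊆ Finset.range (n + 1) :=
      ⟨S.sup id, fun i hi => Finset.mem_range.2 (Nat.lt_succ_of_le (Finset.le_sup (f := id) hi))⟩
    refine le_trans (CStarAlgebra.norm_le_norm_of_nonneg_of_le
      (Finset.sum_nonneg fun i _ => hD0 i) ?_) hP1
    refine (Finset.sum_le_sum_of_subset_of_nonneg hn fun i _ _ => hD0 i).trans ?_
    rw [hDsum]
    exact sub_le_self _ (hP0 n)
  have hmsum : ∑ i ∈ S, m x (D i) = m x (∑ i ∈ S, D i) := by
    classical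
    induction S using Finset.induction_on with
    | empty => simp [hm0]
    | insert a s ha ih =>
      rw [Finset.sum_insert ha, Finset.sum_insert ha, hadd, ih]
      refine (CStarAlgebra.norm_le_norm_of_nonneg_of_le
        (Finset.sum_nonneg fun i _ => hD0 i) ?_).trans hS
      exact Finset.sum_le_sum_of_subset_of_nonneg (Finset.subset_insert a s) fun i _ _ => hD0 i
  have h1 : ‖∑ i ∈ S, (if i = 0 then x - m x (P 0) else 0)‖ ≤ 2 * ‖x‖ := by
    rw [Finset.sum_ite_eq']
    split_ifs
    · refine (norm_sub_le _ _).trans ?_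
      have := (hm x (P 0)).trans (mul_le_of_le_one_right (norm_nonneg x) hP1)
      linarith
    · simp
  simp only [hD]
  rw [Finset.sum_add_distrib, hmsum]
  refine (norm_add_le _ _).trans ?_
  have := (hm x (∑ i ∈ S, D i)).trans (mul_le_of_le_one_right (norm_nonneg x) hS)
  linarith

/-- Within one residue class mod 3 the off-diagonal products vanish, so the sum of products is the
product f(∑ X i) f(∑ Z i), whose bound is independent of n. The modulus 3 leaves room to shift one
of the two families by one index when only bands at distance at least 2 are orthogonal. -/
theorem norm_sum_map_mul_map_le {f : A →ₗ[ℂ] B} (hf : ∀ a, ‖f a‖ ≤ ‖a‖)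
    (h0 : ∀ x y, x * y = 0 → f x * f y = 0) {X Z : ℕ → A} {a b : ℝ}
    (hXZ : ∀ i j, i % 3 = j % 3 → i ≠ j → X i * Z j = 0)
    (hX : ∀ S : Finset ℕ, ‖∑ i ∈ S, X i‖ ≤ a) (hZ : ∀ S : Finset ℕ, ‖∑ i ∈ S, Z i‖ ≤ b) (n : ℕ) :
    ‖∑ i ∈ Finset.range n, f (X i) * f (Z i)‖ ≤ 3 * (a * b) := by
  have ha : 0 ≤ a := (norm_nonneg _).trans (hX ∅)
  have hmaps : ∀ i ∈ Finset.range n, i % 3 ∈ Finset.range 3 := fun i _ =>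
    Finset.mem_range.2 (Nat.mod_lt _ (by norm_num))
  rw [← Finset.sum_fiberwise_of_maps_to hmaps]
  have hterm : ∀ r ∈ Finset.range 3,
      ‖∑ i ∈ (Finset.range n).filter (fun i => i % 3 = r), f (X i) * f (Z i)‖ ≤ a * b := by
    intro r _
    set S := (Finset.range n).filter (fun i => i % 3 = r) with hS
    have : ∑ i ∈ S, f (X i) * f (Z i) = f (∑ i ∈ S, X i) * f (∑ i ∈ S, Z i) := by
      rw [map_sum, map_sum, Finset.sum_mul_sum]
      refine Finset.sum_congr rfl fun i hi => ?_
      refine (Finset.sum_eq_single_of_mem i hi fun j hj hij => h0 _ _ (hXZ i j ?_ hij.symm)).symm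
      rw [(Finset.mem_filter.1 hi).2, (Finset.mem_filter.1 hj).2]
    rw [this]
    exact (norm_mul_le _ _).trans (mul_le_mul ((hf _).trans (hX S)) ((hf _).trans (hZ S))
      (norm_nonneg _) ha)
  refine (norm_sum_le_of_le _ hterm).trans ?_
  simp

/-- Write h = δ ∑ P i with the ramps P i of h. For a single P the defect f(xP) f(z) - f(x) f(Pz)
equals f(xP) f(z - Pz) - f(x - xP) f(Pz), and orthogonality of distant bands reduces it to products
of two neighbouring bands. The sum over i is bounded independently of the number of ramps, so the
factor δ sends the defect to zero. -/
theorem map_mul_map_eq_of_nonneg {f : A →ₗ[ℂ] B} (hf : ∀ a, ‖f a‖ ≤ ‖a‖)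
    (h0 : ∀ x y, x * y = 0 → f x * f y = 0) {h : A} (hh : 0 ≤ h) (x z : A) :
    f (x * h) * f z = f x * f (h * z) := by
  have hsa : IsSelfAdjoint h := .of_nonneg hh
  -- 54 comes from two sums, each at most 3 · (3‖x‖ · 3‖z‖).
  have key : ∀ δ : ℝ, 0 < δ → ‖f (x * h) * f z - f x * f (h * z)‖ ≤ δ * (54 * (‖x‖ * ‖z‖)) := by
    intro δ hδ
    let P : ℕ → A := fun i => cfcₙ (ramp δ i) h
    have hc := continuous_ramp δ
    have hz := ramp_zero δ
    have hPP : ∀ {i j}, i < j → P i * P j = P j := fun {i j} hij => by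
      simp only [P]
      rw [← cfcₙ_mul _ _ h (hc i).continuousOn (hz i) (hc j).continuousOn (hz j)]
      exact cfcₙ_congr fun t _ => ramp_mul_ramp δ hij t
    have hPP' : ∀ {i j}, i < j → P j * P i = P j := fun {i j} hij => by
      rw [(cfcₙ_commute_cfcₙ (ramp δ j) (ramp δ i) h).eq]; exact hPP hij
    have hP0 : ∀ i, 0 ≤ P i := fun i => cfcₙ_nonneg fun t _ => le_max_left _ _
    have hP1 : ‖P 0‖ ≤ 1 := norm_cfcₙ_le fun t _ => by
      rw [ramp, Real.norm_of_nonneg (le_max_left _ _)]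
      exact max_le zero_le_one (min_le_left _ _)
    have hanti : ∀ i, P (i + 1) ≤ P i := fun i =>
      cfcₙ_mono (fun t _ => ramp_succ_le δ i t) (hc _).continuousOn (hc _).continuousOn
        (hz _) (hz _)
    obtain ⟨n, hn⟩ := exists_nat_ge (‖h‖ / δ)
    have hsum : h = δ • ∑ i ∈ Finset.range n, P i := by
      have h1 : ∑ i ∈ Finset.range n, P i =
          cfcₙ (fun t => ∑ i ∈ Finset.range n, ramp δ i t) h := by
        have := cfcₙ_sum (fun i => ramp δ i) h (Finset.range n) (fun i _ => (hc i).continuousOn)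
          (fun i _ => hz i)
        rw [← this]
        congr 1
        ext t
        simp
      have hcs : Continuous fun t => ∑ i ∈ Finset.range n, ramp δ i t :=
        continuous_finsetSum _ fun i _ => hc i
      rw [h1, ← cfcₙ_smul δ (fun t => ∑ i ∈ Finset.range n, ramp δ i t) h hcs.continuousOn
        (by simp [hz])]
      conv_lhs => rw [← cfcₙ_id' ℝ h]
      refine cfcₙ_congr fun t ht => ?_
      have ht0 := quasispectrum_nonneg' hh ht
      have ht1 : t ≤ ‖h‖ := (le_abs_self t).trans
        (by simpa using NonUnitalIsometricContinuousFunctionalCalculus.norm_quasispectrum_le h ht)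
      simp only [smul_eq_mul]
      rw [sum_ramp δ n (by positivity), min_eq_left ((div_le_div_of_nonneg_right ht1 hδ.le).trans hn)]
      field_simp
    let X := bands (fun x y => x * y) P x
    let Z := bands (fun x y => y * x) P z
    have hX : ∀ S : Finset ℕ, ‖∑ i ∈ S, X i‖ ≤ 3 * ‖x‖ :=
      norm_sum_bands_le (fun x y => norm_mul_le x y) (fun _ _ _ => mul_add _ _ _) hP0 hP1 hanti x
    have hZ : ∀ S : Finset ℕ, ‖∑ i ∈ S, Z i‖ ≤ 3 * ‖z‖ :=
      norm_sum_bands_le (fun x y => (norm_mul_le y x).trans (mul_comm _ _).le)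
        (fun _ _ _ => add_mul _ _ _) hP0 hP1 hanti z
    have hX0 : ∀ i, X (i + 1) = x * (P i - P (i + 1)) := fun i => rfl
    have hZ0 : ∀ i, Z (i + 1) = (P i - P (i + 1)) * z := fun i => rfl
    have h00 : X 0 = x - x * P 0 := rfl
    have h00' : Z 0 = z - P 0 * z := rfl
    have hXZ : ∀ i j, i + 2 ≤ j → X i * Z j = 0 := by
      intro i j hij
      obtain ⟨j, rfl⟩ : ∃ k, j = k + 1 := ⟨j - 1, by omega⟩
      rw [hZ0]
      rcases i with _ | i
      · rw [h00, ← mul_assoc, sub_mul, mul_assoc x, mul_sub (P 0), hPP (by omega), hPP (by omega),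
          sub_self, zero_mul]
      · rw [hX0]
        have : (P i - P (i + 1)) * (P j - P (j + 1)) = 0 := by
          rw [sub_mul, mul_sub, mul_sub, hPP (by omega), hPP (by omega), hPP (by omega),
            hPP (by omega), sub_self]
        rw [mul_assoc, ← mul_assoc (P i - P (i + 1)), this, zero_mul, mul_zero]
    have hkill : ∀ {d q : A}, d * q = d → d * (z - q * z) = 0 := fun {d q} h => by
      rw [mul_sub, ← mul_assoc, h, sub_self]
    have hXZ' : ∀ i j, j + 2 ≤ i → X i * Z j = 0 := by
      intro i j hij
      obtain ⟨i, rfl⟩ : ∃ k, i = k + 1 := ⟨i - 1, by omega⟩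
      rw [hX0]
      rcases j with _ | j
      · rw [h00']
        exact hkill (by rw [mul_assoc, sub_mul, hPP' (by omega), hPP' (by omega)])
      · rw [hZ0]
        have : (P i - P (i + 1)) * (P j - P (j + 1)) = 0 := by
          rw [mul_sub, sub_mul, sub_mul, hPP' (by omega), hPP' (by omega), hPP' (by omega),
            hPP' (by omega), sub_self]
        rw [mul_assoc, ← mul_assoc (P i - P (i + 1)), this, zero_mul, mul_zero]
    -- Of x P i = X (i+1) + x P (i+1) the second part is orthogonal to z - P i z; of z - P i z only
    -- the last band Z i meets X (i+1).
    have h1 : ∀ i, f (x * P i) * f (z - P i * z) = f (X (i + 1)) * f (Z i) := by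
      intro i
      have e1 : f (x * P (i + 1)) * f (z - P i * z) = 0 := by
        refine h0 _ _ ?_
        exact hkill (by rw [mul_assoc, hPP' (by omega)])
      have e2 : x * P i = X (i + 1) + x * P (i + 1) := by rw [hX0, mul_sub]; abel
      rw [e2, map_add, add_mul, e1, add_zero]
      rcases i with _ | i
      · rfl
      · have e3 : z - P (i + 1) * z = (z - P i * z) + Z (i + 1) := by rw [hZ0, sub_mul]; abel
        have e4 : f (X (i + 1 + 1)) * f (z - P i * z) = 0 := by
          refine h0 _ _ ?_
          rw [hX0]
          exact hkill (by rw [mul_assoc, sub_mul, hPP' (by omega), hPP' (by omega)])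
        rw [e3, map_add, mul_add, e4, zero_add]
    have h2 : ∀ i, f (x - x * P i) * f (P i * z) = f (X i) * f (Z (i + 1)) := by
      intro i
      have e1 : f (x - x * P i) * f (P (i + 1) * z) = 0 := by
        refine h0 _ _ ?_
        rw [← mul_assoc, sub_mul, mul_assoc x, hPP (by omega), sub_self, zero_mul]
      have e2 : P i * z = Z (i + 1) + P (i + 1) * z := by rw [hZ0, sub_mul]; abel
      rw [e2, map_add, mul_add, e1, add_zero]
      rcases i with _ | i
      · rfl
      · have e3 : x - x * P (i + 1) = (x - x * P i) + X (i + 1) := by rw [hX0, mul_sub]; abel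
        have e4 : f (x - x * P i) * f (Z (i + 1 + 1)) = 0 := by
          refine h0 _ _ ?_
          rw [hZ0, ← mul_assoc, sub_mul x, mul_assoc x, mul_sub (P i), hPP (by omega),
            hPP (by omega), ← mul_sub, sub_self, mul_zero, zero_mul]
        rw [e3, map_add, add_mul, e4, zero_add]
    have h3 : ∀ i, f (x * P i) * f z - f x * f (P i * z) =
        f (X (i + 1)) * f (Z i) - f (X i) * f (Z (i + 1)) := by
      intro i
      rw [← h1, ← h2, map_sub, map_sub]
      noncomm_ring
    have h4 : f (x * h) * f z - f x * f (h * z) =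
        δ • (∑ i ∈ Finset.range n, f (X (i + 1)) * f (Z i) -
          ∑ i ∈ Finset.range n, f (X i) * f (Z (i + 1))) := by
      rw [← Finset.sum_sub_distrib, ← Finset.sum_congr rfl fun i _ => h3 i]
      nth_rw 1 2 [hsum]
      rw [mul_smul_comm, smul_mul_assoc, LinearMap.map_smul_of_tower, LinearMap.map_smul_of_tower,
        smul_mul_assoc, mul_smul_comm, ← smul_sub, Finset.mul_sum, Finset.sum_mul, map_sum, map_sum,
        Finset.sum_mul, Finset.mul_sum, Finset.sum_sub_distrib]
    have hX' : ∀ S : Finset ℕ, ‖∑ i ∈ S, X (i + 1)‖ ≤ 3 * ‖x‖ := fun S => by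
      have := hX (S.map ⟨Nat.succ, Nat.succ_injective⟩)
      rwa [Finset.sum_map] at this
    have hZ' : ∀ S : Finset ℕ, ‖∑ i ∈ S, Z (i + 1)‖ ≤ 3 * ‖z‖ := fun S => by
      have := hZ (S.map ⟨Nat.succ, Nat.succ_injective⟩)
      rwa [Finset.sum_map] at this
    have b1 := norm_sum_map_mul_map_le hf h0 (X := fun i => X (i + 1)) (Z := Z) (fun i j hm hij => by
      rcases lt_or_gt_of_ne hij with hlt | hlt
      · exact hXZ _ _ (by omega)
      · exact hXZ' _ _ (by omega)) hX' hZ n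
    have b2 := norm_sum_map_mul_map_le hf h0 (X := X) (Z := fun i => Z (i + 1)) (fun i j hm hij => by
      rcases lt_or_gt_of_ne hij with hlt | hlt
      · exact hXZ _ _ (by omega)
      · exact hXZ' _ _ (by omega)) hX hZ' n
    rw [h4, norm_smul, Real.norm_of_nonneg hδ.le]
    refine mul_le_mul_of_nonneg_left ((norm_sub_le _ _).trans ?_) hδ.le
    linarith
  have hlim : Tendsto (fun δ : ℝ => δ * (54 * (‖x‖ * ‖z‖))) (𝓝[>] 0) (𝓝 0) := by
    have : Continuous fun δ : ℝ => δ * (54 * (‖x‖ * ‖z‖)) := by fun_prop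
    simpa using (this.tendsto 0).mono_left nhdsWithin_le_nhds
  have := ge_of_tendsto hlim (by filter_upwards [self_mem_nhdsWithin] with δ hδ using key δ hδ)
  exact sub_eq_zero.1 (norm_le_zero_iff.1 this)

/-- Order zero maps satisfy `f (x y) f z = f x f (y z)`. -/
theorem IsCPC.map_mul_map {f : A →ₗ[ℂ] B} (hf : IsCPC f) (h0 : IsOrderZero f) (x y z : A) :
    f (x * y) * f z = f x * f (y * z) := by
  have hy : y ∈ Submodule.span ℂ {a : A | 0 ≤ a} := by
    rw [CStarAlgebra.span_nonneg]; trivial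
  induction hy using Submodule.span_induction with
  | mem y hy =>
    exact map_mul_map_eq_of_nonneg hf.contractive (fun _ _ => hf.map_mul_map_eq_zero h0) hy x z
  | zero => simp
  | add a b _ _ ha hb => rw [mul_add, map_add, add_mul, ha, hb, add_mul, map_add, mul_add]
  | smul c a _ ha =>
    rw [mul_smul_comm, map_smul, smul_mul_assoc, ha, smul_mul_assoc, map_smul, mul_smul_comm]

end OrderZero

/-! ### Comparison in finite-dimensional C⋆-algebras by counting dimensions. -/

section FiniteDimensional

variable {F : Type*} [NonUnitalCStarAlgebra F] [FiniteDimensional ℂ F]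

/-- Spectral values are roots of the minimal polynomial. Hence every real function is continuous on
the spectrum, which makes sharp cut-offs and inverse powers available in the functional calculus. -/
theorem finite_quasispectrum (a : F) : (quasispectrum ℝ a).Finite := by
  rw [Unitization.quasispectrum_eq_spectrum_inr ℝ a]
  have : FiniteDimensional ℝ F := FiniteDimensional.complexToReal F
  have : Module.Finite ℝ (Unitization ℝ F) :=
    Module.Finite.equiv (Unitization.linearEquiv ℝ ℝ F).symm
  set x : Unitization ℝ F := (a : Unitization ℝ F)
  have hxint : IsIntegral ℝ x := Algebra.IsIntegral.isIntegral x
  refine ((minpoly ℝ x).roots.toFinset.finite_toSet).subset fun t ht => ?_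
  have h1 := spectrum.subset_polynomial_aeval x (minpoly ℝ x) ⟨t, ht, rfl⟩
  rw [minpoly.aeval, spectrum.zero_eq] at h1
  simpa [Polynomial.mem_roots (minpoly.ne_zero hxint)] using h1

theorem continuousOn_quasispectrum (f : ℝ → ℝ) (a : F) : ContinuousOn f (quasispectrum ℝ a) :=
  (finite_quasispectrum a).continuousOn f

theorem cfcₙ_mul_cfcₙ {f g : ℝ → ℝ} (hf : f 0 = 0) (hg : g 0 = 0) (a : F) :
    cfcₙ f a * cfcₙ g a = cfcₙ (fun t => f t * g t) a :=
  (cfcₙ_mul f g a (continuousOn_quasispectrum _ _) hf (continuousOn_quasispectrum _ _) hg).symm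

variable [PartialOrder F] [StarOrderedRing F]

/-- A nonzero element `x` has a nonzero partially isometric multiple `x g x`. -/
theorem exists_partialIsometry_mul {x : F} (hx : x ≠ 0) :
    ∃ g : F, x * (g * x) ≠ 0 ∧ x * (g * x) * star (x * (g * x)) * (x * (g * x)) = x * (g * x) := by
  set h := star x * x with hh
  have hh0 : 0 ≤ h := star_mul_self_nonneg x
  have hsa : IsSelfAdjoint h := .of_nonneg hh0
  -- The element x h^(-3/2) x⋆ x = x h^(-1/2) is the polar part of x; with 0⁻¹ = 0 both functions
  -- vanish at 0. Having x at both ends, it inherits the left and right annihilators of x.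
  let g : ℝ → ℝ := fun t => t⁻¹ * (√t)⁻¹
  let k : ℝ → ℝ := fun t => (√t)⁻¹
  have hg0 : g 0 = 0 := by simp [g]
  have hk0 : k 0 = 0 := by simp [k]
  have hid : h = cfcₙ (fun t : ℝ => t) h := (cfcₙ_id' ℝ h).symm
  have hk : cfcₙ g h * h = cfcₙ k h := by
    nth_rw 2 [hid]
    rw [cfcₙ_mul_cfcₙ hg0 rfl]
    refine cfcₙ_congr fun t ht => ?_
    rcases eq_or_ne t 0 with rfl | ht
    · simp [k]
    · simp only [g, k]; field_simp
  have hks : star (cfcₙ k h) = cfcₙ k h := star_cfcₙ_real _ _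
  have hcomm : Commute (cfcₙ k h) h := by
    nth_rw 2 [hid]; exact cfcₙ_commute_cfcₙ _ _ _
  have hkhk : h * cfcₙ k h * cfcₙ k h * h = h := by
    nth_rw 1 4 5 [hid]
    rw [cfcₙ_mul_cfcₙ rfl hk0, cfcₙ_mul_cfcₙ (by simp) hk0, cfcₙ_mul_cfcₙ (by simp) rfl]
    refine cfcₙ_congr fun t ht => ?_
    have ht0 := quasispectrum_nonneg' hh0 ht
    rcases ht0.eq_or_lt with rfl | ht
    · simp
    · have hs : √t ≠ 0 := (Real.sqrt_pos.2 ht).ne'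
      simp only [k]
      field_simp
      rw [Real.sq_sqrt ht0]
  have hkhk' : cfcₙ k h * cfcₙ k h * h * cfcₙ k h = cfcₙ k h := by
    nth_rw 3 [hid]
    rw [cfcₙ_mul_cfcₙ hk0 hk0, cfcₙ_mul_cfcₙ (by simp [hk0]) rfl, cfcₙ_mul_cfcₙ (by simp) hk0]
    refine cfcₙ_congr fun t ht => ?_
    have ht0 := quasispectrum_nonneg' hh0 ht
    rcases ht0.eq_or_lt with rfl | ht
    · simp [k]
    · have hs : √t ≠ 0 := (Real.sqrt_pos.2 ht).ne'
      simp only [k]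
      field_simp
      rw [Real.sq_sqrt ht0]
  refine ⟨cfcₙ g h * star x, ?_⟩
  rw [mul_assoc, ← hh, hk]
  constructor
  · intro h0
    have h1 : h * cfcₙ k h = 0 := by rw [hh, mul_assoc, h0, mul_zero]
    rw [h1, zero_mul, zero_mul] at hkhk
    exact hx ((CStarRing.star_mul_self_eq_zero_iff x).1 hkhk.symm)
  · rw [star_mul, hks]
    calc x * cfcₙ k h * (cfcₙ k h * star x) * (x * cfcₙ k h)
        = x * (cfcₙ k h * cfcₙ k h * (star x * x) * cfcₙ k h) := by simp only [mul_assoc]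
      _ = x * cfcₙ k h := by rw [← hh, hkhk']

/-- A maximal partial isometry between two projections has centrally orthogonal defects. -/
theorem exists_maximal_partialIsometry {p q : F} (hp : IsStarProjection p)
    (hq : IsStarProjection q) : ∃ v : F, v * star v * v = v ∧ v * p = v ∧ q * v = v ∧
      ∀ y, (q - v * star v) * y * (p - star v * v) = 0 := by
  let S : Set F := {v | v * star v * v = v ∧ v * p = v ∧ q * v = v}
  -- v is chosen with the left ideal F v of largest dimension.
  let R : F → Submodule ℂ F := fun v => LinearMap.range (LinearMap.mulRight ℂ v)
  obtain ⟨v, ⟨hv, hvp, hqv⟩, hmin⟩ := (measure fun v : F =>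
    Module.finrank ℂ F - Module.finrank ℂ (R v)).wf.has_min S ⟨0, by simp [S]⟩
  refine ⟨v, hv, hvp, hqv, ?_⟩
  by_contra! hne
  obtain ⟨y, hy⟩ := hne
  set p' := p - star v * v with hp'
  set q' := q - v * star v with hq'
  have hps : star p = p := hp.isSelfAdjoint
  have hqs : star q = q := hq.isSelfAdjoint
  have hpp : p * p = p := hp.isIdempotentElem
  have hqq : q * q = q := hq.isIdempotentElem
  have hps' : star p' = p' := by simp [hp', hps]
  have hvq : star v * q = star v := by
    have := congrArg star hqv; rwa [star_mul, hqs] at this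
  have hvs : star v * v * star v = star v := by
    have := congrArg star hv
    simpa [mul_assoc] using this
  have hvp' : v * p' = 0 := by rw [hp', mul_sub, hvp, ← mul_assoc, hv, sub_self]
  have hvq' : star v * q' = 0 := by rw [hq', mul_sub, hvq, ← mul_assoc, hvs, sub_self]
  have hp'p : p' * p = p' := by rw [hp', sub_mul, hpp, mul_assoc, hvp]
  have hqq' : q * q' = q' := by rw [hq', mul_sub, hqq, ← mul_assoc, hqv]
  have hpv' : p' * star v = 0 := by
    have := congrArg star hvp'; rwa [star_mul, hps', star_zero] at this
  -- The polar part w of x lies under both defects, so v + w is again an admissible partial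
  -- isometry, and its left ideal is strictly larger.
  set x := q' * y * p' with hx
  obtain ⟨g, hw0, hw⟩ := exists_partialIsometry_mul hy
  have hxv : x * star v = 0 := by rw [hx, mul_assoc, hpv', mul_zero]
  have hvx : star v * x = 0 := by rw [hx, ← mul_assoc, ← mul_assoc, hvq', zero_mul, zero_mul]
  have hqx : q * x = x := by rw [hx, ← mul_assoc, ← mul_assoc, hqq']
  have hxp : x * p = x := by rw [hx, mul_assoc, hp'p]
  set w := x * (g * x) with hwdef
  have hwv : w * star v = 0 := by
    rw [hwdef, mul_assoc x, mul_assoc g, hxv, mul_zero, mul_zero]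
  have hvw : star v * w = 0 := by
    rw [hwdef, ← mul_assoc, hvx, zero_mul]
  have hqw : q * w = w := by
    rw [hwdef, ← mul_assoc, hqx]
  have hwp : w * p = w := by
    rw [hwdef, mul_assoc x, mul_assoc g, hxp]
  have hvw' : v * star w = 0 := by
    have := congrArg star hwv; simpa using this
  have hwv' : star w * v = 0 := by
    have := congrArg star hvw; simpa using this
  have hS : v + w ∈ S := by
    refine ⟨?_, by rw [add_mul, hvp, hwp], by rw [mul_add, hqv, hqw]⟩
    have h1 : (v + w) * star (v + w) = v * star v + w * star w := by
      rw [star_add, add_mul, mul_add, mul_add, hvw', hwv, add_zero, zero_add]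
    rw [h1, add_mul, mul_add, mul_add, hv, hw, mul_assoc v, hvw, mul_assoc w, hwv', mul_zero,
      mul_zero, add_zero, zero_add]
  have hlt : R v < R (v + w) := by
    refine lt_of_le_of_ne ?_ fun heq => ?_
    · rintro _ ⟨z, rfl⟩
      refine ⟨z * v * star v, ?_⟩
      simp only [LinearMap.mulRight_apply, mul_add, mul_assoc, hvw, mul_zero, add_zero]
      rw [← mul_assoc v, hv]
    · have hwR : w ∈ R (v + w) := by
        refine ⟨w * star w, ?_⟩
        simp only [LinearMap.mulRight_apply, mul_add, mul_assoc, hwv', mul_zero, zero_add]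
        rw [← mul_assoc, hw]
      rw [← heq] at hwR
      obtain ⟨z, hz⟩ := hwR
      simp only [LinearMap.mulRight_apply] at hz
      have h0 : w * p' = 0 := by rw [← hz, mul_assoc, hvp', mul_zero]
      have h1 : w * p' = w := by rw [hp', mul_sub, hwp, ← mul_assoc, hwv, zero_mul, sub_zero]
      exact hw0 (h1.symm.trans h0)
  refine hmin (v + w) hS ?_
  have h1 := Submodule.finrank_lt_finrank_of_lt hlt
  have h2 := Submodule.finrank_le (R (v + w))
  show Module.finrank ℂ F - Module.finrank ℂ (R (v + w)) <
    Module.finrank ℂ F - Module.finrank ℂ (R v)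
  omega

/-- The elements of a subspace `I` fixed by right multiplication by `p`. -/
def fixedRight (I : Submodule ℂ F) (p : F) : Submodule ℂ F where
  carrier := {u | u ∈ I ∧ u * p = u}
  add_mem' {a b} ha hb := ⟨I.add_mem ha.1 hb.1, by rw [add_mul, ha.2, hb.2]⟩
  zero_mem' := ⟨I.zero_mem, zero_mul _⟩
  smul_mem' c a ha := ⟨I.smul_mem c ha.1, by rw [smul_mul_assoc, ha.2]⟩

/-- If `k + 1` copies of the projection `p` embed into `k` copies of the projection `q`, then `p`
is Murray–von Neumann equivalent to a subprojection of `q`. -/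
theorem exists_partialIsometry_of_injective {p q : F} (hp : IsStarProjection p)
    (hq : IsStarProjection q) {k : ℕ} (X : Fin (k + 1) → Fin k → F)
    (hX : ∀ u : Fin (k + 1) → F, (∀ i, u i * p = u i) → (∀ l, ∑ i, u i * X i l * q = 0) → u = 0) :
    ∃ v : F, star v * v = p ∧ q * v = v := by
  obtain ⟨v, hv, hvp, hqv, hmax⟩ := exists_maximal_partialIsometry hp hq
  refine ⟨v, ?_, hqv⟩
  set p' := p - star v * v with hp'
  set q' := q - v * star v with hq'
  by_contra hne
  have hp'0 : p' ≠ 0 := fun h => hne (sub_eq_zero.1 h).symm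
  have hps : star p = p := hp.isSelfAdjoint
  have hqs : star q = q := hq.isSelfAdjoint
  have hpp : p * p = p := hp.isIdempotentElem
  have hqq : q * q = q := hq.isIdempotentElem
  have hps' : star p' = p' := by simp [hp', hps]
  have hqs' : star q' = q' := by simp [hq', hqs]
  have hvq : star v * q = star v := by
    have := congrArg star hqv; rwa [star_mul, hqs] at this
  have hvs : star v * v * star v = star v := by
    have := congrArg star hv
    simpa [mul_assoc] using this
  have hvq' : star v * q' = 0 := by rw [hq', mul_sub, hvq, ← mul_assoc, hvs, sub_self]
  have hp'p : p' * p = p' := by rw [hp', sub_mul, hpp, mul_assoc, hvp]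
  have hq'q' : q' * q' = q' := by
    nth_rw 1 [hq']
    rw [sub_mul, mul_assoc, hvq', mul_zero, sub_zero, hq', mul_sub, hqq, ← mul_assoc, hqv]
  -- I consists of the u with u F q' = 0. Right multiplication by q' is zero on I, so v v⋆ acts
  -- there as q does, while the defect p' lies in I by maximality of v.
  let I : Submodule ℂ F :=
    { carrier := {u | ∀ y, u * y * q' = 0}
      add_mem' := fun {a b} ha hb y => by rw [add_mul, add_mul, ha, hb, add_zero]
      zero_mem' := fun y => by rw [zero_mul, zero_mul]
      smul_mem' := fun c a ha y => by rw [smul_mul_assoc, smul_mul_assoc, ha, smul_zero] }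
  have hI : ∀ {u}, u ∈ I → ∀ z, u * z ∈ I := fun {u} hu z y => by
    rw [mul_assoc u]; exact hu (z * y)
  have hIq' : ∀ {u}, u ∈ I → u * q' = 0 := fun {u} hu => by
    rw [← hq'q', ← mul_assoc]; exact hu q'
  have hp'I : p' ∈ I := fun y => by
    have := congrArg star (hmax (star y))
    rw [star_mul, star_mul, star_star, hps', hqs', star_zero, ← mul_assoc] at this
    exact this
  -- `dim I q ≤ dim I p`
  have h1 : Module.finrank ℂ (fixedRight I q) ≤ Module.finrank ℂ (fixedRight I p) := by
    let T : fixedRight I q →ₗ[ℂ] fixedRight I p :=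
      { toFun := fun u => ⟨u * v, hI u.2.1 v, by rw [mul_assoc, hvp]⟩
        map_add' := fun a b => Subtype.ext (add_mul _ _ _)
        map_smul' := fun c a => Subtype.ext (smul_mul_assoc _ _ _) }
    refine LinearMap.finrank_le_finrank_of_injective (f := T) fun a b hab => ?_
    have hab' : (a : F) * v = b * v := congrArg Subtype.val hab
    have key : ∀ c : fixedRight I q, (c : F) = c * v * star v := fun c => by
      have := hIq' c.2.1
      rw [hq', mul_sub, c.2.2, sub_eq_zero] at this
      rw [mul_assoc]; exact this
    refine Subtype.ext ?_
    rw [key a, hab', ← key b]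
  -- `(k + 1) dim I p ≤ k dim I q`
  have h2 : (k + 1) * Module.finrank ℂ (fixedRight I p) ≤
      k * Module.finrank ℂ (fixedRight I q) := by
    let T : (Fin (k + 1) → fixedRight I p) →ₗ[ℂ] (Fin k → fixedRight I q) :=
      { toFun := fun u l => ⟨∑ i, (u i : F) * X i l * q,
          I.sum_mem fun i _ => hI (hI (u i).2.1 _) _, by
            rw [Finset.sum_mul]; simp only [mul_assoc, hqq]⟩
        map_add' := fun a b => by
          ext l
          simp [add_mul, Finset.sum_add_distrib]
        map_smul' := fun c a => by
          ext l
          simp [smul_mul_assoc, Finset.smul_sum] }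
    have hT : Function.Injective T := by
      refine (injective_iff_map_eq_zero T).2 fun u hu => ?_
      have := hX (fun i => u i) (fun i => (u i).2.2) fun l =>
        congrArg Subtype.val (congrFun hu l)
      ext i
      exact congrFun this i
    have := LinearMap.finrank_le_finrank_of_injective hT
    simpa [Module.finrank_pi_fintype] using this
  -- I p contains p' ≠ 0, so (k + 1) dim I p ≤ k dim I q ≤ k dim I p is absurd.
  have h3 : 0 < Module.finrank ℂ (fixedRight I p) := by
    have : Nontrivial (fixedRight I p) :=
      ⟨⟨p', hp'I, hp'p⟩, 0, fun h => hp'0 (congrArg Subtype.val h)⟩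
    exact Module.finrank_pos
  nlinarith

/-- Almost unperforation of finite-dimensional C⋆-algebras, in quantitative form. -/
theorem exists_conj_near_of_finiteDimensional {a b : F} (ha : 0 ≤ a) (hb : 0 ≤ b) {k : ℕ}
    (X : Fin (k + 1) → Fin k → F) (Y : Fin k → Fin (k + 1) → F) {C η θ δ : ℝ} 
    (hX : ∀ i l, ‖X i l‖ ≤ C) (hY : ∀ l j, ‖Y l j‖ ≤ C) (hθ : 0 < θ) (hδ : 0 < δ)
    (hXY : ∀ i j, ‖(if i = j then a * a * a else 0) - ∑ l, X i l * b * Y l j‖ ≤ η)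
    (hη : (k + 1) * (η + k * (C * δ * C)) < θ ^ 3) :
    ∃ r : F, ‖r‖ ≤ (√δ)⁻¹ * √‖a‖ ∧ ‖a - star r * b * r‖ ≤ θ := by
  have hasa : IsSelfAdjoint a := .of_nonneg ha
  have hbsa : IsSelfAdjoint b := .of_nonneg hb
  let ind : ℝ → (ℝ → ℝ) → ℝ → ℝ := fun c f t => if c < t then f t else 0
  have hind0 : ∀ {c : ℝ} (f), 0 < c → ind c f 0 = 0 := fun {c} f hc => if_neg (not_lt.2 hc.le)
  -- p and q are the spectral projections of a and b for (θ, ∞) and (δ, ∞).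
  set p := cfcₙ (ind θ fun _ => 1) a with hp
  set q := cfcₙ (ind δ fun _ => 1) b with hq
  have hproj : ∀ {c : ℝ} (x : F), 0 < c → IsStarProjection (cfcₙ (ind c fun _ => 1) x) :=
    fun {c} x hc => ⟨by
      rw [IsIdempotentElem, cfcₙ_mul_cfcₙ (hind0 _ hc) (hind0 _ hc)]
      refine cfcₙ_congr fun t _ => ?_
      simp only [ind]; split_ifs <;> simp, star_cfcₙ_real _ _⟩
  set b' := cfcₙ (ind δ fun t => t) b with hb'
  have hqb' : q * b' = b' := by
    rw [hq, hb', cfcₙ_mul_cfcₙ (hind0 _ hδ) (hind0 _ hδ)]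
    refine cfcₙ_congr fun t _ => ?_
    simp only [ind]; split_ifs <;> simp
  have hbb' : ‖b - b'‖ ≤ δ := by
    have : b - b' = cfcₙ (fun t => t - ind δ (fun t => t) t) b := by
      rw [cfcₙ_sub (fun t => t) _ b (continuousOn_quasispectrum _ _) rfl
        (continuousOn_quasispectrum _ _) (hind0 _ hδ), cfcₙ_id' ℝ b]
    rw [this]
    refine norm_cfcₙ_le fun t ht => ?_
    have ht0 := quasispectrum_nonneg' hb ht
    simp only [ind]
    split_ifs with h
    · simpa using hδ.le
    · rw [sub_zero, Real.norm_of_nonneg ht0]; exact not_lt.1 h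
  set g := cfcₙ (ind θ fun t => (t ^ 3)⁻¹) a with hg
  have hgn : ‖g‖ ≤ (θ ^ 3)⁻¹ := norm_cfcₙ_le fun t _ => by
    simp only [ind]
    split_ifs with h
    · rw [Real.norm_of_nonneg (by have := hθ.trans h; positivity)]
      gcongr
    · simp; positivity
  have hag : a * a * a * g = p := by
    have h3 : a * a * a = cfcₙ (fun t : ℝ => t * t * t) a := by
      rw [← cfcₙ_mul_cfcₙ (by simp) rfl, ← cfcₙ_mul_cfcₙ rfl rfl, cfcₙ_id' ℝ a]
    rw [h3, hg, cfcₙ_mul_cfcₙ (by simp) (hind0 _ hθ)]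
    refine cfcₙ_congr fun t _ => ?_
    simp only [ind]
    split_ifs with h
    · have := hθ.trans h; field_simp
    · simp
  -- Suppose a row u = u p is killed by X q. Then u_j = u_j a³ g is g applied to a sum of k + 1
  -- errors. Each costs η plus k C δ C for cutting b at δ, and ‖g‖ ≤ θ⁻³, so `hη` would give ‖u‖ <
  -- ‖u‖ for u ≠ 0.
  obtain ⟨v, hvv, hqv⟩ := exists_partialIsometry_of_injective (hproj a hθ) (hproj b hδ) X (by
    intro u hup huX
    by_contra hu0
    have hupos : 0 < ‖u‖ := norm_pos_iff.2 hu0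
    have hC : 0 ≤ k * (C * δ * C) := by
      rcases k.eq_zero_or_pos with rfl | hk
      · simp
      · have : 0 ≤ C := (norm_nonneg _).trans (hX 0 ⟨0, hk⟩)
        positivity
    have hη0 : 0 ≤ η := (norm_nonneg _).trans (hXY 0 0)
    have hE : ∀ i j, ‖(if i = j then a * a * a else 0) - ∑ l, X i l * b' * Y l j‖ ≤
        η + k * (C * δ * C) := by
      intro i j
      have h1 : (if i = j then a * a * a else 0) - ∑ l, X i l * b' * Y l j =
          ((if i = j then a * a * a else 0) - ∑ l, X i l * b * Y l j) +
            ∑ l, X i l * (b - b') * Y l j := by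
        simp only [mul_sub, sub_mul, Finset.sum_sub_distrib]; abel
      rw [h1]
      refine (norm_add_le _ _).trans (add_le_add (hXY i j) ?_)
      refine (norm_sum_le_of_le _ fun l _ => ?_).trans (by simp : ∑ _l : Fin k, C * δ * C ≤ _)
      have hC' : 0 ≤ C := (norm_nonneg _).trans (hX i l)
      exact (norm_mul_le _ _).trans (mul_le_mul ((norm_mul_le _ _).trans
        (mul_le_mul (hX _ _) hbb' (norm_nonneg _) hC')) (hY _ _) (norm_nonneg _) (by positivity))
    have hj : ∀ j, u j = (∑ i, u i * ((if i = j then a * a * a else 0) -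
        ∑ l, X i l * b' * Y l j)) * g := by
      intro j
      have h1 : ∑ i, u i * ∑ l, X i l * b' * Y l j = 0 := by
        have : ∑ i, u i * ∑ l, X i l * b' * Y l j =
            ∑ l, (∑ i, u i * X i l * q) * b' * Y l j := by
          simp only [Finset.mul_sum, Finset.sum_mul]
          rw [Finset.sum_comm]
          refine Finset.sum_congr rfl fun l _ => Finset.sum_congr rfl fun i _ => ?_
          nth_rw 1 [← hqb']
          simp only [mul_assoc]
        rw [this]
        exact Finset.sum_eq_zero fun l _ => by rw [huX l, zero_mul, zero_mul]
      simp only [mul_sub, Finset.sum_sub_distrib]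
      rw [h1, sub_zero]
      simp only [mul_ite, mul_zero, Finset.sum_ite_eq', Finset.mem_univ, if_true]
      rw [mul_assoc, hag, hup]
    have hbound : ‖u‖ ≤ (k + 1) * (η + k * (C * δ * C)) * (θ ^ 3)⁻¹ * ‖u‖ := by
      refine (pi_norm_le_iff_of_nonneg (by positivity)).2 fun j => ?_
      rw [hj j]
      have h1 : ‖∑ i, u i * ((if i = j then a * a * a else 0) - ∑ l, X i l * b' * Y l j)‖ ≤
          (k + 1) * (‖u‖ * (η + k * (C * δ * C))) := by
        refine (norm_sum_le_of_le _ fun i _ => (norm_mul_le _ _).trans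
          (mul_le_mul (norm_le_pi_norm u i) (hE i j) (norm_nonneg _) (norm_nonneg _))).trans ?_
        simp
      refine (norm_mul_le _ _).trans ((mul_le_mul h1 hgn (norm_nonneg _) (by positivity)).trans ?_)
      exact le_of_eq (by ring)
    have hlt : (k + 1) * (η + k * (C * δ * C)) * (θ ^ 3)⁻¹ < 1 := by
      rw [← div_eq_mul_inv, div_lt_one (by positivity)]
      exact hη
    nlinarith)
  rw [← hp] at hvv
  rw [← hq] at hqv
  -- The witness is r = b^(-1/2) v a^(1/2) with both powers cut off, so that r⋆ b r is a cut off at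
  -- θ. Its norm is controlled by δ and ‖a‖ alone, hence uniformly over a net of algebras.
  set s := cfcₙ (ind δ fun t => (√t)⁻¹) b with hs
  set m := cfcₙ (ind θ fun t => √t) a with hm
  have hss : star s = s := star_cfcₙ_real _ _
  have hms : star m = m := star_cfcₙ_real _ _
  have hsbs : s * b * s = q := by
    have hid : s * b = s * cfcₙ (fun t : ℝ => t) b := by rw [cfcₙ_id' ℝ b]
    rw [hid, hs, cfcₙ_mul_cfcₙ (hind0 _ hδ) rfl, cfcₙ_mul_cfcₙ (by simp) (hind0 _ hδ)]
    refine cfcₙ_congr fun t _ => ?_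
    simp only [ind]
    split_ifs with h
    · have ht := hδ.trans h
      have : √t ≠ 0 := (Real.sqrt_pos.2 ht).ne'
      field_simp
      rw [Real.sq_sqrt ht.le]
    · simp
  have hmpm : m * p * m = cfcₙ (ind θ fun t => t) a := by
    rw [hm, hp, cfcₙ_mul_cfcₙ (hind0 _ hθ) (hind0 _ hθ), cfcₙ_mul_cfcₙ (by simp [hind0 _ hθ])
      (hind0 _ hθ)]
    refine cfcₙ_congr fun t _ => ?_
    simp only [ind]
    split_ifs with h
    · simp [Real.mul_self_sqrt (hθ.trans h).le]
    · simp
  refine ⟨s * v * m, ?_, ?_⟩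
  · have hv1 : ‖v‖ ≤ 1 := by
      have h1 : ‖v‖ * ‖v‖ = ‖p‖ := by rw [← CStarRing.norm_star_mul_self, hvv]
      have h2 : ‖p‖ ≤ 1 := norm_cfcₙ_le fun t _ => by
        simp only [ind]; split_ifs <;> simp
      nlinarith [norm_nonneg v]
    have hs1 : ‖s‖ ≤ (√δ)⁻¹ := norm_cfcₙ_le fun t _ => by
      simp only [ind]
      split_ifs with h
      · rw [Real.norm_of_nonneg (by positivity)]
        gcongr
      · simp
    have hm1 : ‖m‖ ≤ √‖a‖ := norm_cfcₙ_le fun t ht => by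
      have ht1 : t ≤ ‖a‖ := (le_abs_self t).trans
        (by simpa using NonUnitalIsometricContinuousFunctionalCalculus.norm_quasispectrum_le a ht)
      simp only [ind]
      split_ifs with h
      · rw [Real.norm_of_nonneg (by positivity)]
        gcongr
      · simp
    calc ‖s * v * m‖ ≤ ‖s‖ * ‖v‖ * ‖m‖ :=
          (norm_mul_le _ _).trans (mul_le_mul_of_nonneg_right (norm_mul_le _ _) (norm_nonneg _))
      _ ≤ (√δ)⁻¹ * 1 * √‖a‖ := by gcongr
      _ = _ := by rw [mul_one]
  · have h1 : star (s * v * m) * b * (s * v * m) = cfcₙ (ind θ fun t => t) a := by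
      rw [← hmpm, ← hvv]
      calc star (s * v * m) * b * (s * v * m) = m * (star v * ((s * b * s) * v)) * m := by
            simp only [star_mul, hss, hms, mul_assoc]
        _ = m * (star v * v) * m := by rw [hsbs, hqv]
    have h2 : a - cfcₙ (ind θ fun t => t) a = cfcₙ (fun t => t - ind θ (fun t => t) t) a := by
      rw [cfcₙ_sub (fun t => t) _ a (continuousOn_quasispectrum _ _) rfl
        (continuousOn_quasispectrum _ _) (hind0 _ hθ), cfcₙ_id' ℝ a]
    rw [h1, h2]
    refine norm_cfcₙ_le fun t ht => ?_
    have ht0 := quasispectrum_nonneg' ha ht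
    simp only [ind]
    split_ifs with h
    · simpa using hθ.le
    · rw [sub_zero, Real.norm_of_nonneg ht0]; exact not_lt.1 h

end FiniteDimensional

/-! ### Nets modulo null nets, and the comparison through the approximating maps. -/

section Nets

variable {L : Type v} [Preorder L]

/-- A net of elements of normed groups is bounded. -/
def BddNet {E : L → Type*} [∀ l, Norm (E l)] (x : ∀ l, E l) : Prop := ∃ C, ∀ l, ‖x l‖ ≤ C

section

variable {E : L → Type*} [∀ l, NonUnitalCStarAlgebra (E l)]

theorem BddNet.mul {x y : ∀ l, E l} (hx : BddNet x) (hy : BddNet y) :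
    BddNet (fun l => x l * y l) := by
  obtain ⟨C, hC⟩ := hx
  obtain ⟨D, hD⟩ := hy
  exact ⟨C * D, fun l => (norm_mul_le _ _).trans (mul_le_mul (hC l) (hD l) (norm_nonneg _)
    ((norm_nonneg _).trans (hC l)))⟩

theorem BddNet.conj {x : ∀ l, E l} (hx : BddNet x) : BddNet (fun l => star (x l)) := by
  obtain ⟨C, hC⟩ := hx
  exact ⟨C, fun l => by rw [norm_star]; exact hC l⟩

theorem BddNet.sum {ι : Type*} (s : Finset ι) {x : ι → ∀ l, E l} (hx : ∀ i, BddNet (x i)) :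
    BddNet (fun l => ∑ i ∈ s, x i l) := by
  choose C hC using hx
  exact ⟨∑ i ∈ s, C i, fun l => norm_sum_le_of_le _ fun i _ => hC i l⟩

/-- A bounded net as an element of the product C⋆-algebra. -/
def BddNet.toLp {x : ∀ l, E l} (hx : BddNet x) : lp E ∞ :=
  ⟨x, memℓp_infty (by obtain ⟨C, hC⟩ := hx; exact ⟨C, by rintro _ ⟨l, rfl⟩; exact hC l⟩)⟩

/-- The class of a bounded net modulo null nets. -/
def BddNet.cls {x : ∀ l, E l} (hx : BddNet x) : ProdModSum E := ProdModSum.mk E hx.toLp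

theorem BddNet.cls_eq_cls {x y : ∀ l, E l} (hx : BddNet x) (hy : BddNet y)
    (h : Tendsto (fun l => ‖x l - y l‖) atTop (𝓝 0)) : hx.cls = hy.cls :=
  ProdModSum.mk_eq_mk.2 h

theorem BddNet.cls_nonneg [∀ l, PartialOrder (E l)] [∀ l, StarOrderedRing (E l)]
    {x : ∀ l, E l} (hx : BddNet x) (h : ∀ l, 0 ≤ x l) : 0 ≤ hx.cls := by
  choose c hc using fun l => exists_eq_star_mul_self (h l)
  have hcb : BddNet c := by
    obtain ⟨C, hC⟩ := hx
    refine ⟨√C, fun l => Real.le_sqrt_of_sq_le ?_⟩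
    rw [sq, ← CStarRing.norm_star_mul_self, ← hc]
    exact hC l
  have : hx.cls = star hcb.cls * hcb.cls := by
    refine BddNet.cls_eq_cls hx (hcb.conj.mul hcb) ?_
    simpa [← hc] using tendsto_const_nhds
  rw [this]
  exact star_mul_self_nonneg _

/-- A bounded net of linear maps that preserves boundedness of nets. -/
def BddMaps {G : L → Type*} [∀ l, NonUnitalCStarAlgebra (G l)] (f : ∀ l, E l →ₗ[ℂ] G l) : Prop :=
  ∃ C, 0 ≤ C ∧ ∀ l x, ‖f l x‖ ≤ C * ‖x‖

variable {G : L → Type*} [∀ l, NonUnitalCStarAlgebra (G l)] {f : ∀ l, E l →ₗ[ℂ] G l}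

theorem BddMaps.bddNet (hf : BddMaps f) {x : ∀ l, E l} (hx : BddNet x) :
    BddNet (fun l => f l (x l)) := by
  obtain ⟨C, hC0, hC⟩ := hf
  obtain ⟨D, hD⟩ := hx
  exact ⟨C * D, fun l => (hC l _).trans (mul_le_mul_of_nonneg_left (hD l) hC0)⟩

theorem tendsto_zero_mul_bddNet {x y : ∀ l, E l} (hx : Tendsto (fun l => ‖x l‖) atTop (𝓝 0))
    (hy : BddNet y) : Tendsto (fun l => ‖x l * y l‖) atTop (𝓝 0) := by
  obtain ⟨C, hC⟩ := hy
  refine squeeze_zero (fun _ => norm_nonneg _) (fun l => (norm_mul_le _ _).trans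
    (mul_le_mul_of_nonneg_left (hC l) (norm_nonneg _))) (by simpa using hx.mul_const C)

theorem bddNet_mul_tendsto_zero {x y : ∀ l, E l} (hx : BddNet x)
    (hy : Tendsto (fun l => ‖y l‖) atTop (𝓝 0)) : Tendsto (fun l => ‖x l * y l‖) atTop (𝓝 0) := by
  obtain ⟨C, hC⟩ := hx
  refine squeeze_zero (fun _ => norm_nonneg _) (fun l => (norm_mul_le _ _).trans
    (mul_le_mul_of_nonneg_right (hC l) (norm_nonneg _))) (by simpa using hy.const_mul C)

/-- Asymptotic multiplicativity of order zero type, on the nets in a class `P`. -/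
def AsympOrderZero (f : ∀ l, E l →ₗ[ℂ] G l) (P : (∀ l, E l) → Prop) : Prop :=
  ∀ x y z, P x → P y → P z → Tendsto (fun l =>
    ‖f l (x l * y l) * f l (z l) - f l (x l) * f l (y l * z l)‖) atTop (𝓝 0)

/-- Three moves: z passes to u, then y to z u, then z u to w. When f(xyz), f(u) and f(w) agree, this
factors a cube through f(y). -/
theorem AsympOrderZero.triple {P : (∀ l, E l) → Prop} (h : AsympOrderZero f P) (hf : BddMaps f)
    (hP : ∀ x, P x → BddNet x) (hmul : ∀ x y, P x → P y → P (fun l => x l * y l))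
    {x y z u w : ∀ l, E l} (hx : P x) (hy : P y) (hz : P z) (hu : P u) (hw : P w) :
    Tendsto (fun l => ‖f l (x l * y l * z l) * f l (u l) * f l (w l) -
      f l (x l) * f l (y l) * f l (z l * (u l * w l))‖) atTop (𝓝 0) := by
  have h1 := tendsto_zero_mul_bddNet (h _ z u (hmul x y hx hy) hz hu) (hf.bddNet (hP w hw))
  have h2 := tendsto_zero_mul_bddNet (h x y _ hx hy (hmul z u hz hu)) (hf.bddNet (hP w hw))
  have h3 := bddNet_mul_tendsto_zero (hf.bddNet (hP x hx)) (h y _ w hy (hmul z u hz hu) hw)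
  refine squeeze_zero (fun _ => norm_nonneg _) (fun l => ?_) (by simpa using (h1.add h2).add h3)
  refine le_trans (le_of_eq (congrArg norm ?_)) (norm_add₃_le)
  simp only [mul_assoc, sub_mul, mul_sub]
  abel

end

variable [IsDirectedOrder L] [Nonempty L] {A : Type u} [NonUnitalCStarAlgebra A] [PartialOrder A]
  [StarOrderedRing A] {F : L → Type w} [∀ l, NonUnitalCStarAlgebra (F l)]
  [∀ l, PartialOrder (F l)] [∀ l, StarOrderedRing (F l)]

/-- Nets of positive maps `A → F l → A` that are asymptotically of order zero. -/
structure OrderZeroNet (ψ : ∀ l, A →ₗ[ℂ] F l) (φ : ∀ l, F l →ₗ[ℂ] A) : Prop where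
  norm_in_le : ∀ l a, ‖ψ l a‖ ≤ ‖a‖
  norm_out_le : ∀ l a, ‖φ l a‖ ≤ ‖a‖
  nonneg_in : ∀ l a, 0 ≤ a → 0 ≤ ψ l a
  nonneg_out : ∀ l a, 0 ≤ a → 0 ≤ φ l a
  -- The map induced by ψ is defined on A, so it gives information on constant nets only; the one
  -- induced by φ sees all bounded nets.
  orderZero_in : AsympOrderZero ψ fun x => ∃ a, x = fun _ => a
  orderZero_out : AsympOrderZero φ BddNet

theorem bddNet_const (a : A) : BddNet (fun _ : L => a) := ⟨‖a‖, fun _ => le_rfl⟩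

theorem BddMaps.of_contractive {E G : L → Type*} [∀ l, NonUnitalCStarAlgebra (E l)]
    [∀ l, NonUnitalCStarAlgebra (G l)] {f : ∀ l, E l →ₗ[ℂ] G l} (hf : ∀ l x, ‖f l x‖ ≤ ‖x‖) :
    BddMaps f := ⟨1, zero_le_one, fun l x => by simpa using hf l x⟩

theorem OrderZeroNet.bdd_in {ψ : ∀ l, A →ₗ[ℂ] F l} {φ : ∀ l, F l →ₗ[ℂ] A}
    (h : OrderZeroNet ψ φ) : BddMaps ψ := .of_contractive h.norm_in_le

theorem OrderZeroNet.bdd_out {ψ : ∀ l, A →ₗ[ℂ] F l} {φ : ∀ l, F l →ₗ[ℂ] A}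
    (h : OrderZeroNet ψ φ) : BddMaps φ := .of_contractive h.norm_out_le

theorem OrderZeroNet.bddNet {ψ : ∀ l, A →ₗ[ℂ] F l} {φ : ∀ l, F l →ₗ[ℂ] A}
    (h : OrderZeroNet ψ φ) (a : A) : BddNet (fun l => φ l (ψ l a)) :=
  h.bdd_out.bddNet (h.bdd_in.bddNet (bddNet_const a))

/-- `k + 1` copies of `a` are Cuntz below `k` copies of `b`, up to an error `e`. -/
def AmpSub {B : Type*} [NonUnitalCStarAlgebra B] (k : ℕ) (a b : B) (e : ℝ) : Prop :=
  ∃ d : Fin k → Fin (k + 1) → B,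
    ∀ i j, ‖(if i = j then a else 0) - ∑ l, star (d l i) * b * d l j‖ < e

/-- The precision at which a comparison of `k + 1` copies of an element of norm `r` with `k` copies
of another one is needed to get a comparison up to `e`. -/
def tol (k : ℕ) (r e : ℝ) : ℝ := (e / 4) ^ 3 / (4 * (k + 1)) / (2 * (r * r + 1))

theorem tol_pos (k : ℕ) (r : ℝ) {e : ℝ} (he : 0 < e) : 0 < tol k r e := by
  have : 0 ≤ r * r := mul_self_nonneg r
  unfold tol
  positivity

/-- The chain is φψ(a) ≈ φ(r⋆ ψ(b) r) ≲ φψ(b) ≤ b: the first link is almost unperforation in `F l`,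
the second is order zero of φ, the third is `hT`. The comparison is required at a single precision
only, so that it survives a compression to matrices over A. -/
theorem OrderZeroNet.exists_near [∀ l, FiniteDimensional ℂ (F l)] {ψ : ∀ l, A →ₗ[ℂ] F l}
    {φ : ∀ l, F l →ₗ[ℂ] A} (h : OrderZeroNet ψ φ) {a b : A} (ha : 0 ≤ a) (hb : 0 ≤ b) {k : ℕ}
    {e : ℝ} (he : 0 < e) (hab : AmpSub k a b (tol k ‖a‖ e))
    (hT : (h.bddNet b).cls ≤ ProdModSum.diag L A b) :
    ∀ᶠ l in atTop, ∃ x, ‖φ l (ψ l a) - star x * b * x‖ < e := by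
  have hC := h.norm_in_le
  set θ := e / 4 with hθe
  have hθ : 0 < θ := by positivity
  -- The finite-dimensional comparison needs (k + 1)(η + k K δ K) < θ³; once k K δ K ≤ η, the left
  -- side is at most θ³ / 2. Half of η pays for the inexactness of d, magnified by M² when
  -- multiplied by ψ(a) twice, and half for the defect of ψ from order zero.
  set η := θ ^ 3 / (4 * (k + 1)) with hη
  have hη0 : 0 < η := by positivity
  set M := ‖a‖ with hM
  have hM0 : 0 ≤ M := norm_nonneg a
  obtain ⟨d, hd⟩ := hab
  set η' := tol k M e with hη'def
  have hη'0 : 0 < η' := tol_pos k M he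
  have hη' : η' * M * M ≤ η / 2 := by
    have h1 : η' = η / (2 * (M * M + 1)) := rfl
    rw [h1, div_mul_eq_mul_div, div_mul_eq_mul_div, div_le_div_iff₀ (by positivity) (by positivity)]
    nlinarith
  set K := ∑ l, ∑ i, (‖star (d l i)‖ + ‖d l i * (a * a)‖) with hK
  have hKle : ∀ l i, ‖star (d l i)‖ + ‖d l i * (a * a)‖ ≤ K := fun l i =>
    (Finset.single_le_sum (f := fun i => ‖star (d l i)‖ + ‖d l i * (a * a)‖)
      (fun _ _ => by positivity) (Finset.mem_univ i)).trans
      (Finset.single_le_sum (f := fun l => ∑ i, (‖star (d l i)‖ + ‖d l i * (a * a)‖))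
      (fun _ _ => by positivity) (Finset.mem_univ l))
  have hK0 : 0 ≤ K := by positivity
  -- K depends on d and a but not on l, so neither does δ, nor the bound R on r.
  obtain ⟨δ, hδ, hKδ⟩ : ∃ δ > 0, k * (K * δ * K) ≤ η := by
    refine ⟨η / (k * K * K + 1), by positivity, ?_⟩
    rw [show k * (K * (η / (k * K * K + 1)) * K) = η * (k * K * K) / (k * K * K + 1) by ring,
      div_le_iff₀ (by positivity)]
    nlinarith
  have hbound : (k + 1) * (η + k * (K * δ * K)) < θ ^ 3 := by
    have h1 : (k + 1) * (η + k * (K * δ * K)) ≤ (k + 1) * (2 * η) := by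
      gcongr; linarith
    have h2 : (k + 1) * (2 * η) = θ ^ 3 / 2 := by rw [hη]; field_simp; norm_num
    have : 0 < θ ^ 3 := by positivity
    linarith
  -- the order zero condition on `ψ` turns `d` into a Cuntz comparison in `F l`
  have hE : ∀ᶠ l in atTop, ∀ i j, ‖(if i = j then ψ l a * ψ l a * ψ l a else 0) -
      ∑ m, ψ l (star (d m i)) * ψ l b * ψ l (d m j * (a * a))‖ ≤ η := by
    rw [eventually_all]
    intro i
    rw [eventually_all]
    intro j
    have hlim : Tendsto (fun l => ∑ m, ‖ψ l (star (d m i) * b * d m j) * ψ l a * ψ l a -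
        ψ l (star (d m i)) * ψ l b * ψ l (d m j * (a * a))‖) atTop (𝓝 0) := by
      rw [show (0 : ℝ) = ∑ _m : Fin k, 0 by simp]
      refine tendsto_finsetSum _ fun m _ => ?_
      exact h.orderZero_in.triple h.bdd_in (by rintro _ ⟨c, rfl⟩; exact bddNet_const c)
        (by rintro _ _ ⟨c, rfl⟩ ⟨c', rfl⟩; exact ⟨c * c', rfl⟩) ⟨_, rfl⟩ ⟨_, rfl⟩ ⟨_, rfl⟩
        ⟨_, rfl⟩ ⟨_, rfl⟩
    filter_upwards [hlim.eventually_lt_const (half_pos hη0)] with l hl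
    have h1 : (if i = j then ψ l a * ψ l a * ψ l a else 0) -
        ∑ m, ψ l (star (d m i)) * ψ l b * ψ l (d m j * (a * a)) =
        ψ l ((if i = j then a else 0) - ∑ m, star (d m i) * b * d m j) * ψ l a * ψ l a +
        ∑ m, (ψ l (star (d m i) * b * d m j) * ψ l a * ψ l a -
          ψ l (star (d m i)) * ψ l b * ψ l (d m j * (a * a))) := by
      rw [map_sub, map_sum, sub_mul, sub_mul, Finset.sum_mul, Finset.sum_mul,
        Finset.sum_sub_distrib]
      split_ifs
      · abel
      · simp only [map_zero, zero_mul]; abel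
    rw [h1]
    refine (norm_add_le _ _).trans ?_
    have h2 : ‖ψ l ((if i = j then a else 0) - ∑ m, star (d m i) * b * d m j) * ψ l a * ψ l a‖ ≤
        η' * M * M := by
      refine (norm_mul_le _ _).trans (mul_le_mul ((norm_mul_le _ _).trans (mul_le_mul
        ((hC l _).trans ?_) (hC l a) (norm_nonneg _) (by positivity))) (hC l a) (norm_nonneg _)
        (by positivity))
      exact (hd i j).le
    have h3 := norm_sum_le Finset.univ fun m => (ψ l (star (d m i) * b * d m j) * ψ l a * ψ l a -
          ψ l (star (d m i)) * ψ l b * ψ l (d m j * (a * a)))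
    linarith
  set R := (√δ)⁻¹ * √M with hR
  -- At the indices where the estimate fails, r = 0 is taken, so that r is a bounded net defined
  -- everywhere.
  have hr : ∀ l, ∃ r : F l, ‖r‖ ≤ R ∧ ((∀ i j, ‖(if i = j then ψ l a * ψ l a * ψ l a else 0) -
      ∑ m, ψ l (star (d m i)) * ψ l b * ψ l (d m j * (a * a))‖ ≤ η) →
      ‖ψ l a - star r * ψ l b * r‖ ≤ θ) := by
    intro l
    by_cases hl : ∀ i j, ‖(if i = j then ψ l a * ψ l a * ψ l a else 0) -
      ∑ m, ψ l (star (d m i)) * ψ l b * ψ l (d m j * (a * a))‖ ≤ η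
    · obtain ⟨r, hr1, hr2⟩ := exists_conj_near_of_finiteDimensional (h.nonneg_in l a ha)
        (h.nonneg_in l b hb) (fun i m => ψ l (star (d m i))) (fun m j => ψ l (d m j * (a * a)))
        (C := K) (fun i m => (hC l _).trans (le_trans (by
          have : 0 ≤ ‖d m i * (a * a)‖ := by positivity
          linarith) (hKle m i))) (fun m j => (hC l _).trans (le_trans (by
          have : 0 ≤ ‖star (d m j)‖ := by positivity
          linarith) (hKle m j))) hθ hδ hl hbound
      refine ⟨r, hr1.trans ?_, fun _ => hr2⟩
      rw [hR]
      gcongr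
      exact hC l a
    · exact ⟨0, by simp; positivity, fun h => absurd h hl⟩
  choose r hrR hrθ using hr
  have hrb : BddNet r := ⟨R, hrR⟩
  have hcb : BddNet (fun l => ψ l b) := h.bdd_in.bddNet (bddNet_const b)
  have hsb : BddNet (fun l => star (r l) * ψ l b * r l) := (hrb.conj.mul hcb).mul hrb
  have hPb : BddNet (fun l => φ l (star (r l) * ψ l b * r l)) := h.bdd_out.bddNet hsb
  -- With s = r⋆ ψ(b) r and P = φ(s), the triple identity reads P³ = φ(r⋆) φψ(b) φ(r s s).
  have hcube : hPb.cls * hPb.cls * hPb.cls = (h.bdd_out.bddNet hrb.conj).cls * (h.bddNet b).cls *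
      (h.bdd_out.bddNet (hrb.mul (hsb.mul hsb))).cls := by
    refine BddNet.cls_eq_cls ((hPb.mul hPb).mul hPb)
      (((h.bdd_out.bddNet hrb.conj).mul (h.bddNet b)).mul
        (h.bdd_out.bddNet (hrb.mul (hsb.mul hsb)))) ?_
    exact h.orderZero_out.triple h.bdd_out (fun _ hx => hx) (fun _ _ hx hy => hx.mul hy) hrb.conj
      hcb hrb hsb hsb
  have hPnn : 0 ≤ hPb.cls := hPb.cls_nonneg fun l => h.nonneg_out l _
    (star_left_conjugate_nonneg (h.nonneg_in l b hb) (r l))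
  have hTnn : 0 ≤ (h.bddNet b).cls := (h.bddNet b).cls_nonneg fun l =>
    h.nonneg_out l _ (h.nonneg_in l b hb)
  have hsub : Sub hPb.cls (ProdModSum.diag L A b) :=
    (Sub.of_cube_eq hPnn hTnn hcube).trans (Sub.of_le hTnn hT)
  obtain ⟨z, hz⟩ := sub_iff.1 hsub (e / 2) (half_pos he)
  obtain ⟨z, rfl⟩ := ProdModSum.mk_surjective z
  have hz' := ProdModSum.eventually_norm_lt
    (hPb.toLp - star z * (bddNet_const (L := L) b).toLp * z) (r := e / 2) hz
  filter_upwards [hE, hz'] with l h1 h2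
  refine ⟨z l, ?_⟩
  have h3 : ‖φ l (star (r l) * ψ l b * r l) - star (z l) * b * z l‖ < e / 2 := h2
  have h4 : ‖φ l (ψ l a) - φ l (star (r l) * ψ l b * r l)‖ ≤ θ := by
    rw [← map_sub]
    exact (h.norm_out_le l _).trans (hrθ l h1)
  calc ‖φ l (ψ l a) - star (z l) * b * z l‖
      = ‖(φ l (ψ l a) - φ l (star (r l) * ψ l b * r l)) +
          (φ l (star (r l) * ψ l b * r l) - star (z l) * b * z l)‖ := by congr 1; abel
    _ ≤ _ := norm_add_le _ _
    _ < e := by linarith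

/-- If the net `∑ φ i l (ψ i l b)` approximates `b`, then each of its terms is asymptotically
dominated by `b`. -/
theorem OrderZeroNet.cls_le_diag {F : ℕ → L → Type w} [∀ i l, NonUnitalCStarAlgebra (F i l)]
    [∀ i l, PartialOrder (F i l)] [∀ i l, StarOrderedRing (F i l)] {ψ : ∀ i l, A →ₗ[ℂ] F i l}
    {φ : ∀ i l, F i l →ₗ[ℂ] A} (h : ∀ i, OrderZeroNet (ψ i) (φ i)) {b : A} (hb : 0 ≤ b)
    (hsum : ∀ e > 0, ∃ n, ∀ m ≥ n, ∀ᶠ l in atTop,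
      ‖b - ∑ i ∈ Finset.range m, φ i l (ψ i l b)‖ < e) (i : ℕ) :
    ((h i).bddNet b).cls ≤ ProdModSum.diag L A b := by
  have hS : ∀ m, BddNet (fun l => ∑ i ∈ Finset.range m, φ i l (ψ i l b)) := fun m =>
    BddNet.sum _ fun i => (h i).bddNet b
  have hlim : Tendsto (fun m => (hS m).cls) atTop (𝓝 (ProdModSum.diag L A b)) := by
    rw [Metric.tendsto_atTop]
    intro e he
    obtain ⟨n, hn⟩ := hsum (e / 2) (half_pos he)
    refine ⟨n, fun m hm => ?_⟩
    rw [dist_comm, dist_eq_norm]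
    refine lt_of_le_of_lt (ProdModSum.norm_mk_le_of_eventually
      ((bddNet_const (L := L) b).toLp - (hS m).toLp) (half_pos he).le ?_) (half_lt_self he)
    filter_upwards [hn m hm] with l hl
    exact hl.le
  -- The class of b is the limit of the partial sums, and once m > i, removing the i-th term leaves
  -- a sum of positive terms.
  refine ge_of_tendsto hlim ?_
  filter_upwards [eventually_gt_atTop i] with m hm
  rw [← sub_nonneg]
  have hrest : BddNet (fun l => ∑ j ∈ (Finset.range m).erase i, φ j l (ψ j l b)) :=
    BddNet.sum _ fun i => (h i).bddNet b
  have heq : (hS m).cls - ((h i).bddNet b).cls = hrest.cls := by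
    rw [sub_eq_iff_eq_add]
    refine (congrArg (ProdModSum.mk _) ?_ : (hS m).cls = ProdModSum.mk _ (hrest.toLp +
      ((h i).bddNet b).toLp))
    ext l
    exact (Finset.sum_erase_add _ _ (Finset.mem_range.2 hm)).symm
  rw [heq]
  exact hrest.cls_nonneg fun l => Finset.sum_nonneg fun j _ =>
    (h j).nonneg_out l _ ((h j).nonneg_in l b hb)

/-- The main comparison estimate: if `a ≈ ∑ φ i l (ψ i l a)` and `k i + 1` copies of `a` are below
`k i` copies of `b i` for all `i < n`, then `a` is close to some `∑ x i⋆ b i x i`. -/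
theorem OrderZeroNet.exists_sum_near {F : ℕ → L → Type w} [∀ i l, NonUnitalCStarAlgebra (F i l)]
    [∀ i l, PartialOrder (F i l)] [∀ i l, StarOrderedRing (F i l)]
    [∀ i l, FiniteDimensional ℂ (F i l)] {ψ : ∀ i l, A →ₗ[ℂ] F i l}
    {φ : ∀ i l, F i l →ₗ[ℂ] A} (h : ∀ i, OrderZeroNet (ψ i) (φ i))
    (hsum : ∀ b, ∀ e > 0, ∃ n, ∀ m ≥ n, ∀ᶠ l in atTop,
      ‖b - ∑ i ∈ Finset.range m, φ i l (ψ i l b)‖ < e) {a : A} (ha : 0 ≤ a) {b : ℕ → A}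
    (hb : ∀ i, 0 ≤ b i) {k : ℕ → ℕ} {n : ℕ} {e e' : ℝ} (hee : e < e')
    (hab : ∀ i < n, AmpSub (k i) a (b i) (tol (k i) ‖a‖ ((e' - e) / (n + 1))))
    (hn : ∀ᶠ l in atTop, ‖a - ∑ i ∈ Finset.range n, φ i l (ψ i l a)‖ < e) :
    ∃ x : ℕ → A, ‖a - ∑ i ∈ Finset.range n, star (x i) * b i * x i‖ < e' := by
  have hpos : 0 < (e' - e) / (n + 1) := div_pos (sub_pos.2 hee) (by positivity)
  have hall : ∀ᶠ l in atTop, ∀ i ∈ Finset.range n,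
      ∃ x, ‖φ i l (ψ i l a) - star x * b i * x‖ < (e' - e) / (n + 1) := by
    rw [Filter.eventually_all_finset]
    intro i hi
    exact (h i).exists_near ha (hb i) hpos (hab i (Finset.mem_range.1 hi))
      (OrderZeroNet.cls_le_diag h (hb i) (hsum (b i)) i)
  -- One index l serves all n terms; the slack e' - e is shared among them.
  obtain ⟨l, hl1, hl2⟩ := (hall.and hn).exists
  choose! x hx using hl1
  refine ⟨x, ?_⟩
  have h1 : a - ∑ i ∈ Finset.range n, star (x i) * b i * x i =
      (a - ∑ i ∈ Finset.range n, φ i l (ψ i l a)) +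
        ∑ i ∈ Finset.range n, (φ i l (ψ i l a) - star (x i) * b i * x i) := by
    rw [Finset.sum_sub_distrib]; abel
  rw [h1]
  refine (norm_add_le _ _).trans_lt ?_
  have h2 : ‖∑ i ∈ Finset.range n, (φ i l (ψ i l a) - star (x i) * b i * x i)‖ ≤
      n * ((e' - e) / (n + 1)) :=
    (norm_sum_le_of_le _ fun i hi => (hx i hi).le).trans (by simp)
  have h3 : n * ((e' - e) / (n + 1)) ≤ e' - e := by
    rw [← mul_div_assoc, div_le_iff₀ (by positivity)]
    nlinarith
  linarith

end Nets

/-! ### 2 × 2 block matrices and contractivity of amplifications. -/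

section Blocks

variable {B : Type*} [NonUnitalCStarAlgebra B] [PartialOrder B] [StarOrderedRing B]
  {m : Type} [Fintype m]

/-- The `2 × 2` block matrix with entries `a b c d`. -/
def blocks (a b c d : CStarMatrix m m B) : CStarMatrix (m ⊕ m) (m ⊕ m) B :=
  CStarMatrix.ofMatrix (Matrix.fromBlocks a b c d)

theorem blocks_mul (a b c d a' b' c' d' : CStarMatrix m m B) :
    blocks a b c d * blocks a' b' c' d' = blocks (a * a' + b * c') (a * b' + b * d')
      (c * a' + d * c') (c * b' + d * d') :=
  Matrix.fromBlocks_multiply (α := B) a b c d a' b' c' d'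

theorem star_blocks (a b c d : CStarMatrix m m B) :
    star (blocks a b c d) = blocks (star a) (star c) (star b) (star d) :=
  Matrix.fromBlocks_conjTranspose (α := B) a b c d

theorem blocks_inj {a b c d a' b' c' d' : CStarMatrix m m B} :
    blocks a b c d = blocks a' b' c' d' ↔ a = a' ∧ b = b' ∧ c = c' ∧ d = d' :=
  Matrix.fromBlocks_inj (α := B)

theorem exists_eq_blocks (M : CStarMatrix (m ⊕ m) (m ⊕ m) B) : ∃ a b c d, M = blocks a b c d :=
  ⟨_, _, _, _, (Matrix.fromBlocks_toBlocks (α := B) M).symm⟩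

/-- The embedding `a ↦ diag (a, 0)`. -/
def cornerHom : CStarMatrix m m B →⋆ₙₐ[ℂ] CStarMatrix (m ⊕ m) (m ⊕ m) B where
  toFun a := blocks a 0 0 0
  map_smul' c a := by
    ext (i | i) (j | j) <;> simp [blocks, Matrix.fromBlocks]
  map_zero' := Matrix.fromBlocks_zero
  map_add' a b := by
    ext (i | i) (j | j) <;> simp [blocks, Matrix.fromBlocks]
  map_mul' a b := by rw [blocks_mul]; simp
  map_star' a := by rw [star_blocks]; simp

theorem norm_cornerHom (a : CStarMatrix m m B) : ‖blocks a 0 0 0‖ = ‖a‖ :=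
  NonUnitalStarAlgHom.norm_map (cornerHom (B := B) (m := m)) (fun _ _ h => (blocks_inj.1 h).1) a

/-- Cauchy–Schwarz for the two block columns of a factor X with X⋆ X the given matrix: b is the
product of the adjoint of the first column with the second. The columns are padded to square
matrices, so that the C⋆-identity applies to them. -/
theorem norm_mul_self_le_of_blocks_nonneg {a b c d : CStarMatrix m m B} (h : 0 ≤ blocks a b c d) :
    ‖b‖ * ‖b‖ ≤ ‖a‖ * ‖d‖ := by
  obtain ⟨X, hX⟩ := exists_eq_star_mul_self h
  obtain ⟨p, q, r, s, rfl⟩ := exists_eq_blocks X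
  rw [star_blocks, blocks_mul, blocks_inj] at hX
  obtain ⟨ha, hb, -, hd⟩ := hX
  have e : ∀ p q r s : CStarMatrix m m B, star (blocks p 0 q 0) * blocks r 0 s 0 =
      blocks (star p * r + star q * s) 0 0 0 := by
    intro p q r s
    rw [star_blocks, blocks_mul]; simp
  have h1 : ‖b‖ ≤ ‖blocks p 0 r 0‖ * ‖blocks q 0 s 0‖ := by
    rw [← norm_cornerHom, hb, ← e, ← norm_star (blocks p 0 r 0)]
    exact norm_mul_le _ _
  have h2 : ‖blocks p 0 r 0‖ * ‖blocks p 0 r 0‖ = ‖a‖ := by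
    rw [← CStarRing.norm_star_mul_self, e, ← ha, norm_cornerHom]
  have h3 : ‖blocks q 0 s 0‖ * ‖blocks q 0 s 0‖ = ‖d‖ := by
    rw [← CStarRing.norm_star_mul_self, e, ← hd, norm_cornerHom]
  rw [← h2, ← h3]
  calc ‖b‖ * ‖b‖ ≤ (‖blocks p 0 r 0‖ * ‖blocks q 0 s 0‖) * (‖blocks p 0 r 0‖ * ‖blocks q 0 s 0‖) :=
        mul_le_mul h1 h1 (norm_nonneg _) (by positivity)
    _ = _ := by ring

end Blocks

/-- The diagonal embedding of `A` into the matrices over `A`. -/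
def scalarHom (A : Type*) [NonUnitalCStarAlgebra A] [PartialOrder A] [StarOrderedRing A]
    (n : ℕ) : A →⋆ₙₐ[ℂ] Mat A n where
  toFun a := CStarMatrix.ofMatrix (Matrix.diagonal fun _ => a)
  map_smul' c a := by
    ext i j; by_cases h : i = j <;> simp [Matrix.diagonal, h]
  map_zero' := Matrix.diagonal_zero
  map_add' a b := by
    ext i j; by_cases h : i = j <;> simp [Matrix.diagonal, h]
  map_mul' a b := (Matrix.diagonal_mul_diagonal (α := A) (n := Fin n) (fun _ => a) fun _ => b).symm
  map_star' a := (Matrix.diagonal_conjTranspose (α := A) (n := Fin n) fun _ => a).symm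

theorem tendsto_star_mul_mul {A : Type*} [NonUnitalCStarAlgebra A] [PartialOrder A]
    [StarOrderedRing A] (a : A) :
    Tendsto (fun u : A => star u * a * u) (CStarAlgebra.approximateUnit A) (𝓝 a) := by
  have hu := CStarAlgebra.increasingApproximateUnit A
  have hl : Tendsto (fun u : A => a * u) (CStarAlgebra.approximateUnit A) (𝓝 a) :=
    hu.tendsto_mul_left a
  have hr : Tendsto (fun u : A => u * a) (CStarAlgebra.approximateUnit A) (𝓝 a) :=
    hu.tendsto_mul_right a
  rw [tendsto_iff_norm_sub_tendsto_zero] at *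
  refine squeeze_zero' (.of_forall fun _ => norm_nonneg _) ?_ (by simpa using hl.add hr)
  filter_upwards [hu.eventually_norm, hu.eventually_star_eq] with u hu1 hu2
  have : star u * a * u - a = u * (a * u - a) + (u * a - a) := by
    rw [hu2]; noncomm_ring
  rw [this]
  refine (norm_add_le _ _).trans (add_le_add_left ?_ _)
  calc ‖u * (a * u - a)‖ ≤ ‖u‖ * ‖a * u - a‖ := norm_mul_le _ _
    _ ≤ 1 * ‖a * u - a‖ := by gcongr
    _ = _ := one_mul _

theorem norm_map_conj_le {A B : Type*} [NonUnitalCStarAlgebra A] [PartialOrder A]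
    [StarOrderedRing A] [NonUnitalCStarAlgebra B] [PartialOrder B] [StarOrderedRing B]
    {G : A →ₗ[ℂ] B} (hG : ∀ a, 0 ≤ a → 0 ≤ G a) (x e : A) :
    ‖G (star e * (star x * x) * e)‖ ≤ ‖x‖ * ‖x‖ * ‖G (star e * e)‖ := by
  have h2 := CStarAlgebra.star_left_conjugate_le_norm_smul (a := e)
    (IsSelfAdjoint.star_mul_self x)
  have h3 : G (star e * (star x * x) * e) ≤ ‖star x * x‖ • G (star e * e) := by
    rw [← sub_nonneg]
    have h4 := hG _ (sub_nonneg.2 h2)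
    rwa [map_sub, ← Complex.coe_smul, map_smul, Complex.coe_smul] at h4
  refine (CStarAlgebra.norm_le_norm_of_nonneg_of_le
    (hG _ (star_left_conjugate_nonneg (star_mul_self_nonneg x) e)) h3).trans ?_
  rw [norm_smul, norm_norm, CStarRing.norm_star_mul_self]

/-- The entrywise amplification of a completely positive contraction is a contraction. -/
theorem IsCPC.norm_mapₗ_le {A B : Type*} [NonUnitalCStarAlgebra A] [PartialOrder A]
    [StarOrderedRing A] [NonUnitalCStarAlgebra B] [PartialOrder B] [StarOrderedRing B]
    {f : A →ₗ[ℂ] B} (hf : IsCPC f) {n : ℕ} (x : Mat A n) :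
    ‖(CStarMatrix.mapₗ f x : Mat B n)‖ ≤ ‖x‖ := by
  obtain ⟨g, rfl⟩ := hf.completelyPositive
  set G : Mat A n →ₗ[ℂ] Mat B n := CStarMatrix.mapₗ g.toLinearMap with hG
  have hGnn : ∀ y, 0 ≤ y → 0 ≤ G y := fun y hy => g.map_cstarMatrix_nonneg y hy
  have hE : ∀ e : A, ‖e‖ ≤ 1 → ‖G (star (scalarHom A n e) * scalarHom A n e)‖ ≤ 1 := by
    intro e he
    have h1 : G (star (scalarHom A n e) * scalarHom A n e) =
        scalarHom B n (g.toLinearMap (star e * e)) := by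
      rw [← map_star, ← map_mul]
      exact Matrix.diagonal_map (map_zero g.toLinearMap)
    rw [h1]
    refine (NonUnitalStarAlgHom.norm_apply_le _ _).trans ((hf.contractive _).trans ?_)
    rw [CStarRing.norm_star_mul_self]
    exact mul_le_one₀ he (norm_nonneg _) he
  -- A Kadison–Schwarz estimate with E in the role of the unit: by complete positivity the block
  -- matrix with diagonal G(E⋆ E), G(E⋆ x⋆ x E) and corner G(E⋆ x E) is positive. Contractivity of f
  -- enters through ‖G(E⋆ E)‖ ≤ 1.
  have key : ∀ e : A, ‖e‖ ≤ 1 → ‖G (star (scalarHom A n e) * x * scalarHom A n e)‖ ≤ ‖x‖ := by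
    intro e he
    set E := scalarHom A n e
    have h1 : ‖G (star E * (star x * x) * E)‖ ≤ ‖x‖ * ‖x‖ := by
      refine (norm_map_conj_le hGnn x E).trans ?_
      exact mul_le_of_le_one_right (by positivity) (hE e he)
    have h2 : 0 ≤ blocks (G (star E * E)) (G (star E * x * E)) (G (star E * star x * E))
        (G (star E * (star x * x) * E)) := by
      have h3 := g.map_cstarMatrix_nonneg _ (star_mul_self_nonneg (blocks E (x * E) 0 0))
      rw [star_blocks, blocks_mul] at h3
      simp only [star_zero, mul_zero, add_zero, star_mul, mul_assoc] at h3 ⊢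
      rwa [show (blocks (star E * E) (star E * (x * E)) (star E * (star x * E))
        (star E * (star x * (x * E)))).map g = blocks (G (star E * E)) (G (star E * (x * E)))
        (G (star E * (star x * E))) (G (star E * (star x * (x * E)))) from
        Matrix.fromBlocks_map _ _ _ _ _] at h3
    have h3 := norm_mul_self_le_of_blocks_nonneg h2
    rw [mul_self_le_mul_self_iff (norm_nonneg _) (norm_nonneg _)]
    refine h3.trans ?_
    calc ‖G (star E * E)‖ * ‖G (star E * (star x * x) * E)‖ ≤ 1 * (‖x‖ * ‖x‖) := by
          gcongr; exact hE e he
      _ = _ := one_mul _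
  have hu := CStarAlgebra.increasingApproximateUnit A
  have hneBot := hu.neBot
  have hlim : Tendsto (fun e => G (star (scalarHom A n e) * x * scalarHom A n e))
      (CStarAlgebra.approximateUnit A) (𝓝 (G x)) := by
    refine tendsto_pi_nhds.2 fun i => tendsto_pi_nhds.2 fun j => ?_
    have h1 : ∀ e, G (star (scalarHom A n e) * x * scalarHom A n e) i j =
        g.toLinearMap (star e * x i j * e) := by
      intro e
      change g.toLinearMap _ = _
      congr 1
      rw [← map_star]
      refine (Matrix.mul_diagonal (α := A) _ _ _ _).trans ?_
      congr 1
      exact Matrix.diagonal_mul (α := A) _ _ _ _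
    simp only [h1]
    exact (hf.continuous.tendsto _).comp (tendsto_star_mul_mul _)
  exact le_of_tendsto hlim.norm (hu.eventually_norm.mono key)

/-! ### Passing from A to matrices over A. -/

section Amplification

section Matrices

variable {A : Type*} [NonUnitalCStarAlgebra A] [PartialOrder A] [StarOrderedRing A]

/-- The embedding of `A` into `M_n(A)` in the `i`-th diagonal position. -/
def diagEntry {n : ℕ} (i : Fin n) : A →⋆ₙₐ[ℂ] Mat A n where
  toFun a := CStarMatrix.ofMatrix (Matrix.single i i a)
  map_smul' c a := by
    rw [CStarMatrix.smul_of]; exact congrArg _ (Matrix.smul_single c i i a).symm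
  map_zero' := by simp
  map_add' a b := by rw [CStarMatrix.of_add_of, Matrix.single_add]
  map_mul' a b := (Matrix.single_mul_single_same (c := a) i i i b).symm
  map_star' a := (Matrix.conjTranspose_single i i a).symm

theorem norm_single_le {n : ℕ} (i j : Fin n) (a : A) :
    ‖(CStarMatrix.ofMatrix (Matrix.single i j a) : Mat A n)‖ ≤ ‖a‖ := by
  set S : Mat A n := CStarMatrix.ofMatrix (Matrix.single i j a) with hS
  have h1 : star S * S = diagEntry j (star a * a) := by
    have : star S = CStarMatrix.ofMatrix (Matrix.single j i (star a)) :=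
      Matrix.conjTranspose_single i j a
    rw [this, hS]
    exact Matrix.single_mul_single_same (c := star a) j i j a
  rw [mul_self_le_mul_self_iff (norm_nonneg _) (norm_nonneg _), ← CStarRing.norm_star_mul_self, h1,
    ← CStarRing.norm_star_mul_self]
  exact NonUnitalStarAlgHom.norm_apply_le _ _

theorem norm_le_sum_entries {n : ℕ} (M : Mat A n) : ‖M‖ ≤ ∑ i, ∑ j, ‖M i j‖ := by
  have h : M = ∑ i, ∑ j, (CStarMatrix.ofMatrix (Matrix.single i j (M i j)) : Mat A n) :=
    Matrix.matrix_eq_sum_single (α := A) M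
  nth_rw 1 [h]
  exact norm_sum_le_of_le _ fun i _ => norm_sum_le_of_le _ fun j _ => norm_single_le i j _

instance (n : ℕ) [FiniteDimensional ℂ A] : FiniteDimensional ℂ (Mat A n) :=
  inferInstanceAs (FiniteDimensional ℂ (Matrix (Fin n) (Fin n) A))

theorem matSum_apply {n : ℕ} {ι : Type*} (s : Finset ι) (M : ι → Mat A n) (i j : Fin n) :
    (∑ k ∈ s, M k) i j = ∑ k ∈ s, M k i j :=
  Matrix.sum_apply (α := A) i j s M

end Matrices

variable {L : Type v} [Preorder L]

section

variable {E G : L → Type*} [∀ l, NonUnitalCStarAlgebra (E l)] [∀ l, NonUnitalCStarAlgebra (G l)]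
  [∀ l, PartialOrder (E l)] [∀ l, StarOrderedRing (E l)]
  [∀ l, PartialOrder (G l)] [∀ l, StarOrderedRing (G l)] {f : ∀ l, E l →ₗ[ℂ] G l}

variable (f) in
/-- The entrywise amplification of a net of linear maps to `n × n` matrices. -/
def amp (n : ℕ) (l : L) : Mat (E l) n →ₗ[ℂ] Mat (G l) n := CStarMatrix.mapₗ (f l)

theorem amp_apply (n : ℕ) (l : L) (M : Mat (E l) n) (i j : Fin n) :
    amp f n l M i j = f l (M i j) := rfl

theorem amp_nonneg (hf : ∀ l, IsCPC (f l)) (n : ℕ) (l : L) (M : Mat (E l) n) (hM : 0 ≤ M) :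
    0 ≤ amp f n l M := by
  obtain ⟨g, hg⟩ := (hf l).completelyPositive
  have := g.map_cstarMatrix_nonneg M hM
  rw [amp, ← hg]
  exact this

theorem tendsto_norm_mat_zero {n : ℕ} {M : ∀ l, Mat (E l) n}
    (h : ∀ i j, Tendsto (fun l => ‖M l i j‖) atTop (𝓝 0)) :
    Tendsto (fun l => ‖M l‖) atTop (𝓝 0) := by
  refine squeeze_zero (fun _ => norm_nonneg _) (fun l => norm_le_sum_entries (M l)) ?_
  rw [show (0 : ℝ) = ∑ _i : Fin n, ∑ _j : Fin n, 0 by simp]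
  exact tendsto_finsetSum _ fun i _ => tendsto_finsetSum _ fun j _ => h i j

/-- Each entry of the defect of the amplification is a finite double sum of defects of f at entries,
and a net of matrices of fixed size is null as soon as its entries are. -/
theorem AsympOrderZero.amp {P : (∀ l, E l) → Prop} (h : AsympOrderZero f P) (n : ℕ)
    {Q : (∀ l, Mat (E l) n) → Prop} (hQ : ∀ X, Q X → ∀ i j, P fun l => X l i j) :
    AsympOrderZero (amp f n) Q := by
  intro X Y Z hX hY hZ
  refine tendsto_norm_mat_zero fun i j => ?_
  have hlim : Tendsto (fun l => ∑ s, ∑ r, ‖f l (X l i r * Y l r s) * f l (Z l s j) -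
      f l (X l i r) * f l (Y l r s * Z l s j)‖) atTop (𝓝 0) := by
    rw [show (0 : ℝ) = ∑ _i : Fin n, ∑ _j : Fin n, 0 by simp]
    exact tendsto_finsetSum _ fun s _ => tendsto_finsetSum _ fun r _ =>
      h _ _ _ (hQ X hX i r) (hQ Y hY r s) (hQ Z hZ s j)
  refine squeeze_zero (fun _ => norm_nonneg _) (fun l => ?_) hlim
  refine le_trans (le_of_eq (congrArg norm ?_)) (norm_sum_le_of_le _ fun s _ => norm_sum_le _ _)
  simp only [CStarMatrix.sub_apply, CStarMatrix.mul_apply, amp_apply, map_sum, Finset.sum_mul,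
    Finset.mul_sum, Finset.sum_sub_distrib]
  congr 1
  exact Finset.sum_comm

end

variable {A : Type u} [NonUnitalCStarAlgebra A] [PartialOrder A] [StarOrderedRing A]

/-- The identity of `IsCPC.map_mul_map` for the induced map is an equality of classes, so the
representing nets differ by a null net. -/
theorem inducedIn_asympOrderZero {F : L → Type w} [∀ l, NonUnitalCStarAlgebra (F l)]
    [∀ l, PartialOrder (F l)] [∀ l, StarOrderedRing (F l)] {ψ : ∀ l, A →ₗ[ℂ] F l}
    (hψ : ∀ l, IsCPC (ψ l)) (h : IsCPC (inducedIn hψ)) (h0 : IsOrderZero (inducedIn hψ)) :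
    AsympOrderZero ψ fun x => ∃ a, x = fun _ => a := by
  rintro _ _ _ ⟨a, rfl⟩ ⟨b, rfl⟩ ⟨c, rfl⟩
  have hb : BddMaps ψ := ⟨1, zero_le_one, fun l x => by simpa using (hψ l).contractive x⟩
  have hn : ∀ x : A, BddNet fun l => ψ l x := fun x => hb.bddNet ⟨‖x‖, fun _ => le_rfl⟩
  exact ProdModSum.mk_eq_mk.1 ((h.map_mul_map h0 a b c :
    ProdModSum.mk F ((hn (a * b)).toLp * (hn c).toLp) =
      ProdModSum.mk F ((hn a).toLp * (hn (b * c)).toLp)))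

theorem inducedOut_asympOrderZero {F : L → Type w} [∀ l, NonUnitalCStarAlgebra (F l)]
    [∀ l, PartialOrder (F l)] [∀ l, StarOrderedRing (F l)] {φ : ∀ l, F l →ₗ[ℂ] A}
    (hφ : ∀ l, IsCPC (φ l)) (h : IsCPC (inducedOut hφ)) (h0 : IsOrderZero (inducedOut hφ)) :
    AsympOrderZero φ BddNet := by
  intro x y z hx hy hz
  have hb : BddMaps φ := ⟨1, zero_le_one, fun l x => by simpa using (hφ l).contractive x⟩
  exact ProdModSum.mk_eq_mk.1 ((h.map_mul_map h0 hx.cls hy.cls hz.cls :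
    ProdModSum.mk _ ((hb.bddNet (hx.mul hy)).toLp * (hb.bddNet hz).toLp) =
      ProdModSum.mk _ ((hb.bddNet hx).toLp * (hb.bddNet (hy.mul hz)).toLp)))

theorem BddNet.entry {E : L → Type*} [∀ l, NonUnitalCStarAlgebra (E l)]
    [∀ l, PartialOrder (E l)] [∀ l, StarOrderedRing (E l)] {n : ℕ} {X : ∀ l, Mat (E l) n}
    (hX : BddNet X) (i j : Fin n) : BddNet fun l => X l i j := by
  obtain ⟨C, hC⟩ := hX
  exact ⟨C, fun l => CStarMatrix.norm_entry_le_norm.trans (hC l)⟩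

theorem OrderZeroNet.amp [IsDirectedOrder L] [Nonempty L] {F : L → Type w}
    [∀ l, NonUnitalCStarAlgebra (F l)] [∀ l, PartialOrder (F l)] [∀ l, StarOrderedRing (F l)]
    {ψ : ∀ l, A →ₗ[ℂ] F l} {φ : ∀ l, F l →ₗ[ℂ] A} (hψ : ∀ l, IsCPC (ψ l)) (hφ : ∀ l, IsCPC (φ l))
    (h1 : IsCPC (inducedIn hψ) ∧ IsOrderZero (inducedIn hψ))
    (h2 : IsCPC (inducedOut hφ) ∧ IsOrderZero (inducedOut hφ)) (n : ℕ) :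
    OrderZeroNet (A := Mat A n) (F := fun l => Mat (F l) n) (amp ψ n) (amp φ n) where
  norm_in_le l := (hψ l).norm_mapₗ_le
  norm_out_le l := (hφ l).norm_mapₗ_le
  nonneg_in := amp_nonneg hψ n
  nonneg_out := amp_nonneg hφ n
  orderZero_in := (inducedIn_asympOrderZero hψ h1.1 h1.2).amp n (by
    rintro _ ⟨M, rfl⟩ i j
    exact ⟨M i j, rfl⟩)
  orderZero_out := (inducedOut_asympOrderZero hφ h2.1 h2.2).amp n fun X hX i j => hX.entry i j

theorem eventually_norm_sub_sum_lt [IsDirectedOrder L] [Nonempty L] {F : ℕ → L → Type w}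
    [∀ i l, NonUnitalCStarAlgebra (F i l)] [∀ i l, PartialOrder (F i l)]
    [∀ i l, StarOrderedRing (F i l)] {ψ : ∀ i l, A →ₗ[ℂ] F i l} {φ : ∀ i l, F i l →ₗ[ℂ] A}
    (hψ : ∀ i l, IsCPC (ψ i l)) (hφ : ∀ i l, IsCPC (φ i l)) {a : A}
    (h : Tendsto (fun n : ℕ => ∑ i ∈ Finset.range n, inducedOut (hφ i) (inducedIn (hψ i) a))
      atTop (𝓝 (ProdModSum.diag L A a))) {e : ℝ} (he : 0 < e) :
    ∃ n, ∀ m ≥ n, ∀ᶠ l in atTop, ‖a - ∑ i ∈ Finset.range m, φ i l (ψ i l a)‖ < e := by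
  obtain ⟨n, hn⟩ := Metric.tendsto_atTop.1 h e he
  refine ⟨n, fun m hm => ?_⟩
  have h1 := hn m hm
  rw [dist_comm, dist_eq_norm] at h1
  have hb : ∀ i, BddMaps (ψ i) := fun i =>
    ⟨1, zero_le_one, fun l x => by simpa using (hψ i l).contractive x⟩
  have hb' : ∀ i, BddMaps (φ i) := fun i =>
    ⟨1, zero_le_one, fun l x => by simpa using (hφ i l).contractive x⟩
  have hnet : ∀ i, BddNet fun l => φ i l (ψ i l a) := fun i =>
    (hb' i).bddNet ((hb i).bddNet ⟨‖a‖, fun _ => le_rfl⟩)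
  have h2 : ∑ i ∈ Finset.range m, inducedOut (hφ i) (inducedIn (hψ i) a) =
      (BddNet.sum (Finset.range m) hnet).cls := by
    have h3 : ∀ i, inducedOut (hφ i) (inducedIn (hψ i) a) = ProdModSum.mk _ (hnet i).toLp :=
      fun i => rfl
    simp only [h3]
    rw [← map_sum]
    refine congrArg (ProdModSum.mk _) ?_
    ext l
    rw [lp.coeFn_sum, Finset.sum_apply]
    rfl
  rw [h2] at h1
  exact ProdModSum.eventually_norm_lt
    ((bddNet_const (L := L) a).toLp - (BddNet.sum (Finset.range m) hnet).toLp) h1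

/-- The n² entries are approximated to within e / (n² + 1) simultaneously; the added 1 covers n = 0
and keeps the final inequality strict. -/
theorem eventually_norm_sub_sum_amp_lt [IsDirectedOrder L] [Nonempty L] {F : ℕ → L → Type w}
    [∀ i l, NonUnitalCStarAlgebra (F i l)] [∀ i l, PartialOrder (F i l)]
    [∀ i l, StarOrderedRing (F i l)] {ψ : ∀ i l, A →ₗ[ℂ] F i l} {φ : ∀ i l, F i l →ₗ[ℂ] A}
    (h : ∀ a, ∀ e > 0, ∃ n, ∀ m ≥ n, ∀ᶠ l in atTop,
      ‖a - ∑ i ∈ Finset.range m, φ i l (ψ i l a)‖ < e) {n : ℕ} (M : Mat A n) {e : ℝ} (he : 0 < e) :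
    ∃ N, ∀ m ≥ N, ∀ᶠ l in atTop,
      ‖M - ∑ i ∈ Finset.range m, amp (φ i) n l (amp (ψ i) n l M)‖ < e := by
  set r := e / (n * n + 1) with hr
  have hr0 : 0 < r := by positivity
  choose N hN using fun i j => h (M i j) r hr0
  refine ⟨∑ i, ∑ j, N i j, fun m hm => ?_⟩
  have hNle : ∀ i j, N i j ≤ m := fun i j =>
    ((Finset.single_le_sum (f := fun j => N i j) (fun _ _ => Nat.zero_le _)
      (Finset.mem_univ j)).trans (Finset.single_le_sum (f := fun i => ∑ j, N i j)
      (fun _ _ => Nat.zero_le _) (Finset.mem_univ i))).trans hm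
  have hall : ∀ᶠ l in atTop, ∀ i j, ‖M i j - ∑ k ∈ Finset.range m, φ k l (ψ k l (M i j))‖ < r :=
    eventually_all.2 fun i => eventually_all.2 fun j => hN i j m (hNle i j)
  filter_upwards [hall] with l hl
  refine (norm_le_sum_entries _).trans_lt ?_
  have h1 : ∀ i j, ‖(M - ∑ k ∈ Finset.range m, amp (φ k) n l (amp (ψ k) n l M)) i j‖ ≤ r := by
    intro i j
    rw [CStarMatrix.sub_apply, matSum_apply]
    exact (hl i j).le
  refine (Finset.sum_le_sum fun i _ => Finset.sum_le_sum fun j _ => h1 i j).trans_lt ?_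
  simp only [Finset.sum_const, Finset.card_univ, Fintype.card_fin, nsmul_eq_mul]
  rw [hr, ← mul_assoc, ← mul_div_assoc, div_lt_iff₀ (by positivity)]
  nlinarith

end Amplification

/-! ### Finitely supported matrices as a dense part of A ⊗ 𝒦. -/

section StabRep

variable {A : Type u} [NonUnitalCStarAlgebra A] [PartialOrder A] [StarOrderedRing A]

/-- `x` is the element of `A ⊗ 𝒦` given by the finitely supported matrix `a`. -/
def Rep (x : Stab A) (a : ℕ → ℕ → A) : Prop :=
  ∃ y : lp (Mat A) ∞, ProdModSum.mk _ y = x.1 ∧ ∃ n : ℕ,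
    (∀ i j, n ≤ i ∨ n ≤ j → a i j = 0) ∧ ∀ m, n ≤ m → ∀ i j : Fin m, y m i j = a i j

theorem Rep.sub {x z : Stab A} {a b : ℕ → ℕ → A} (hx : Rep x a) (hz : Rep z b) :
    Rep (x - z) (fun i j => a i j - b i j) := by
  obtain ⟨y, hy, n, ha, hya⟩ := hx
  obtain ⟨w, hw, k, hb, hwb⟩ := hz
  refine ⟨y - w, ?_, max n k, fun i j h => ?_, fun m hm i j => ?_⟩
  · rw [map_sub, hy, hw]; rfl
  · simp only [ha i j (by omega), hb i j (by omega), sub_zero]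
  · exact congrArg₂ (· - ·) (hya m (by omega) i j) (hwb m (by omega) i j)

theorem Rep.add {x z : Stab A} {a b : ℕ → ℕ → A} (hx : Rep x a) (hz : Rep z b) :
    Rep (x + z) (fun i j => a i j + b i j) := by
  obtain ⟨y, hy, n, ha, hya⟩ := hx
  obtain ⟨w, hw, k, hb, hwb⟩ := hz
  refine ⟨y + w, ?_, max n k, fun i j h => ?_, fun m hm i j => ?_⟩
  · rw [map_add, hy, hw]; rfl
  · simp only [ha i j (by omega), hb i j (by omega), add_zero]
  · exact congrArg₂ (· + ·) (hya m (by omega) i j) (hwb m (by omega) i j)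

theorem Rep.smul {x : Stab A} {a : ℕ → ℕ → A} (c : ℂ) (hx : Rep x a) :
    Rep (c • x) (fun i j => c • a i j) := by
  obtain ⟨y, hy, n, ha, hya⟩ := hx
  refine ⟨c • y, ?_, n, fun i j h => ?_, fun m hm i j => ?_⟩
  · rw [map_smul, hy]; rfl
  · simp only [ha i j h, smul_zero]
  · exact congrArg (c • ·) (hya m hm i j)

theorem Rep.conj {x : Stab A} {a : ℕ → ℕ → A} (hx : Rep x a) :
    Rep (star x) (fun i j => star (a j i)) := by
  obtain ⟨y, hy, n, ha, hya⟩ := hx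
  refine ⟨star y, ?_, n, fun i j h => ?_, fun m hm i j => ?_⟩
  · rw [ProdModSum.mk_star, hy]; rfl
  · simp only [ha j i h.symm, star_zero]
  · exact congrArg star (hya m hm j i)

/-- With finite supports the truncated sums stabilize, so it is enough that c agrees with all late
truncations; no common support bound has to be named. -/
theorem Rep.mul {x z : Stab A} {a b c : ℕ → ℕ → A} (hx : Rep x a) (hz : Rep z b)
    (hc : ∀ᶠ N in atTop, ∀ i j, c i j = ∑ p ∈ Finset.range N, a i p * b p j) : Rep (x * z) c := by
  obtain ⟨y, hy, n, ha, hya⟩ := hx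
  obtain ⟨w, hw, k, hb, hwb⟩ := hz
  obtain ⟨N, hN⟩ := eventually_atTop.1 hc
  refine ⟨y * w, ?_, max N (max n k), fun i j h => ?_, fun m hm i j => ?_⟩
  · rw [ProdModSum.mk_mul, hy, hw]; rfl
  · rw [hN N le_rfl]
    refine Finset.sum_eq_zero fun p _ => ?_
    rcases h with h | h
    · rw [ha i p (by omega), zero_mul]
    · rw [hb p j (by omega), mul_zero]
  · rw [lp.infty_coeFn_mul, Pi.mul_apply, CStarMatrix.mul_apply, hN m (by omega)]
    simp only [hya m (by omega), hwb m (by omega)]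
    rw [Fin.sum_univ_eq_sum_range (fun p => a i p * b p j)]

theorem Rep.unique {x z : Stab A} {a : ℕ → ℕ → A} (hx : Rep x a) (hz : Rep z a) : x = z := by
  obtain ⟨y, hy, n, -, hya⟩ := hx
  obtain ⟨w, hw, k, -, hwb⟩ := hz
  refine Subtype.ext ?_
  rw [← hy, ← hw, ProdModSum.mk_eq_mk, mem_nullNets]
  refine tendsto_const_nhds.congr' ?_
  filter_upwards [eventually_ge_atTop n, eventually_ge_atTop k] with m h1 h2
  have : y m = w m := by
    ext i j
    rw [hya m h1, hwb m h2]
  simp [this]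

theorem Rep.eq_zero {a : ℕ → ℕ → A} (h : Rep (0 : Stab A) a) (i j : ℕ) : a i j = 0 := by
  obtain ⟨y, hy, n, -, hya⟩ := h
  have h1 : Tendsto (fun m => ‖y m‖) atTop (𝓝 0) := by
    have : y - 0 ∈ nullNets (Mat A) := ProdModSum.mk_eq_mk.1 (hy.trans (map_zero _).symm)
    simpa [mem_nullNets] using this
  rw [← norm_le_zero_iff]
  refine ge_of_tendsto h1 ?_
  filter_upwards [eventually_ge_atTop n, eventually_gt_atTop i, eventually_gt_atTop j]
    with m h1 h2 h3
  rw [← hya m h1 ⟨i, h2⟩ ⟨j, h3⟩]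
  exact CStarMatrix.norm_entry_le_norm

theorem exists_rep {a : ℕ → ℕ → A} {n : ℕ} (ha : ∀ i j, n ≤ i ∨ n ≤ j → a i j = 0) :
    ∃ x, Rep x a := by
  have hsum : ∀ (m : ℕ) (f : ℕ → ℝ), (∀ i, 0 ≤ f i) → (∀ i, n ≤ i → f i = 0) →
      ∑ i : Fin m, f i ≤ ∑ i ∈ Finset.range n, f i := by
    intro m f hf hf0
    rw [Fin.sum_univ_eq_sum_range]
    have h2 : ∑ i ∈ Finset.range m, f i ≤ ∑ i ∈ Finset.range (max m n), f i :=
      Finset.sum_le_sum_of_subset_of_nonneg (Finset.range_mono (le_max_left _ _))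
        fun i _ _ => hf i
    refine h2.trans (le_of_eq ?_)
    refine (Finset.sum_subset (Finset.range_mono (le_max_right _ _)) fun i _ hi => ?_).symm
    exact hf0 i (by simpa using hi)
  let y : lp (Mat A) ∞ := ⟨fun m => CStarMatrix.ofMatrix fun i j => a i j, by
    refine memℓp_infty ⟨∑ i ∈ Finset.range n, ∑ j ∈ Finset.range n, ‖a i j‖, ?_⟩
    rintro _ ⟨m, rfl⟩
    refine (norm_le_sum_entries _).trans ?_
    refine (Finset.sum_le_sum (s := (Finset.univ : Finset (Fin m))) fun i _ =>
      hsum m (fun j => ‖a i j‖) (fun _ => norm_nonneg _) fun j hj => ?_).trans (hsum m (fun i => ∑ j ∈ Finset.range n, ‖a i j‖)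
      (fun _ => by positivity) fun i hi => ?_)
    · rw [ha i j (Or.inr hj), norm_zero]
    · exact Finset.sum_eq_zero fun j _ => by rw [ha i j (Or.inl hi), norm_zero]⟩
  have hy : ProdModSum.mk _ y ∈ finMatrices A := ⟨y, rfl, n, a, ha, fun _ _ _ _ => rfl⟩
  exact ⟨⟨_, (finMatrices A).le_topologicalClosure hy⟩, y, rfl, n, ha, fun _ _ _ _ => rfl⟩

theorem exists_rep_near (x : Stab A) {e : ℝ} (he : 0 < e) :
    ∃ z a, Rep (A := A) z a ∧ ‖x - z‖ < e := by
  have hx : x.1 ∈ closure (finMatrices A : Set (ProdModSum (Mat A))) := x.2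
  obtain ⟨z, hz, hxz⟩ := Metric.mem_closure_iff.1 hx e he
  have hz' : z ∈ finMatrices A := hz
  obtain ⟨y, hy, n, a, ha, hya⟩ := id hz'
  refine ⟨⟨z, (finMatrices A).le_topologicalClosure hz'⟩, a, ⟨y, hy, n, ha, hya⟩, ?_⟩
  rw [dist_eq_norm] at hxz
  exact hxz

end StabRep

/-! ### Isometries with orthogonal ranges on A ⊗ 𝒦. -/

section Shift

variable {A : Type u} [NonUnitalCStarAlgebra A] [PartialOrder A] [StarOrderedRing A]

/-- The matrix `a` with its `i`-th row moved to the position `Nat.pair p i`. -/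
def shiftRows (p : ℕ) (a : ℕ → ℕ → A) (i j : ℕ) : A :=
  if i.unpair.1 = p then a i.unpair.2 j else 0

theorem exists_rep_shiftRows (p : ℕ) {x : Stab A} {a : ℕ → ℕ → A} (h : Rep x a) :
    ∃ z, Rep z (shiftRows p a) := by
  obtain ⟨-, -, n, ha, -⟩ := h
  refine exists_rep (n := max n (Nat.pair p n)) fun i j hij => ?_
  unfold shiftRows
  split_ifs with hi
  · refine ha _ _ ?_
    rcases hij with hij | hij
    · left
      by_contra! hlt
      have h1 : Nat.pair i.unpair.1 i.unpair.2 < Nat.pair p n := by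
        rw [hi]; exact Nat.pair_lt_pair_right p hlt
      rw [Nat.pair_unpair] at h1
      omega
    · right; omega
  · rfl

/-- Entries of x'⋆ z' are sums over rows. The pairing function moves the rows injectively, and to
disjoint sets of positions for different p and q, so the sums are either unchanged or empty. -/
theorem Rep.star_mul_shiftRows {p q : ℕ} {x z x' z' : Stab A} {a b : ℕ → ℕ → A} (hx : Rep x a)
    (hz : Rep z b) (hx' : Rep x' (shiftRows p a)) (hz' : Rep z' (shiftRows q b)) :
    star x' * z' = if p = q then star x * z else 0 := by
  split_ifs with hpq
  · subst hpq
    obtain ⟨n, ha⟩ : ∃ n, ∀ i j, n ≤ i ∨ n ≤ j → a i j = 0 := by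
      obtain ⟨-, -, n, ha, -⟩ := hx; exact ⟨n, ha⟩
    have h1 : Rep (star x * z) fun i j => ∑ s ∈ Finset.range n, star (a s i) * b s j := by
      refine hx.conj.mul hz ?_
      filter_upwards [eventually_ge_atTop n] with N hN i j
      refine Finset.sum_subset (Finset.range_mono hN) fun s _ hs => ?_
      rw [ha s i (by simpa using Or.inl hs), star_zero, zero_mul]
    refine Rep.unique ?_ h1
    refine hx'.conj.mul hz' ?_
    filter_upwards [eventually_ge_atTop (Nat.pair p n)] with N hN i j
    have h2 : ∀ s, shiftRows p a (Nat.pair p s) i = a s i := by simp [shiftRows]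
    have h3 : ∀ s, shiftRows p b (Nat.pair p s) j = b s j := by simp [shiftRows]
    have hinj : Function.Injective (Nat.pair p) := fun s t hst => by
      simpa using congrArg (fun r => r.unpair.2) hst
    simp only [← h2, ← h3]
    rw [← Finset.sum_image (f := fun r => star (shiftRows p a r i) * shiftRows p b r j)
      (fun s _ t _ hst => hinj hst)]
    refine Finset.sum_subset ?_ fun r _ hr => ?_
    · intro r hr
      obtain ⟨s, hs, rfl⟩ := Finset.mem_image.1 hr
      exact Finset.mem_range.2
        ((Nat.pair_lt_pair_right p (Finset.mem_range.1 hs)).trans_le hN)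
    · have : shiftRows p a r i = 0 := by
        unfold shiftRows
        split_ifs with hrp
        · refine ha _ _ (Or.inl ?_)
          by_contra! hlt
          refine hr (Finset.mem_image.2 ⟨r.unpair.2, Finset.mem_range.2 hlt, ?_⟩)
          rw [← hrp, Nat.pair_unpair]
        · rfl
      rw [this, star_zero, zero_mul]
  · have h0 : Rep (star x' * z') fun _ _ => 0 := by
      refine hx'.conj.mul hz' (.of_forall fun N i j => (Finset.sum_eq_zero fun r _ => ?_).symm)
      by_cases hrp : r.unpair.1 = p
      · have : r.unpair.1 ≠ q := fun h => hpq (hrp.symm.trans h)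
        simp [shiftRows, this]
      · simp [shiftRows, hrp]
    have h1 : Rep (0 : Stab A) fun _ _ => 0 := by
      obtain ⟨w, hw⟩ := exists_rep (A := A) (a := fun _ _ => 0) (n := 0) fun _ _ _ => rfl
      have := hw.sub hw
      simpa using this
    exact h0.unique h1

theorem shiftRows_sub (p : ℕ) (a b : ℕ → ℕ → A) :
    shiftRows p (fun i j => a i j - b i j) = fun i j => shiftRows p a i j - shiftRows p b i j := by
  ext i j
  unfold shiftRows
  split_ifs <;> simp

theorem Rep.norm_shiftRows {p : ℕ} {x x' : Stab A} {a : ℕ → ℕ → A} (hx : Rep x a)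
    (hx' : Rep x' (shiftRows p a)) : ‖x'‖ = ‖x‖ := by
  have h := hx.star_mul_shiftRows hx hx' hx'
  rw [if_pos rfl] at h
  have h1 : ‖x'‖ * ‖x'‖ = ‖x‖ * ‖x‖ := by
    rw [← CStarRing.norm_star_mul_self, ← CStarRing.norm_star_mul_self, h]
  exact (mul_self_inj (norm_nonneg _) (norm_nonneg _)).1 h1

variable (A) in
/-- `A ⊗ 𝒦` is closed under a sequence of isometries of the multiplier algebra with pairwise
orthogonal ranges. -/
theorem exists_isometries : ∃ V : ℕ → Stab A → Stab A, ∀ p q c d,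
    star (V p c) * V q d = if p = q then star c * d else 0 := by
  -- V p c is obtained as the limit of the row shifts of finite matrices tending to c, which are
  -- Cauchy because shifting preserves norms of differences. Only the relation between products is
  -- recorded; linearity of V p plays no role.
  have hseq : ∀ c : Stab A, ∃ (s : ℕ → Stab A) (a : ℕ → ℕ → ℕ → A),
      (∀ n, Rep (s n) (a n)) ∧ Tendsto s atTop (𝓝 c) := by
    intro c
    choose s a hs hsc using fun n : ℕ => exists_rep_near c (e := 1 / ((n : ℝ) + 1)) (by positivity)
    refine ⟨s, a, hs, ?_⟩
    rw [tendsto_iff_norm_sub_tendsto_zero]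
    refine squeeze_zero (fun _ => norm_nonneg _) (fun n => ?_) tendsto_one_div_add_atTop_nhds_zero_nat
    rw [norm_sub_rev]
    exact (hsc n).le
  choose s a hs hsc using hseq
  choose t ht using fun (p : ℕ) (c : Stab A) (n : ℕ) => exists_rep_shiftRows p (hs c n)
  have hlim : ∀ p c, ∃ v, Tendsto (t p c) atTop (𝓝 v) := by
    intro p c
    refine cauchySeq_tendsto_of_complete ?_
    rw [Metric.cauchySeq_iff]
    intro e he
    obtain ⟨N, hN⟩ := Metric.cauchySeq_iff.1 (hsc c).cauchySeq e he
    refine ⟨N, fun m hm n hn => ?_⟩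
    have h1 := (ht p c m).sub (ht p c n)
    rw [← shiftRows_sub] at h1
    rw [dist_eq_norm, ((hs c m).sub (hs c n)).norm_shiftRows h1, ← dist_eq_norm]
    exact hN m hm n hn
  choose V hV using hlim
  refine ⟨V, fun p q c d => ?_⟩
  have h1 : Tendsto (fun n => star (t p c n) * t q d n) atTop (𝓝 (star (V p c) * V q d)) :=
    ((continuous_star.tendsto _).comp (hV p c)).mul (hV q d)
  refine tendsto_nhds_unique h1 ?_
  have h2 : ∀ n, star (t p c n) * t q d n = if p = q then star (s c n) * s d n else 0 :=
    fun n => (hs c n).star_mul_shiftRows (hs d n) (ht p c n) (ht q d n)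
  simp only [h2]
  split_ifs
  · exact ((continuous_star.tendsto _).comp (hsc c)).mul (hsc d)
  · exact tendsto_const_nhds

end Shift

/-! ### The corners M_n(A) of A ⊗ 𝒦 and compression to them. -/

section Corners

variable {A : Type u} [NonUnitalCStarAlgebra A] [PartialOrder A] [StarOrderedRing A]

/-- The finitely supported matrix over `ℕ` extending `M` by zero. -/
def extend {n : ℕ} (M : Mat A n) (i j : ℕ) : A :=
  if h : i < n ∧ j < n then M ⟨i, h.1⟩ ⟨j, h.2⟩ else 0

theorem extend_of_le {n : ℕ} (M : Mat A n) {i j : ℕ} (h : n ≤ i ∨ n ≤ j) : extend M i j = 0 :=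
  dif_neg (by omega)

theorem extend_coe {n : ℕ} (M : Mat A n) (i j : Fin n) : extend M i j = M i j :=
  dif_pos ⟨i.2, j.2⟩

theorem eq_extend {n : ℕ} {M : Mat A n} {a : ℕ → ℕ → A} (h0 : ∀ i j, n ≤ i ∨ n ≤ j → a i j = 0)
    (h : ∀ i j : Fin n, a i j = M i j) : a = extend M := by
  ext i j
  by_cases hij : i < n ∧ j < n
  · rw [extend, dif_pos hij]
    exact h ⟨i, hij.1⟩ ⟨j, hij.2⟩
  · rw [h0 i j (by omega), extend_of_le M (by omega)]

theorem exists_rep_extend {n : ℕ} (M : Mat A n) : ∃ x, Rep x (extend M) :=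
  exists_rep (n := n) fun _ _ => extend_of_le M

/-- The embedding of `M_n(A)` into `A ⊗ 𝒦`, as a function. -/
def embFun {n : ℕ} (M : Mat A n) : Stab A := (exists_rep_extend M).choose

theorem rep_embFun {n : ℕ} (M : Mat A n) : Rep (embFun M) (extend M) :=
  (exists_rep_extend M).choose_spec

/-- The upper left `n × n` corner of a matrix over `ℕ`. -/
def corner (n : ℕ) (a : ℕ → ℕ → A) : Mat A n := CStarMatrix.ofMatrix fun i j => a i j

/-- M and N vanish outside the first n indices, so only the n × n corner of x takes part. By density
this makes M_n(A) hereditary. -/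
theorem Rep.emb_mul_mul {n : ℕ} {x : Stab A} {a : ℕ → ℕ → A} (hx : Rep x a) (M N : Mat A n) :
    embFun M * x * embFun N = embFun (M * corner n a * N) := by
  obtain ⟨k, ha⟩ : ∃ n, ∀ i j, n ≤ i ∨ n ≤ j → a i j = 0 := by
    obtain ⟨-, -, n, ha, -⟩ := hx; exact ⟨n, ha⟩
  have h1 : Rep (embFun M * x) fun i j => ∑ p ∈ Finset.range n, extend M i p * a p j := by
    refine (rep_embFun M).mul hx ?_
    filter_upwards [eventually_ge_atTop n] with N hN i j
    refine Finset.sum_subset (Finset.range_mono hN) fun p _ hp => ?_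
    rw [extend_of_le M (by simpa using Or.inr hp), zero_mul]
  refine Rep.unique (h1.mul (rep_embFun N) ?_) (rep_embFun _)
  filter_upwards [eventually_ge_atTop n] with K hK i j
  have h2 : ∑ q ∈ Finset.range K, (∑ p ∈ Finset.range n, extend M i p * a p q) * extend N q j =
      ∑ q ∈ Finset.range n, (∑ p ∈ Finset.range n, extend M i p * a p q) * extend N q j := by
    refine (Finset.sum_subset (Finset.range_mono hK) fun q _ hq => ?_).symm
    rw [extend_of_le N (by simpa using Or.inl hq), mul_zero]
  rw [h2]
  symm
  refine congrFun (congrFun (eq_extend (a := fun i j => ∑ q ∈ Finset.range n,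
    (∑ p ∈ Finset.range n, extend M i p * a p q) * extend N q j) ?_ ?_) i) j
  · rintro i j (h | h)
    · refine Finset.sum_eq_zero fun q _ => ?_
      rw [Finset.sum_eq_zero fun p _ => by rw [extend_of_le M (Or.inl h), zero_mul], zero_mul]
    · refine Finset.sum_eq_zero fun q _ => ?_
      rw [extend_of_le N (Or.inr h), mul_zero]
  · intro i j
    rw [CStarMatrix.mul_apply, ← Fin.sum_univ_eq_sum_range
      (fun q => (∑ p ∈ Finset.range n, extend M i p * a p q) * extend N q j)]
    refine Finset.sum_congr rfl fun q _ => ?_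
    rw [extend_coe, CStarMatrix.mul_apply, ← Fin.sum_univ_eq_sum_range
      (fun p => extend M i p * a p q)]
    simp only [extend_coe]
    rfl

/-- The embedding of `M_n(A)` into `A ⊗ 𝒦`. -/
def emb (n : ℕ) : Mat A n →⋆ₙₐ[ℂ] Stab A where
  toFun := embFun
  map_smul' c M := (rep_embFun _).unique <| by
    have e : (fun i j => c • extend M i j) = extend (c • M) :=
      eq_extend (fun i j h => by rw [extend_of_le M h, smul_zero])
        (fun i j => by rw [extend_coe]; rfl)
    exact e ▸ (rep_embFun M).smul c
  map_zero' := by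
    have h := (rep_embFun (0 : Mat A n)).sub (rep_embFun (0 : Mat A n))
    have e : (fun i j => extend (0 : Mat A n) i j - extend (0 : Mat A n) i j) =
        extend (0 : Mat A n) :=
      eq_extend (fun i j h => by rw [sub_self]) (fun i j => by rw [sub_self]; rfl)
    rw [e, sub_self] at h
    exact (rep_embFun _).unique h
  map_add' M N := (rep_embFun _).unique <| by
    have e : (fun i j => extend M i j + extend N i j) = extend (M + N) :=
      eq_extend (fun i j h => by rw [extend_of_le M h, extend_of_le N h, add_zero])
        (fun i j => by rw [extend_coe, extend_coe]; rfl)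
    exact e ▸ (rep_embFun M).add (rep_embFun N)
  map_mul' M N := (rep_embFun _).unique <| by
    refine (rep_embFun M).mul (rep_embFun N) ?_
    filter_upwards [eventually_ge_atTop n] with K hK i j
    have h2 : ∑ q ∈ Finset.range K, extend M i q * extend N q j =
        ∑ q ∈ Finset.range n, extend M i q * extend N q j := by
      refine (Finset.sum_subset (Finset.range_mono hK) fun q _ hq => ?_).symm
      rw [extend_of_le N (by simpa using Or.inl hq), mul_zero]
    rw [h2]
    symm
    refine congrFun (congrFun (eq_extend (a := fun i j => ∑ q ∈ Finset.range n,
      extend M i q * extend N q j) ?_ ?_) i) j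
    · rintro i j (h | h)
      · exact Finset.sum_eq_zero fun p _ => by rw [extend_of_le M (Or.inl h), zero_mul]
      · exact Finset.sum_eq_zero fun q _ => by rw [extend_of_le N (Or.inr h), mul_zero]
    · intro i j
      rw [CStarMatrix.mul_apply, ← Fin.sum_univ_eq_sum_range
        (fun q => extend M i q * extend N q j)]
      simp only [extend_coe]
  map_star' M := (rep_embFun _).unique <| by
    have e : (fun i j => star (extend M j i)) = extend (star M) :=
      eq_extend (fun i j h => by rw [extend_of_le M h.symm, star_zero])
        (fun i j => by rw [extend_coe]; rfl)
    exact e ▸ (rep_embFun M).conj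

theorem rep_emb {n : ℕ} (M : Mat A n) : Rep (emb n M) (extend M) := rep_embFun M

theorem emb_injective (n : ℕ) : Function.Injective (emb (A := A) n) := by
  rw [injective_iff_map_eq_zero]
  intro M hM
  have h := rep_emb M
  rw [hM] at h
  ext i j
  exact (extend_coe M i j).symm.trans (h.eq_zero i j)

theorem norm_emb {n : ℕ} (M : Mat A n) : ‖emb n M‖ = ‖M‖ :=
  NonUnitalStarAlgHom.norm_map (emb n) (emb_injective n) M

theorem isometry_emb (n : ℕ) : Isometry (emb (A := A) n) :=
  AddMonoidHomClass.isometry_of_norm (emb n) norm_emb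

/-- The range of `M_n(A)` in `A ⊗ 𝒦` is hereditary. -/
theorem exists_emb_eq_mul_mul {n : ℕ} (M N : Mat A n) (x : Stab A) :
    ∃ K, emb n K = emb n M * x * emb n N := by
  -- The embedding is isometric, so its range is complete; it is then enough to treat the dense set
  -- of finitely supported x.
  have hcl : IsClosed (Set.range (emb (A := A) n)) :=
    (isometry_emb n).isUniformInducing.isComplete_range.isClosed
  have hcont : Continuous fun x : Stab A => emb n M * x * emb n N := by fun_prop
  have hx : x ∈ closure {z | ∃ a, Rep z a} := by
    rw [Metric.mem_closure_iff]
    intro e he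
    obtain ⟨z, a, hz, hxz⟩ := exists_rep_near x he
    exact ⟨z, ⟨a, hz⟩, by rwa [dist_eq_norm]⟩
  have := map_mem_closure (t := Set.range (emb (A := A) n)) hcont hx (by
    rintro z ⟨a, hz⟩
    exact ⟨_, (hz.emb_mul_mul M N).symm⟩)
  rwa [hcl.closure_eq] at this

/-- The negative part is a continuous function of the element, so f commutes with taking it, and f
is injective. -/
theorem nonneg_of_map_nonneg {C D : Type*} [NonUnitalCStarAlgebra C] [PartialOrder C]
    [StarOrderedRing C] [NonUnitalCStarAlgebra D] [PartialOrder D] [StarOrderedRing D]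
    (f : C →⋆ₙₐ[ℂ] D) (hf : Isometry f) {x : C} (h : 0 ≤ f x) : 0 ≤ x := by
  have hsa : IsSelfAdjoint x := by
    have := (IsSelfAdjoint.of_nonneg h).star_eq
    rw [← map_star] at this
    exact hf.injective this
  rw [CStarAlgebra.nonneg_iff_isSelfAdjoint_and_negPart_eq_zero]
  refine ⟨hsa, hf.injective ?_⟩
  rw [map_zero, ← ((CStarAlgebra.nonneg_iff_isSelfAdjoint_and_negPart_eq_zero).1 h).2]
  simp only [CFC.negPart_def]
  exact NonUnitalStarAlgHomClass.map_cfcₙ (f.restrictScalars ℝ) _ x (hφ := hf.continuous)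

/-- The embedding `M ↦ diag (M, 0)` of `M_n(A)` into `M_k(A)`, for `n ≤ k`. -/
def pad (k : ℕ) {n : ℕ} (M : Mat A n) : Mat A k := corner k (extend M)

theorem extend_pad {n k : ℕ} (h : n ≤ k) (M : Mat A n) : extend (pad k M) = extend M :=
  (eq_extend (M := pad k M) (fun _ _ hij => extend_of_le M (by omega)) fun _ _ => rfl).symm

theorem emb_pad {n k : ℕ} (h : n ≤ k) (M : Mat A n) : emb k (pad k M) = emb n M :=
  (rep_emb _).unique (extend_pad h M ▸ rep_emb M)

theorem exists_emb_eq {x : Stab A} {a : ℕ → ℕ → A} (h : Rep x a) : ∃ n M, x = emb (A := A) n M := by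
  obtain ⟨n, ha⟩ : ∃ n, ∀ i j, n ≤ i ∨ n ≤ j → a i j = 0 := by
    obtain ⟨-, -, n, ha, -⟩ := h; exact ⟨n, ha⟩
  refine ⟨n, corner n a, h.unique ?_⟩
  have e : a = extend (corner n a) := eq_extend ha fun _ _ => rfl
  have h1 := rep_emb (corner n a)
  rwa [← e] at h1

/-- The approximate unit of `A ⊗ 𝒦` given by the scalar matrices over an approximate unit of
`A`. -/
def unitNet (p : ℕ × A) : Stab A := emb p.1 (scalarHom A p.1 p.2)

variable (A) in
/-- The filter along which `unitNet` is an approximate unit. -/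
def unitFilter : Filter (ℕ × A) := atTop ×ˢ CStarAlgebra.approximateUnit A

instance : (unitFilter A).NeBot := by
  have := (CStarAlgebra.increasingApproximateUnit A).neBot
  unfold unitFilter
  infer_instance

theorem star_scalarHom_mul_mul_apply {n : ℕ} (M : Mat A n) (e : A) (i j : Fin n) :
    (star (scalarHom A n e) * M * scalarHom A n e) i j = star e * M i j * e := by
  rw [← map_star]
  refine (Matrix.mul_diagonal (α := A) _ _ _ _).trans ?_
  congr 1
  exact Matrix.diagonal_mul (α := A) _ _ _ _

theorem star_unitNet_mul_mul {n k : ℕ} (h : n ≤ k) (M : Mat A n) (e : A) :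
    star (unitNet (k, e)) * emb n M * unitNet (k, e) =
      emb n (star (scalarHom A n e) * M * scalarHom A n e) := by
  rw [← emb_pad h, ← emb_pad h, unitNet, ← map_star, ← map_mul, ← map_mul]
  congr 1
  ext i j
  rw [star_scalarHom_mul_mul_apply]
  change star e * extend M i j * e = extend _ i j
  by_cases hij : (i : ℕ) < n ∧ (j : ℕ) < n
  · simp only [extend, dif_pos hij, star_scalarHom_mul_mul_apply]
  · rw [extend_of_le _ (by omega), extend_of_le _ (by omega), mul_zero, zero_mul]

theorem norm_unitNet_le {p : ℕ × A} (hp : ‖p.2‖ ≤ 1) : ‖unitNet p‖ ≤ 1 := by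
  rw [unitNet, norm_emb]
  exact (NonUnitalStarAlgHom.norm_apply_le _ _).trans hp

/-- On M_n(A), for sizes k ≥ n, conjugation by the net is entrywise conjugation by an approximate
unit of A. Density and ‖`unitNet p`‖ ≤ 1 extend the limit to all x. -/
theorem tendsto_unitNet (x : Stab A) :
    Tendsto (fun p => star (unitNet p) * x * unitNet p) (unitFilter A) (𝓝 x) := by
  have hemb : ∀ (n : ℕ) (M : Mat A n),
      Tendsto (fun p => star (unitNet p) * emb n M * unitNet p) (unitFilter A) (𝓝 (emb n M)) := by
    intro n M
    have h1 : Tendsto (fun e => star (scalarHom A n e) * M * scalarHom A n e)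
        (CStarAlgebra.approximateUnit A) (𝓝 M) := by
      refine tendsto_pi_nhds.2 fun i => tendsto_pi_nhds.2 fun j => ?_
      simp only [star_scalarHom_mul_mul_apply]
      exact tendsto_star_mul_mul _
    have h2 : Tendsto (fun p : ℕ × A => emb n (star (scalarHom A n p.2) * M * scalarHom A n p.2))
        (unitFilter A) (𝓝 (emb n M)) :=
      (((isometry_emb n).continuous.tendsto _).comp h1).comp tendsto_snd
    refine h2.congr' ?_
    filter_upwards [tendsto_fst.eventually (eventually_ge_atTop n)] with p hp
    exact (star_unitNet_mul_mul hp M p.2).symm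
  have hnorm : ∀ᶠ p in unitFilter A, ‖unitNet p‖ ≤ 1 :=
    (tendsto_snd.eventually
      (CStarAlgebra.increasingApproximateUnit A).eventually_norm).mono fun p => norm_unitNet_le
  rw [Metric.tendsto_nhds]
  intro e he
  obtain ⟨z, a, hz, hxz⟩ := exists_rep_near x (e := e / 3) (by positivity)
  obtain ⟨n, M, rfl⟩ := exists_emb_eq hz
  filter_upwards [hnorm, Metric.tendsto_nhds.1 (hemb n M) (e / 3) (by positivity)] with p hp hp'
  rw [dist_eq_norm] at hp' ⊢
  set U := unitNet p
  have h1 : star U * x * U - x = star U * (x - emb n M) * U +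
      (star U * emb n M * U - emb n M) + (emb n M - x) := by noncomm_ring
  have h2 : ‖star U * (x - emb n M) * U‖ ≤ ‖x - emb n M‖ := by
    calc _ ≤ ‖star U‖ * ‖x - emb n M‖ * ‖U‖ :=
          (norm_mul_le _ _).trans (mul_le_mul_of_nonneg_right (norm_mul_le _ _) (norm_nonneg _))
      _ ≤ 1 * ‖x - emb n M‖ * 1 := by
          rw [norm_star]; gcongr
      _ = _ := by ring
  rw [h1]
  refine norm_add₃_le.trans_lt ?_
  rw [norm_sub_rev (emb n M) x]
  linarith

theorem exists_emb_eq_unitNet (p : ℕ × A) (x : Stab A) :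
    ∃ K, emb p.1 K = star (unitNet p) * x * unitNet p := by
  rw [unitNet, ← map_star]
  exact exists_emb_eq_mul_mul _ _ x

end Corners

/-! ### The approximation of a by sums of conjugates of the b i in A ⊗ 𝒦. -/

section Core

theorem AmpSub.conj {B : Type*} [NonUnitalCStarAlgebra B] {k : ℕ} {a b : B}
    (h : ∀ e > 0, AmpSub k a b e) (u : B) : ∀ e > 0, AmpSub k (star u * a * u) b e := by
  intro e he
  obtain ⟨d, hd⟩ := h (e / (‖u‖ * ‖u‖ + 1)) (by positivity)
  refine ⟨fun l i => d l i * u, fun i j => ?_⟩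
  have h1 : (if i = j then star u * a * u else 0) - ∑ l, star (d l i * u) * b * (d l j * u) =
      star u * ((if i = j then a else 0) - ∑ l, star (d l i) * b * d l j) * u := by
    rw [mul_sub, sub_mul, Finset.mul_sum, Finset.sum_mul]
    congr 1
    · split_ifs <;> simp
    · simp only [star_mul, mul_assoc]
  rw [h1]
  set X := (if i = j then a else 0) - ∑ l, star (d l i) * b * d l j with hX
  have h2 : ‖star u * X * u‖ ≤ ‖u‖ * ‖u‖ * ‖X‖ := by
    calc _ ≤ ‖star u‖ * ‖X‖ * ‖u‖ :=
          (norm_mul_le _ _).trans (mul_le_mul_of_nonneg_right (norm_mul_le _ _) (norm_nonneg _))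
      _ = _ := by rw [norm_star]; ring
  have h3 := hd i j
  rw [lt_div_iff₀ (by positivity)] at h3
  nlinarith [norm_nonneg X, norm_nonneg u]

/-- At one fixed precision the comparison is a finite system of strict norm inequalities, so it
persists when b and all the d are compressed far enough along the approximate unit; a, already in a
corner, is merely padded. -/
theorem AmpSub.eventually {A : Type u} [NonUnitalCStarAlgebra A] [PartialOrder A]
    [StarOrderedRing A] {k : ℕ} {a b : Stab A} {e : ℝ} (h : AmpSub k a b e) {n : ℕ} {a' : Mat A n}
    (ha : a = emb n a') :
    ∀ᶠ p in unitFilter A, ∀ b' : Mat A p.1, emb p.1 b' = star (unitNet p) * b * unitNet p →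
      AmpSub k (pad p.1 a') b' e := by
  obtain ⟨d, hd⟩ := h
  have hU := tendsto_unitNet (A := A)
  have hlim : ∀ i j, Tendsto (fun p => ‖(if i = j then a else 0) - ∑ l,
      star (star (unitNet p) * d l i * unitNet p) * (star (unitNet p) * b * unitNet p) *
        (star (unitNet p) * d l j * unitNet p)‖) (unitFilter A)
      (𝓝 ‖(if i = j then a else 0) - ∑ l, star (d l i) * b * d l j‖) := by
    intro i j
    refine (tendsto_const_nhds.sub (tendsto_finsetSum _ fun l _ => ?_)).norm
    exact (((continuous_star.tendsto _).comp (hU (d l i))).mul (hU b)).mul (hU (d l j))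
  have hev := eventually_all.2 fun i => eventually_all.2 fun j =>
    (hlim i j).eventually_lt_const (hd i j)
  filter_upwards [hev, tendsto_fst.eventually (eventually_ge_atTop n)] with p hp hn b' hb'
  choose d' hd' using fun l i => exists_emb_eq_unitNet p (d l i)
  refine ⟨d', fun i j => ?_⟩
  rw [← norm_emb, map_sub, map_sum]
  simp only [map_mul, map_star, hd', hb']
  have h1 : emb p.1 (if i = j then pad p.1 a' else 0) = if i = j then a else 0 := by
    split_ifs
    · rw [emb_pad hn, ha]
    · exact map_zero _
  rw [h1]
  exact hp i j

theorem amp_pad {L : Type v} {E G : L → Type*} [∀ l, NonUnitalCStarAlgebra (E l)]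
    [∀ l, NonUnitalCStarAlgebra (G l)] [∀ l, PartialOrder (E l)] [∀ l, StarOrderedRing (E l)]
    [∀ l, PartialOrder (G l)] [∀ l, StarOrderedRing (G l)] (f : ∀ l, E l →ₗ[ℂ] G l) {n k : ℕ}
    (l : L) (M : Mat (E l) n) : amp f k l (pad k M) = pad k (amp f n l M) := by
  ext i j
  change f l (extend M i j) = extend (amp f n l M) i j
  unfold extend
  split_ifs
  · rfl
  · exact map_zero _

variable {A : Type u} [NonUnitalCStarAlgebra A] [PartialOrder A] [StarOrderedRing A]

/-- The order of choices is the point. First a is compressed into M_q(A); this fixes the number N of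
terms. Only then are the finitely many relevant b i compressed into a larger M_p(A). Enlarging p
does not disturb N, since the amplified maps commute with padding. -/
theorem exists_sum_near_of_ampSub (hA : NuclearDimLEOmega.{u, v, w} A) {a : Stab A} (ha : 0 ≤ a)
    {b : ℕ → Stab A} (hb : ∀ i, 0 ≤ b i) {k : ℕ → ℕ} (hab : ∀ i, ∀ e > 0, AmpSub (k i) a (b i) e)
    {e : ℝ} (he : 0 < e) : ∃ (N : ℕ) (x : ℕ → Stab A),
      ‖a - ∑ i ∈ Finset.range N, star (x i) * b i * x i‖ < e := by
  obtain ⟨L, _, _, _, F, _, _, _, _, ψ, φ, hψ, hφ, hin, hout, hsum⟩ := hA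
  have hsum' : ∀ a : A, ∀ e > 0, ∃ n, ∀ m ≥ n, ∀ᶠ l in atTop,
      ‖a - ∑ i ∈ Finset.range m, φ i l (ψ i l a)‖ < e := fun a e he =>
    eventually_norm_sub_sum_lt hψ hφ (hsum a) he
  obtain ⟨q, hq⟩ := (Metric.tendsto_nhds.1 (tendsto_unitNet a) (e / 2) (half_pos he)).exists
  rw [dist_comm, dist_eq_norm] at hq
  obtain ⟨a', ha'⟩ := exists_emb_eq_unitNet q a
  set a₁ := star (unitNet q) * a * unitNet q with ha₁
  have ha'nn : 0 ≤ a' := by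
    refine nonneg_of_map_nonneg (emb q.1) (isometry_emb q.1) ?_
    rw [ha', ha₁]
    exact star_left_conjugate_nonneg ha _
  have hab₁ : ∀ i, ∀ e > 0, AmpSub (k i) a₁ (b i) e := fun i => AmpSub.conj (hab i) _
  -- Compressing a costs e/2, truncating the series e/4, and replacing the N terms by conjugates of
  -- the b i another e/4.
  obtain ⟨N, hN⟩ := eventually_norm_sub_sum_amp_lt hsum' a' (e := e / 4) (by positivity)
  have hpos : 0 < (e / 2 - e / 4) / ((N : ℝ) + 1) := div_pos (by linarith) (by positivity)
  have hev : ∀ᶠ p in unitFilter A, ∀ i ∈ Finset.range N, ∀ b' : Mat A p.1,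
      emb p.1 b' = star (unitNet p) * b i * unitNet p →
      AmpSub (k i) (pad p.1 a') b' (tol (k i) ‖a'‖ ((e / 2 - e / 4) / ((N : ℝ) + 1))) := by
    rw [eventually_all_finset]
    intro i _
    exact (hab₁ i _ (tol_pos _ _ hpos)).eventually ha'.symm
  obtain ⟨p, hp, hpn⟩ := (hev.and (tendsto_fst.eventually (eventually_ge_atTop q.1))).exists
  have hpad : ∀ M : Mat A q.1, ‖pad p.1 M‖ = ‖M‖ := fun M => by
    rw [← norm_emb, emb_pad hpn, norm_emb]
  choose b' hb' using fun i => exists_emb_eq_unitNet p (b i)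
  have hb'nn : ∀ i, 0 ≤ b' i := by
    intro i
    refine nonneg_of_map_nonneg (emb p.1) (isometry_emb p.1) ?_
    rw [hb']
    exact star_left_conjugate_nonneg (hb i) _
  have hpadnn : 0 ≤ pad p.1 a' := by
    refine nonneg_of_map_nonneg (emb p.1) (isometry_emb p.1) ?_
    rw [emb_pad hpn]
    exact map_nonneg (emb q.1) ha'nn
  obtain ⟨x, hx⟩ := OrderZeroNet.exists_sum_near
    (fun i => OrderZeroNet.amp (hψ i) (hφ i) (hin i) (hout i) p.1)
    (fun M e he => eventually_norm_sub_sum_amp_lt hsum' M he) hpadnn hb'nn (k := k) (n := N)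
    (e := e / 4) (e' := e / 2) (by linarith)
    (fun i hi => by rw [hpad]; exact hp i (Finset.mem_range.2 hi) _ (hb' i)) (by
      filter_upwards [hN N le_rfl] with l hl
      have h1 : pad p.1 a' - ∑ i ∈ Finset.range N, amp (φ i) p.1 l (amp (ψ i) p.1 l (pad p.1 a')) =
          pad p.1 (a' - ∑ i ∈ Finset.range N, amp (φ i) q.1 l (amp (ψ i) q.1 l a')) := by
        refine (emb_injective p.1) ?_
        rw [emb_pad hpn, map_sub, map_sum, map_sub, map_sum, emb_pad hpn]
        congr 1
        refine Finset.sum_congr rfl fun i _ => ?_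
        rw [amp_pad, amp_pad, emb_pad hpn]
      rw [h1, hpad]
      exact hl)
  refine ⟨N, fun i => unitNet p * emb p.1 (x i), ?_⟩
  have h1 : emb p.1 (pad p.1 a' - ∑ i ∈ Finset.range N, star (x i) * b' i * x i) =
      a₁ - ∑ i ∈ Finset.range N, star (unitNet p * emb p.1 (x i)) * b i *
        (unitNet p * emb p.1 (x i)) := by
    rw [map_sub, map_sum, emb_pad hpn, ha']
    congr 1
    refine Finset.sum_congr rfl fun i _ => ?_
    rw [map_mul, map_mul, map_star, hb', star_mul]
    simp only [mul_assoc]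
  rw [← norm_emb, h1] at hx
  refine (norm_sub_le_norm_sub_add_norm_sub _ a₁ _).trans_lt ?_
  linarith

end Core

/-! ### Representing classes by elements of A ⊗ 𝒦, and suprema of partial sums. -/

section Classes

variable {B : Type u} [NonUnitalCStarAlgebra B] [PartialOrder B] [StarOrderedRing B]

theorem conjTranspose_mul_mul_apply {m n : ℕ} (b : Mat B n) (d : CStarMatrix (Fin n) (Fin m) B)
    (i j : Fin m) :
    (d.conjTranspose * b * d) i j = ∑ l, ∑ l', star (d l i) * b l l' * d l' j := by
  rw [CStarMatrix.mul_apply, Finset.sum_comm]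
  refine Finset.sum_congr rfl fun l' _ => ?_
  rw [CStarMatrix.mul_apply, Finset.sum_mul]
  rfl

theorem cuntzLE_iff {m n : ℕ} {a : Mat B m} {b : Mat B n} :
    CuntzLE a b ↔ ∀ e > 0, ∃ d : Fin n → Fin m → B,
      ∀ i j, ‖a i j - ∑ l, ∑ l', star (d l i) * b l l' * d l' j‖ < e := by
  rw [CuntzLE, Metric.mem_closure_iff]
  simp only [Set.exists_range_iff, dist_eq_norm]
  constructor
  · intro h e he
    obtain ⟨d, hd⟩ := h e he
    refine ⟨d, fun i j => ?_⟩
    rw [← conjTranspose_mul_mul_apply]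
    exact (CStarMatrix.norm_entry_le_norm (M := a - d.conjTranspose * b * d)).trans_lt hd
  · intro h e he
    obtain ⟨d, hd⟩ := h (e / (m * m + 1)) (by positivity)
    refine ⟨CStarMatrix.ofMatrix d, (norm_le_sum_entries _).trans_lt ?_⟩
    have h1 : ∀ i j, ‖(a - (CStarMatrix.ofMatrix d).conjTranspose * b * CStarMatrix.ofMatrix d) i j‖
        ≤ e / (m * m + 1) := by
      intro i j
      rw [CStarMatrix.sub_apply, conjTranspose_mul_mul_apply]
      exact (hd i j).le
    refine (Finset.sum_le_sum fun i _ => Finset.sum_le_sum fun j _ => h1 i j).trans_lt ?_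
    simp only [Finset.sum_const, Finset.card_univ, Fintype.card_fin, nsmul_eq_mul]
    rw [← mul_assoc, ← mul_div_assoc, div_lt_iff₀ (by positivity)]
    nlinarith

theorem CuntzLE.of_eq {m n : ℕ} {a : Mat B m} {b : Mat B n} (d : Fin n → Fin m → B)
    (h : ∀ i j, a i j = ∑ l, ∑ l', star (d l i) * b l l' * d l' j) : CuntzLE a b :=
  cuntzLE_iff.2 fun e he => ⟨d, fun i j => by rw [h, sub_self, norm_zero]; exact he⟩

/-- The diagonal matrix with entries `b 0, …, b (n - 1)`. -/
def diagMat (n : ℕ) (b : ℕ → B) : Mat B n :=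
  CStarMatrix.ofMatrix (Matrix.diagonal fun i : Fin n => b i)

theorem diagMat_apply (n : ℕ) (b : ℕ → B) (i j : Fin n) :
    diagMat n b i j = if i = j then b i else 0 := rfl

theorem diagMat_mul (n : ℕ) (b c : ℕ → B) :
    diagMat n b * diagMat n c = diagMat n fun i => b i * c i :=
  Matrix.diagonal_mul_diagonal (α := B) (n := Fin n) (fun i => b i) fun i => c i

theorem star_diagMat (n : ℕ) (b : ℕ → B) : star (diagMat n b) = diagMat n fun i => star (b i) :=
  Matrix.diagonal_conjTranspose (α := B) (n := Fin n) fun i => b i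

theorem diagMat_nonneg (n : ℕ) {b : ℕ → B} (hb : ∀ i, 0 ≤ b i) : 0 ≤ diagMat n b := by
  choose c hc using fun i => exists_eq_star_mul_self (hb i)
  have : diagMat n b = star (diagMat n c) * diagMat n c := by
    rw [star_diagMat, diagMat_mul]
    simp only [← hc]
  rw [this]
  exact star_mul_self_nonneg _

/-- The diagonal matrix with entries `b 0, …, b (n - 1)`, as a positive matrix. -/
def posDiag (n : ℕ) {b : ℕ → B} (hb : ∀ i, 0 ≤ b i) : PosMat B := ⟨n, diagMat n b, diagMat_nonneg n hb⟩

/-- The class of a positive element. -/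
def cls {a : B} (ha : 0 ≤ a) : CuntzW B := CuntzW.mk (posDiag 1 fun _ => ha)

theorem sum_cls {b : ℕ → B} (hb : ∀ i, 0 ≤ b i) (n : ℕ) :
    ∑ i ∈ Finset.range n, cls (hb i) = CuntzW.mk (posDiag n hb) := by
  induction n with
  | zero =>
    refine congrArg CuntzW.mk (?_ : (⟨0, 0, le_rfl⟩ : PosMat B) = _)
    refine congrArg (Sigma.mk 0) (Subtype.ext ?_)
    ext i
    exact i.elim0
  | succ n ih =>
    rw [Finset.sum_range_succ, ih, cls, ← CuntzW.mk_add]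
    refine congrArg CuntzW.mk (congrArg (Sigma.mk (n + 1)) (Subtype.ext ?_))
    ext i j
    change blockDiag (diagMat n b) (diagMat 1 fun _ => b n) (finSumFinEquiv.symm i)
      (finSumFinEquiv.symm j) = diagMat (n + 1) b i j
    obtain ⟨i, rfl⟩ := (finSumFinEquiv (m := n) (n := 1)).surjective i
    obtain ⟨j, rfl⟩ := (finSumFinEquiv (m := n) (n := 1)).surjective j
    change blockDiag (diagMat n b) (diagMat 1 fun _ => b n)
      ((finSumFinEquiv (m := n) (n := 1)).symm (finSumFinEquiv i))
      ((finSumFinEquiv (m := n) (n := 1)).symm (finSumFinEquiv j)) =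
      diagMat (n + 1) b (finSumFinEquiv i) (finSumFinEquiv j)
    rw [Equiv.symm_apply_apply, Equiv.symm_apply_apply, diagMat_apply]
    rcases i with i | i <;> rcases j with j | j
    · change diagMat n b i j = _
      simp [diagMat_apply, Fin.ext_iff]
    · change (0 : B) = _
      rw [if_neg]
      have := i.2
      simp [Fin.ext_iff]
      omega
    · change (0 : B) = _
      rw [if_neg]
      have := j.2
      simp [Fin.ext_iff]
      omega
    · change diagMat 1 (fun _ => b n) i j = _
      have hij : i = j := Subsingleton.elim _ _
      subst hij
      simp [diagMat_apply]

theorem sum_diagMat (n : ℕ) (b : ℕ → B) (x y : Fin n → B) :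
    ∑ l, ∑ l', x l * diagMat n b l l' * y l' = ∑ l, x l * b l * y l := by
  refine Finset.sum_congr rfl fun l _ => ?_
  simp only [diagMat_apply, mul_ite, ite_mul, mul_zero, zero_mul, Finset.sum_ite_eq,
    Finset.mem_univ, if_true]

theorem diagMat_one_apply (a : B) (i j : Fin 1) : diagMat 1 (fun _ => a) i j = a :=
  if_pos (Subsingleton.elim _ _)

theorem cls_le_cls {a b : B} (ha : 0 ≤ a) (hb : 0 ≤ b) : cls ha ≤ cls hb ↔ Sub a b := by
  change CuntzLE (diagMat 1 fun _ => a) (diagMat 1 fun _ => b) ↔ _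
  rw [cuntzLE_iff, sub_iff]
  refine forall₂_congr fun e _ => ⟨fun ⟨d, hd⟩ => ⟨d 0 0, ?_⟩, fun ⟨d, hd⟩ => ⟨fun _ _ => d, ?_⟩⟩
  · simpa [sum_diagMat, diagMat_one_apply] using hd 0 0
  · intro i j
    simpa [sum_diagMat, diagMat_one_apply] using hd

theorem cls_le_mk_posDiag {a : B} (ha : 0 ≤ a) {b : ℕ → B} (hb : ∀ i, 0 ≤ b i) {n : ℕ}
    (x : ℕ → B) (h : a = ∑ i ∈ Finset.range n, star (x i) * b i * x i) :
    cls ha ≤ CuntzW.mk (posDiag n hb) := by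
  change CuntzLE (diagMat 1 fun _ => a) (diagMat n b)
  refine CuntzLE.of_eq (fun l _ => x l) fun i j => ?_
  rw [diagMat_one_apply, sum_diagMat, h]
  exact (Fin.sum_univ_eq_sum_range (fun l => star (x l) * b l * x l) n).symm

/-- A multiple n[c] is the class of a constant diagonal matrix; the entries of the resulting matrix
comparison are the required estimates. -/
theorem LEs.ampSub {a b : B} {ha : 0 ≤ a} {hb : 0 ≤ b} (h : LEs (cls ha) (cls hb)) :
    ∃ k, ∀ e > 0, AmpSub k a b e := by
  obtain ⟨k, hk⟩ := h
  refine ⟨k, fun e he => ?_⟩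
  have h1 : ∀ (n : ℕ) {c : B} (hc : 0 ≤ c), n • cls hc = CuntzW.mk (posDiag n fun _ => hc) := by
    intro n c hc
    rw [← sum_cls, Finset.sum_const, Finset.card_range]
  rw [h1, h1] at hk
  have hk' : CuntzLE (diagMat (k + 1) fun _ => a) (diagMat k fun _ => b) := hk
  obtain ⟨d, hd⟩ := cuntzLE_iff.1 hk' e he
  refine ⟨d, fun i j => ?_⟩
  have h2 := hd i j
  rwa [sum_diagMat, diagMat_apply] at h2

theorem cuntzLE_mul_self {n : ℕ} {M : Mat B n} (hM : 0 ≤ M) : CuntzLE M (M * M) :=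
  Sub.mul_self hM

variable {V : ℕ → B → B}

/-- If there are isometries in the multiplier algebra with orthogonal ranges, then every class has
a representative in `B`. -/
theorem exists_cls_eq (hV : ∀ p q c d, star (V p c) * V q d = if p = q then star c * d else 0)
    (x : CuntzW B) : ∃ (a : B) (ha : 0 ≤ a), x = cls ha := by
  induction x using CuntzW.ind with
  | h P =>
  obtain ⟨n, M, hM⟩ := P
  obtain ⟨c, hc⟩ := exists_eq_star_mul_self hM
  -- The isometries fold the columns of c into one row D with D⋆ D = M. Then S = D D⋆ lies in B and
  -- is Cuntz equivalent to M, since M ≲ M² = D⋆ S D and S ≲ S² = D M D⋆.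
  obtain ⟨D, hDM⟩ : ∃ D : Fin n → B, ∀ q r, star (D q) * D r = M q r := by
    refine ⟨fun q => ∑ p : Fin n, V p (c p q), fun q r => ?_⟩
    simp only [star_sum, Finset.sum_mul_sum, hV, Fin.val_inj, Finset.sum_ite_eq,
      Finset.mem_univ, if_true]
    rw [hc, CStarMatrix.mul_apply]
    rfl
  set S := ∑ q, D q * star (D q) with hS
  have hSnn : 0 ≤ S := Finset.sum_nonneg fun q _ => mul_star_self_nonneg _
  refine ⟨S, hSnn, le_antisymm ?_ ?_⟩
  · change CuntzLE M (diagMat 1 fun _ => S)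
    refine (cuntzLE_mul_self hM).trans (CuntzLE.of_eq (fun _ i => D i) fun i j => ?_)
    have h1 : (M * M) i j = star (D i) * S * D j := by
      rw [CStarMatrix.mul_apply, hS, Finset.mul_sum, Finset.sum_mul]
      refine Finset.sum_congr rfl fun k _ => ?_
      rw [← hDM, ← hDM]
      simp only [mul_assoc]
    rw [h1, sum_diagMat]
    simp
  · change CuntzLE (diagMat 1 fun _ => S) M
    refine (cuntzLE_mul_self (diagMat_nonneg 1 fun _ => hSnn)).trans
      (CuntzLE.of_eq (fun q _ => star (D q)) fun i j => ?_)
    rw [diagMat_mul, diagMat_one_apply, hS, Finset.sum_mul_sum]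
    refine Finset.sum_congr rfl fun q _ => Finset.sum_congr rfl fun r _ => ?_
    rw [star_star, ← hDM]
    simp only [mul_assoc]

/-- With w_i⋆ w_j = δ_ij b_i, the element s = ∑ t_i w_i w_i⋆ is an orthogonal sum of copies of the
b_i, where the weights t_i only secure convergence. It dominates each partial sum because w_i⋆ s w_j
= δ_ij t_i b_i², and it is least because it is the norm limit of its truncations. -/
theorem exists_isLUB_cls (hV : ∀ p q c d, star (V p c) * V q d = if p = q then star c * d else 0)
    {b : ℕ → B} (hb : ∀ i, 0 ≤ b i) : ∃ (s : B) (hs : 0 ≤ s),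
      IsLUB (Set.range fun n : ℕ => ∑ i ∈ Finset.range n, cls (hb i)) (cls hs) := by
  choose c hc using fun i => exists_eq_star_mul_self (hb i)
  set w : ℕ → B := fun i => V i (c i) with hw
  have hww : ∀ i j, star (w i) * w j = if i = j then b i else 0 := by
    intro i j
    rw [hw, hV]
    split_ifs with h
    · rw [hc, h]
    · rfl
  set t : ℕ → ℝ := fun i => (1 / 2) ^ i / (‖b i‖ + 1) with ht
  have ht0 : ∀ i, 0 < t i := fun i => by positivity
  set f : ℕ → B := fun i => t i • (w i * star (w i)) with hf
  have hfnn : ∀ i, 0 ≤ f i := fun i => smul_nonneg (ht0 i).le (mul_star_self_nonneg _)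
  have hfsum : Summable f := by
    refine Summable.of_norm_bounded (g := fun i : ℕ => (1 / 2 : ℝ) ^ i) summable_geometric_two
      fun i => ?_
    rw [norm_smul, Real.norm_of_nonneg (ht0 i).le, CStarRing.norm_self_mul_star,
      ← CStarRing.norm_star_mul_self, hww, if_pos rfl, ht, div_mul_eq_mul_div,
      div_le_iff₀ (by positivity)]
    have : 0 < (1 / 2 : ℝ) ^ i := by positivity
    nlinarith
  obtain ⟨s, hs⟩ := hfsum
  have hsnn : 0 ≤ s := hs.nonneg hfnn
  refine ⟨s, hsnn, ?_, ?_⟩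
  · rintro _ ⟨n, rfl⟩
    simp only [sum_cls]
    change CuntzLE (diagMat n b) (diagMat 1 fun _ => s)
    refine (cuntzLE_mul_self (diagMat_nonneg n hb)).trans
      (CuntzLE.of_eq (fun _ i => (√(t i))⁻¹ • w i) fun i j => ?_)
    have h1 : HasSum (fun k => star (w i) * f k * w j) (star (w i) * s * w j) :=
      (hs.mul_left _).mul_right _
    have h2 : ∀ k, star (w i) * f k * w j =
        if k = i then (if (i : ℕ) = j then t i • (b i * b i) else 0) else 0 := by
      intro k
      have h3 : star (w i) * f k * w j = t k • ((star (w i) * w k) * (star (w k) * w j)) := by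
        simp only [hf, mul_smul_comm, smul_mul_assoc, mul_assoc]
      rw [h3, hww, hww]
      by_cases hki : k = i
      · subst hki
        simp only [if_true]
        split_ifs
        · rfl
        · rw [mul_zero, smul_zero]
      · rw [if_neg (Ne.symm hki), if_neg hki, zero_mul, smul_zero]
    simp only [h2] at h1
    have h4 := h1.unique (hasSum_ite_eq (i : ℕ) _)
    have h5 : star ((√(t i))⁻¹ • w i) * s * ((√(t j))⁻¹ • w j) =
        ((√(t i))⁻¹ * (√(t j))⁻¹) • (star (w i) * s * w j) := by
      rw [star_smul, star_trivial, smul_mul_assoc, smul_mul_assoc, mul_smul_comm, smul_smul]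
    rw [sum_diagMat, Fin.sum_univ_one, h5]
    rw [h4, diagMat_mul, diagMat_apply]
    simp only [Fin.val_inj]
    split_ifs with hij
    · subst hij
      rw [smul_smul, ← mul_inv, Real.mul_self_sqrt (ht0 i).le, inv_mul_cancel₀ (ht0 i).ne',
        one_smul]
    · rw [smul_zero]
  · intro u hu
    -- Every upper bound has a representative T in B itself, so closedness of Cuntz subequivalence
    -- reduces s ≲ T to truncations. A truncation is below its square ∑ t_i² w_i b_i w_i⋆, hence
    -- below a partial sum.
    obtain ⟨T, hT, rfl⟩ := exists_cls_eq hV u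
    rw [cls_le_cls]
    refine Sub.of_forall fun e he => ?_
    obtain ⟨n, hn⟩ := ((Metric.tendsto_atTop.1 hs.tendsto_sum_nat) e he)
    refine ⟨∑ i ∈ Finset.range n, f i, ?_, ?_⟩
    · have hnn : 0 ≤ ∑ i ∈ Finset.range n, f i := Finset.sum_nonneg fun i _ => hfnn i
      have hsq : 0 ≤ (∑ i ∈ Finset.range n, f i) * ∑ i ∈ Finset.range n, f i := by
        simpa [(IsSelfAdjoint.of_nonneg hnn).star_eq] using
          star_mul_self_nonneg (∑ i ∈ Finset.range n, f i)
      refine (Sub.mul_self hnn).trans ((cls_le_cls hsq hT).1 ?_)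
      refine (cls_le_mk_posDiag hsq hb (n := n) (fun i => t i • star (w i)) ?_).trans
        ((sum_cls hb n).symm.trans_le (hu ⟨n, rfl⟩))
      rw [Finset.sum_mul_sum]
      refine Finset.sum_congr rfl fun i hi => ?_
      have h1 : ∀ j, f i * f j = if i = j then
          star (t i • star (w i)) * b i * (t i • star (w i)) else 0 := by
        intro j
        have h3 : f i * f j = (t i * t j) • (w i * (star (w i) * w j) * star (w j)) := by
          simp only [hf, mul_smul_comm, smul_mul_assoc, mul_assoc, smul_smul, mul_comm]
        rw [h3, hww]
        split_ifs with hij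
        · subst hij
          rw [star_smul, star_star, star_trivial (t i), smul_mul_assoc, smul_mul_assoc, mul_smul_comm,
            smul_smul]
        · rw [mul_zero, zero_mul, smul_zero]
      simp only [h1, Finset.sum_ite_eq, hi, if_true]
    · have := hn n le_rfl
      rwa [dist_comm, dist_eq_norm] at this

end Classes

end CuntzComparison

end

theorem theorem3p3 {A : Type u} [NonUnitalCStarAlgebra A] [PartialOrder A] [StarOrderedRing A]
    (hA : CuntzComparison.NuclearDimLEOmega.{u, v, w} A) :
    CuntzComparison.OmegaComparison (CuntzComparison.Cu A) := by
  intro x y hxy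
  obtain ⟨V, hV⟩ := CuntzComparison.exists_isometries A
  obtain ⟨a, ha, rfl⟩ := CuntzComparison.exists_cls_eq hV x
  choose b hb hyb using fun i => CuntzComparison.exists_cls_eq hV (y i)
  obtain rfl : y = fun i => CuntzComparison.cls (hb i) := funext hyb
  choose k hk using fun i => (hxy i).ampSub
  obtain ⟨s, hs, hlub⟩ := CuntzComparison.exists_isLUB_cls hV hb
  refine ⟨_, hlub, (CuntzComparison.cls_le_cls ha hs).2 ?_⟩
  -- Each approximant ∑ z_i⋆ b_i z_i of a is below a finite partial sum, hence below s.
  refine CuntzComparison.Sub.of_forall fun e he => ?_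
  obtain ⟨N, z, hz⟩ := CuntzComparison.exists_sum_near_of_ampSub hA ha hb hk he
  have hnn : 0 ≤ ∑ i ∈ Finset.range N, star (z i) * b i * z i :=
    Finset.sum_nonneg fun i _ => star_left_conjugate_nonneg (hb i) _
  refine ⟨_, (CuntzComparison.cls_le_cls hnn hs).1 ?_, hz⟩
  exact (CuntzComparison.cls_le_mk_posDiag hnn hb z rfl).trans
    ((CuntzComparison.sum_cls hb N).symm.trans_le (hlub.1 ⟨N, rfl⟩))
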